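/- **Theorem (error bound for $m=3$).** Let $d,n\ge 1$. Let $A_1,\dots,A_d\in\mathbb R^{n\times n}$ be symmetric, $E\in\mathbb R^{n\times n}$ skew-symmetric, $T:\mathbb R^n\times\mathbb R^n\times\mathbb R^n\to\mathbb R^n$ trilinear (extended to a complex trilinear map on $\mathbb C^n$), $\kappa\in\mathbb R^d\setminus\{0\}$ and $\omega\in\mathbb R$. Put $A(\beta)=\sum_\ell\beta_\ell A_\ell$, $A(\partial)=\sum_\ell A_\ell\partial_\ell$ and $\mathcal L(\alpha,\beta)=-\alpha I+A(\beta)-\mathrm iE$. Let $W$ be the Wiener algebra of functions $f:\mathbb R^d\to\mathbb C^n$ with $\widehat f\in L^1$, where $\widehat f(k)=(2\pi)^{-d/2}\int f(x)e^{-\mathrm ik\cdot x}\,dx$ (in the sense of tempered distributions), with norm $\|f\|_W=\int_{\mathbb R^d}|\widehat f(k)|_2\,dk$, and let $W^3$ be the space of all $f\in W$ with $\partial^\alpha f\in W$ for $|\alpha|_1\le 3$. Assume: 1. $\ker\mathcal L(\omega,\kappa)$ is one-dimensional. 2. $p=p_0+\varepsilon p_1$ with $p_0,p_1\in W^3$ independent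 of $\varepsilon$, and $p_0(x)\in\ker\mathcal L(\omega,\kappa)$ for a.e. $x$. 3. For $\beta\in\mathbb R^d$ the matrix $\mathcal L(0,\beta)$ has eigenvalues $\omega_1(\beta),\dots,\omega_n(\beta)$ with an orthonormal basis of eigenvectors $\psi_1(\beta),\dots,\psi_n(\beta)$, where all $\omega_\ell$ and $\psi_\ell$ are $C^\infty$ on $\mathbb R^d\setminus\{0\}$, all $\omega_\ell$ are globally Lipschitz continuous on $\mathbb R^d$, $\omega_1(\kappa)=\omega$, and there is a $c>0$ such that $|\omega-\omega_\ell(\beta)|\ge c$ for all $\beta\in\mathbb R^d$ and $\ell=2,\dots,n$. 4. $\mathcal L(3\omega,3\kappa)$ is regular and has no common eigenvalue with $\mathcal L(\omega,\kappa)$. 5. $\mathcal L(5\omega,5\kappa)$ is regular and has no common eigenvalue with $\mathcal L(3\omega,3\kappa)$. Let $t_{\rm end}>0$. Then there are $t_\star\in(0,t_{\rm end}]$ and $C>0$, both independent of $\varepsilon$, such that the following holds for every $\varepsilon\in(0,1]$. Let $u\in C([0,t_{\rm end}/\varepsilon],W)$ be a mild solution of $$\partial_tu+A(\partial)u+\tfrac1\varepsilon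 Eu=\varepsilon T(u,u,u),\qquad u(0,x)=p(x)e^{\mathrm i\kappa\cdot x/\varepsilon}+\text{c.c.},$$ where c.c. denotes the complex conjugate, and let $u_1,u_3\in C([0,t_{\rm end}/\varepsilon],W)$ be a mild solution of the coupled system $$\partial_tu_j+\tfrac{\mathrm i}\varepsilon\mathcal L(j\omega,j\kappa)u_j+A(\partial)u_j=\varepsilon\sum_{j_1+j_2+j_3=j}T(u_{j_1},u_{j_2},u_{j_3}),\qquad j\in\{1,3\},$$ with $u_1(0)=p$, $u_3(0)=0$, where the sum is over $j_1,j_2,j_3\in\{\pm1,\pm3\}$ and $u_{-j}=\overline{u_j}$. Set $$\widetilde u^{(3)}(t,x)=\sum_{j\in\{\pm1,\pm3\}}e^{\mathrm ij(\kappa\cdot x-\omega t)/\varepsilon}u_j(t,x).$$ Then $$\sup_{t\in[0,t_\star/\varepsilon]}\|u(t)-\widetilde u^{(3)}(t)\|_W\le C\varepsilon^3,\qquad \sup_{t\in[0,t_\star/\varepsilon]}\|u(t)-\widetilde u^{(3)}(t)\|_{L^\infty}\le C\varepsilon^3.$$ -/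

import Mathlib

open MeasureTheory Set Filter Topology
open scoped ENNReal SchwartzMap

noncomputable section

namespace NLDispersive

/-- Points (and frequencies) of `ℝ^d`. -/
abbrev Sp (d : ℕ) := EuclideanSpace ℝ (Fin d)

/-- The value space `ℂ^n` with its Euclidean norm. -/
abbrev Vec (n : ℕ) := EuclideanSpace ℂ (Fin n)

variable {d n : ℕ}

/-- Matrix times vector on `ℂ^n`. -/
def mulV (M : Matrix (Fin n) (Fin n) ℂ) (v : Vec n) : Vec n :=
  WithLp.toLp 2 (M.mulVec v.ofLp)

/-- Componentwise complex conjugation on `ℂ^n`. -/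
def conjV (v : Vec n) : Vec n := WithLp.toLp 2 (fun i => (starRingEnd ℂ) (v i))

/-! ### The Wiener algebra -/

/-- Inverse Fourier transform
`(𝓕⁻¹ g)(x) = (2π)^{-d/2} ∫ g(k) e^{i k·x} dk`. -/
def invFourier (g : Sp d → Vec n) (x : Sp d) : Vec n :=
  (((2 * Real.pi) ^ (-(d : ℝ) / 2) : ℝ) : ℂ) •
    ∫ k, Complex.exp (Complex.I * ((inner ℝ k x : ℝ) : ℂ)) • g k

/-- The Fourier transform of `f` (as a tempered distribution) is the integrable function `g`;
by Fourier inversion this means that `f` is the inverse Fourier transform of `g`.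
Elements of the Wiener algebra are represented by their continuous representatives. -/
def HasFourier (f g : Sp d → Vec n) : Prop :=
  Integrable g ∧ ∀ x, f x = invFourier g x

/-- Membership in the Wiener algebra `W`. -/
def MemW (f : Sp d → Vec n) : Prop := ∃ g, HasFourier f g

open Classical in
/-- The Fourier transform of an element of `W` (unique up to null sets). -/
def hat (f : Sp d → Vec n) : Sp d → Vec n :=
  if h : MemW f then h.choose else 0

/-- The norm `‖f‖_W = ‖f̂‖_{L¹}`, with value `∞` if `f` is not in `W`. -/
def normW (f : Sp d → Vec n) : ℝ≥0∞ :=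
  ⨅ (g : Sp d → Vec n) (_ : HasFourier f g), ∫⁻ k, ‖g k‖ₑ

/-- `h` is the partial derivative `∂_ℓ f` in the sense of tempered distributions. -/
def IsPartial (l : Fin d) (f h : Sp d → Vec n) : Prop :=
  ∀ φ : 𝓢(Sp d, ℂ),
    ∫ x, (fderiv ℝ (φ : Sp d → ℂ) x (EuclideanSpace.single l (1 : ℝ))) • f x
      = -∫ x, φ x • h x

/-- Membership in `W^s`: all distributional derivatives of order at most `s` are in `W`. -/
def MemWs : ℕ → (Sp d → Vec n) → Prop
  | 0, f => MemW f
  | s + 1, f => MemW f ∧ ∀ l : Fin d, ∃ h, IsPartial l f h ∧ MemWs s h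

/-! ### The symbol of the Friedrichs system -/

/-- `A(β) = ∑_ℓ β_ℓ A_ℓ`, as a complex matrix. -/
def symbolA (A : Fin d → Matrix (Fin n) (Fin n) ℝ) (β : Sp d) : Matrix (Fin n) (Fin n) ℂ :=
  ∑ l, ((β l : ℝ) : ℂ) • (A l).map Complex.ofReal

/-- `𝓛(α, β) = -α I + A(β) - i E`. -/
def symbolL (A : Fin d → Matrix (Fin n) (Fin n) ℝ) (E : Matrix (Fin n) (Fin n) ℝ)
    (α : ℝ) (β : Sp d) : Matrix (Fin n) (Fin n) ℂ :=
  -((α : ℂ) • (1 : Matrix (Fin n) (Fin n) ℂ)) + symbolA A β - Complex.I • E.map Complex.ofReal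

/-- Real trilinear maps `ℝ^n × ℝ^n × ℝ^n → ℝ^n`. -/
abbrev Trilin (n : ℕ) :=
  (Fin n → ℝ) →ₗ[ℝ] (Fin n → ℝ) →ₗ[ℝ] (Fin n → ℝ) →ₗ[ℝ] (Fin n → ℝ)

/-- The complex trilinear extension of a real trilinear map. -/
def extT (T : Trilin n) (a b c : Vec n) : Vec n :=
  WithLp.toLp 2 (fun i => ∑ j, ∑ k, ∑ l,
    ((T (Pi.single j 1) (Pi.single k 1) (Pi.single l 1) i : ℝ) : ℂ) * a j * b k * c l)

/-! ### Mild solutions -/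

/-- The solution operator at time `t` of `∂_t v + A(∂) v + B v = 0`, as a Fourier multiplier:
`(S(t) f)^(k) = exp(-t (B + i A(k))) f̂(k)`. -/
def propagator (A : Fin d → Matrix (Fin n) (Fin n) ℝ) (B : Matrix (Fin n) (Fin n) ℂ)
    (t : ℝ) (f : Sp d → Vec n) : Sp d → Vec n :=
  invFourier fun k =>
    mulV (NormedSpace.exp (-((t : ℂ) • (B + Complex.I • symbolA A k)))) (hat f k)

/-- `v ∈ C([0, τ], W)`. -/
def ContinuousInW (τ : ℝ) (v : ℝ → Sp d → Vec n) : Prop :=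
  (∀ t ∈ Icc 0 τ, MemW (v t)) ∧
  ∀ t ∈ Icc 0 τ, Tendsto (fun s => normW (fun x => v s x - v t x)) (𝓝[Icc 0 τ] t) (𝓝 0)

/-- `v ∈ C([0, τ], W)` is a mild solution of
`∂_t v + A(∂) v + B v = F`, `v(0) = v₀` on `[0, τ]` (Duhamel's formula). -/
def IsMild (A : Fin d → Matrix (Fin n) (Fin n) ℝ) (B : Matrix (Fin n) (Fin n) ℂ)
    (v₀ : Sp d → Vec n) (F : ℝ → Sp d → Vec n) (τ : ℝ) (v : ℝ → Sp d → Vec n) : Prop :=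
  ContinuousInW τ v ∧
  ∀ t ∈ Icc 0 τ, ∀ x,
    v t x = propagator A B t v₀ x + ∫ s in (0 : ℝ)..t, propagator A B (t - s) (F s) x

/-- The carrier wave `e^{i j (κ·x - ω t)/ε}`. -/
def carrier (κ : Sp d) (ω ε : ℝ) (j : ℤ) (t : ℝ) (x : Sp d) : ℂ :=
  Complex.exp (Complex.I * (((j : ℝ) * ((inner ℝ κ x : ℝ) - ω * t) / ε : ℝ) : ℂ))

/-- `u` is a mild solution on `[0, τ]` of the original problem
`∂_t u + A(∂) u + ε⁻¹ E u = ε T(u,u,u)`, `u(0,x) = p(x) e^{i κ·x/ε} + c.c.` -/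
def SolvesOriginal (A : Fin d → Matrix (Fin n) (Fin n) ℝ) (E : Matrix (Fin n) (Fin n) ℝ)
    (T : Trilin n) (κ : Sp d) (ε : ℝ) (p : Sp d → Vec n) (τ : ℝ)
    (u : ℝ → Sp d → Vec n) : Prop :=
  IsMild A (((ε⁻¹ : ℝ) : ℂ) • E.map Complex.ofReal)
    (fun x => carrier κ 0 ε 1 0 x • p x + conjV (carrier κ 0 ε 1 0 x • p x))
    (fun s x => (ε : ℂ) • extT T (u s x) (u s x) (u s x)) τ u

/-- `𝒥^(m) = {±1, ±3, …, ±m}` for odd `m`. -/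
def harmonics (m : ℕ) : Finset ℤ := (Finset.Icc (-(m : ℤ)) m).filter Odd

/-- The sum of `T(U_{j₁}, U_{j₂}, U_{j₃})` over `j₁, j₂, j₃ ∈ 𝒥^(m)` with `j₁ + j₂ + j₃ = j`. -/
def envelopeT (T : Trilin n) (m : ℕ) (U : ℤ → ℝ → Sp d → Vec n) (j : ℤ) (t : ℝ) (x : Sp d) :
    Vec n :=
  ∑ J ∈ (harmonics m ×ˢ harmonics m ×ˢ harmonics m).filter
      (fun J => J.1 + J.2.1 + J.2.2 = j),
    extT T (U J.1 t x) (U J.2.1 t x) (U J.2.2 t x)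

/-- `(U_j)` is a mild solution on `[0, τ]` of the coupled system
`∂_t U_j + (i/ε) 𝓛(jω, jκ) U_j + A(∂) U_j = ε ∑ T(U_{j₁}, U_{j₂}, U_{j₃})`
for positive `j ∈ 𝒥^(m)`, with `U_{-j} = conj U_j`, `U_1(0) = p` and `U_j(0) = 0` for
the other positive `j`. -/
def SolvesEnvelope (A : Fin d → Matrix (Fin n) (Fin n) ℝ) (E : Matrix (Fin n) (Fin n) ℝ)
    (T : Trilin n) (m : ℕ) (κ : Sp d) (ω ε : ℝ) (p : Sp d → Vec n) (τ : ℝ)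
    (U : ℤ → ℝ → Sp d → Vec n) : Prop :=
  (∀ j ∈ harmonics m, ∀ t ∈ Icc 0 τ, ∀ x, U (-j) t x = conjV (U j t x)) ∧
  ∀ j ∈ harmonics m, 0 < j →
    IsMild A ((Complex.I * ((ε⁻¹ : ℝ) : ℂ)) • symbolL A E ((j : ℝ) * ω) ((j : ℝ) • κ))
      (if j = 1 then p else 0)
      (fun s x => (ε : ℂ) • envelopeT T m U j s x) τ (U j)

/-- The approximation `ũ^(m)(t,x) = ∑_{j ∈ 𝒥^(m)} e^{i j (κ·x - ω t)/ε} U_j(t,x)`. -/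
def approximation (m : ℕ) (κ : Sp d) (ω ε : ℝ) (U : ℤ → ℝ → Sp d → Vec n)
    (t : ℝ) (x : Sp d) : Vec n :=
  ∑ j ∈ harmonics m, carrier κ ω ε j t x • U j t x

/-! ### Assumptions on the eigenvalues -/

/-- `w_ℓ(β)`, `ψ_ℓ(β)` form an orthonormal eigendecomposition of `𝓛(0,β) = A(β) - i E` which is
smooth away from `β = 0`, has globally Lipschitz eigenvalues, and is such that
`ω = w_1(κ)` (index `0` below) is bounded away from the ranges of all the other eigenvalues. -/
structure IsSmoothEigendecomposition [NeZero n] (A : Fin d → Matrix (Fin n) (Fin n) ℝ)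
    (E : Matrix (Fin n) (Fin n) ℝ) (κ : Sp d) (ω : ℝ)
    (w : Fin n → Sp d → ℝ) (ψ : Fin n → Sp d → Vec n) : Prop where
  eigen : ∀ l β, mulV (symbolL A E 0 β) (ψ l β) = ((w l β : ℝ) : ℂ) • ψ l β
  orthonormal : ∀ β, Orthonormal ℂ (fun l => ψ l β)
  smooth_w : ∀ l, ContDiffOn ℝ ((⊤ : ℕ∞) : WithTop ℕ∞) (w l) {0}ᶜ
  smooth_ψ : ∀ l, ContDiffOn ℝ ((⊤ : ℕ∞) : WithTop ℕ∞) (ψ l) {0}ᶜ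
  first : w 0 κ = ω
  lipschitz : ∃ C : ℝ, ∀ l β β', |w l β' - w l β| ≤ C * ∑ i, |β' i - β i|
  gap : ∃ c > 0, ∀ β, ∀ l, l ≠ 0 → c ≤ |ω - w l β|

/-- The matrix `M` is regular and has no common eigenvalue with `N`. -/
def NonResonant (M N : Matrix (Fin n) (Fin n) ℂ) : Prop :=
  IsUnit M ∧ Disjoint (spectrum ℂ M) (spectrum ℂ N)

end NLDispersive

end

open MeasureTheory Set Filter Topology
open scoped ENNReal SchwartzMap

noncomputable section

namespace NLDispersive

set_option maxSynthPendingDepth 3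

variable {d n : ℕ}

/-! By Fourier inversion the Wiener algebra is `L¹` in the frequency variable (`ev`,
`ev_injective`). There the linear evolutions are multiplications by unitary matrices, hence
contractions in every weighted `L¹` norm, and the cubic nonlinearity is an iterated convolution,
bounded in every norm with a submultiplicative weight (`wnorm_tri_le`). A forcing ε·δ acting over
times of order 1/ε contributes an error of order δ. The approximation fails to solve the original
equation because the harmonics 1 and 3 also generate the harmonics 5, 7 and 9. Sources 7 and 9
contain at least two factors `U_{±3}`. Source 5 may contain only one, so even `U_3 = O(ε²)` gives a
priori only an error ε². The missing power of ε comes from non-resonance.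

The steps are as follows. Split `U_1 = z + y`, where `z` is the spectral projection on the first
eigenvector at `κ + εk`. Since `w_1` is Lipschitz and `w_1(κ) = ω`, the time derivative of `z` is
bounded although the generator contains 1/ε. The gap condition makes the generator boundedly
invertible, up to a factor ε, on the range of `y`. Subtracting correctors (integration by parts in
time) gives `y, U_3 = O(ε)` (`fast_order_one`). Next, `U_3 = O(ε²)` (`third_order_two`): the slow
source `T(z,z,z)` is removed by inverting `𝓛(3ω,3κ)`. The source linear in `y` oscillates with
`𝓛(ω,κ)` and is removed by a trilinear map solving a Sylvester equation, which exists because the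
two matrices have disjoint spectra. The same device, with `U_3 = ε²γ + r` and `r` oscillating with
`𝓛(3ω,3κ)`, shows that an auxiliary fifth harmonic is `O(ε³)` (`fifth_order_three`). With this
harmonic added, the residual is ε·O(ε⁴), and an absorption argument on a short time interval yields
`O(ε³)` for the error (`exists_bound_sub_train`). The fifth harmonic can then be dropped at the same
cost.

Mild solutions need not be differentiable in time, as `A(∂)` is unbounded. Frequencies are therefore
cut at `R = ε⁻⁴`, which turns the equations into differential equations with bounded generators, at
the price of a defect `O(ε⁴)` for each derivative spent. The weights `min(1+|k|, 1+R)` are adapted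
to the cut, and all constants are independent of `R`. The three derivatives of the data are consumed
along the way: `y` is controlled in the 2-norm, `U_3` to second order in the 1-norm, the fifth
harmonic in the 0-norm.

Uniformity in ε and in the solutions is obtained by treating families over an arbitrary index type
with constants common to the family. At the end the index type consists of all triples of ε, a
solution of the original problem and a solution of the envelope system. -/

/-- The space `L¹(ℝ^d; ℂ^n)` of Fourier transforms of elements of the Wiener algebra. -/
abbrev FL (d n : ℕ) := Lp (Vec n) 1 (volume : Measure (Sp d))

/-- Bounded linear maps on the value space. -/
abbrev End (n : ℕ) := Vec n →L[ℂ] Vec n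

/-! ### Fourier multipliers -/

/-- Bounded measurable symbols. -/
def IsMultiplier (m : Sp d → End n) : Prop :=
  StronglyMeasurable m ∧ ∃ c, ∀ k, ‖m k‖ ≤ c

lemma IsMultiplier.integrable {m : Sp d → End n} (h : IsMultiplier m) (v : FL d n) :
    Integrable (fun k => m k (v k)) := by
  obtain ⟨hm, c, hc⟩ := h
  refine ((L1.integrable_coeFn v).norm.const_mul c).mono'
    ((ContinuousLinearMap.apply ℂ (Vec n)).flip.aestronglyMeasurable_comp₂
      hm.aestronglyMeasurable (L1.aestronglyMeasurable_coeFn v)) ?_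
  exact Eventually.of_forall fun k => (m k).le_of_opNorm_le (hc k) _

open Classical in
/-- Multiplication by a bounded measurable symbol. -/
def mulOp (m : Sp d → End n) : FL d n →L[ℂ] FL d n :=
  if h : IsMultiplier m then
    LinearMap.mkContinuous
      { toFun := fun v => (h.integrable v).toL1 _
        map_add' := fun v w => by
          rw [← Integrable.toL1_add]
          refine (Integrable.toL1_eq_toL1_iff _ _ _ _).2 ?_
          filter_upwards [Lp.coeFn_add v w] with k hk
          rw [hk]
          exact map_add _ _ _
        map_smul' := fun c v => by
          rw [RingHom.id_apply, ← Integrable.toL1_smul]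
          refine (Integrable.toL1_eq_toL1_iff _ _ _ _).2 ?_
          filter_upwards [Lp.coeFn_smul c v] with k hk
          rw [hk]
          exact map_smul (m k) c _ }
      h.2.choose (fun v => by
        simp only [LinearMap.coe_mk, AddHom.coe_mk]
        rw [L1.norm_of_fun_eq_integral_norm, L1.norm_eq_integral_norm, ← integral_const_mul]
        refine integral_mono (h.integrable v).norm ((L1.integrable_coeFn v).norm.const_mul _) ?_
        exact fun k => (m k).le_of_opNorm_le (h.2.choose_spec k) _)
  else 0

lemma mulOp_ae {m : Sp d → End n} (h : IsMultiplier m) (v : FL d n) :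
    mulOp m v =ᵐ[volume] fun k => m k (v k) := by
  simp only [mulOp, h, dif_pos]
  exact Integrable.coeFn_toL1 (h.integrable v)

lemma norm_le_of_ae {v w : FL d n} {c : ℝ} (h : ∀ᵐ k, ‖v k‖ ≤ c * ‖w k‖) : ‖v‖ ≤ c * ‖w‖ := by
  rw [L1.norm_eq_integral_norm, L1.norm_eq_integral_norm, ← integral_const_mul]
  exact integral_mono_ae (L1.integrable_coeFn v).norm
    ((L1.integrable_coeFn w).norm.const_mul _) h

lemma norm_mulOp_le {m : Sp d → End n} (h : IsMultiplier m) {c : ℝ} (hc : ∀ k, ‖m k‖ ≤ c)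
    (v : FL d n) : ‖mulOp m v‖ ≤ c * ‖v‖ := by
  apply norm_le_of_ae
  filter_upwards [mulOp_ae h v] with k h1
  rw [h1]
  exact (m k).le_of_opNorm_le (hc k) _

lemma opNorm_mulOp_le {m : Sp d → End n} (h : IsMultiplier m) {c : ℝ} (hc : ∀ k, ‖m k‖ ≤ c) :
    ‖mulOp m‖ ≤ c :=
  ContinuousLinearMap.opNorm_le_bound _ ((norm_nonneg _).trans (hc 0)) (norm_mulOp_le h hc)

lemma IsMultiplier.mul {m m' : Sp d → End n} (h : IsMultiplier m) (h' : IsMultiplier m') :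
    IsMultiplier (fun k => m k * m' k) := by
  obtain ⟨hm, c, hc⟩ := h
  obtain ⟨hm', c', hc'⟩ := h'
  exact ⟨hm.mul hm', c * c', fun k => (norm_mul_le _ _).trans
    (mul_le_mul (hc k) (hc' k) (norm_nonneg _) ((norm_nonneg _).trans (hc 0)))⟩

lemma IsMultiplier.add {m m' : Sp d → End n} (h : IsMultiplier m) (h' : IsMultiplier m') :
    IsMultiplier (fun k => m k + m' k) := by
  obtain ⟨hm, c, hc⟩ := h
  obtain ⟨hm', c', hc'⟩ := h'
  exact ⟨hm.add hm', c + c', fun k => (norm_add_le _ _).trans (add_le_add (hc k) (hc' k))⟩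

lemma IsMultiplier.smul {m : Sp d → End n} (h : IsMultiplier m) (a : ℂ) :
    IsMultiplier (fun k => a • m k) := by
  obtain ⟨hm, c, hc⟩ := h
  exact ⟨hm.const_smul a, ‖a‖ * c, fun k => by
    rw [norm_smul]; exact mul_le_mul_of_nonneg_left (hc k) (norm_nonneg _)⟩

lemma isMultiplier_const (M : End n) : IsMultiplier (fun _ : Sp d => M) :=
  ⟨stronglyMeasurable_const, ‖M‖, fun _ => le_rfl⟩

lemma mulOp_ext {m m' : Sp d → End n} (h : IsMultiplier m) (h' : IsMultiplier m') {v w : FL d n}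
    (hvw : ∀ᵐ k, m k (v k) = m' k (w k)) : mulOp m v = mulOp m' w := by
  apply Lp.ext
  filter_upwards [mulOp_ae h v, mulOp_ae h' w, hvw] with k h1 h2 h3
  rw [h1, h2, h3]

lemma mulOp_mulOp {m m' : Sp d → End n} (h : IsMultiplier m) (h' : IsMultiplier m') (v : FL d n) :
    mulOp m (mulOp m' v) = mulOp (fun k => m k * m' k) v := by
  apply mulOp_ext h (h.mul h')
  filter_upwards [mulOp_ae h' v] with k h1
  rw [h1]; rfl

lemma mulOp_mul {m m' : Sp d → End n} (h : IsMultiplier m) (h' : IsMultiplier m') :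
    mulOp (fun k => m k * m' k) = mulOp m * mulOp m' := by
  ext1 v
  exact (mulOp_mulOp h h' v).symm

lemma mulOp_add {m m' : Sp d → End n} (h : IsMultiplier m) (h' : IsMultiplier m') :
    mulOp (fun k => m k + m' k) = mulOp m + mulOp m' := by
  ext1 v
  apply Lp.ext
  refine (mulOp_ae (h.add h') v).trans ?_
  filter_upwards [mulOp_ae h v, mulOp_ae h' v, Lp.coeFn_add (mulOp m v) (mulOp m' v)]
    with k h1 h2 h3
  refine Eq.trans ?_ h3.symm
  rw [Pi.add_apply, h1, h2]; rfl

lemma mulOp_smul {m : Sp d → End n} (h : IsMultiplier m) (a : ℂ) :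
    mulOp (fun k => a • m k) = a • mulOp m := by
  ext1 v
  apply Lp.ext
  refine (mulOp_ae (h.smul a) v).trans ?_
  filter_upwards [mulOp_ae h v, Lp.coeFn_smul a (mulOp m v)] with k h1 h3
  refine Eq.trans ?_ h3.symm
  rw [Pi.smul_apply, h1]; rfl

lemma mulOp_one : mulOp (fun _ : Sp d => (1 : End n)) = 1 := by
  ext1 v
  apply Lp.ext
  exact mulOp_ae (isMultiplier_const 1) v

lemma mulOp_comm {m m' : Sp d → End n} (h : IsMultiplier m) (h' : IsMultiplier m')
    (hc : ∀ k, Commute (m k) (m' k)) : Commute (mulOp m) (mulOp m') := by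
  rw [Commute, SemiconjBy, ← mulOp_mul h h', ← mulOp_mul h' h]
  congr 1
  funext k
  exact hc k

/-! ### Evaluation of the inverse Fourier transform -/

lemma integrable_exp_smul {F : Type*} [NormedAddCommGroup F] [NormedSpace ℂ F] {g : Sp d → F}
    (hg : Integrable g) (x : Sp d) :
    Integrable fun k => Complex.exp (Complex.I * ((inner ℝ k x : ℝ) : ℂ)) • g k := by
  refine hg.norm.mono' (AEStronglyMeasurable.smul (Continuous.aestronglyMeasurable (by fun_prop))
    hg.aestronglyMeasurable) (Eventually.of_forall fun k => ?_)
  rw [norm_smul, mul_comm Complex.I, Complex.norm_exp_ofReal_mul_I, one_mul]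

variable (d) in
/-- The normalizing constant of the Fourier transform. -/
def fourierConst : ℝ := (2 * Real.pi) ^ (-(d : ℝ) / 2)

lemma fourierConst_pos : 0 < fourierConst d := by
  unfold fourierConst; positivity

lemma invFourier_congr {g g' : Sp d → Vec n} (h : g =ᵐ[volume] g') (x : Sp d) :
    invFourier g x = invFourier g' x := by
  unfold invFourier
  congr 1
  apply integral_congr_ae
  filter_upwards [h] with k hk
  rw [hk]

/-- Point evaluation of the inverse Fourier transform on `L¹`. -/
def ev (x : Sp d) : FL d n →L[ℂ] Vec n :=
  LinearMap.mkContinuous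
    { toFun := fun v => invFourier v x
      map_add' := fun v w => by
        rw [invFourier_congr (Lp.coeFn_add v w)]
        simp only [invFourier, Pi.add_apply, smul_add]
        rw [integral_add (integrable_exp_smul (L1.integrable_coeFn v) x)
          (integrable_exp_smul (L1.integrable_coeFn w) x), smul_add]
      map_smul' := fun c v => by
        rw [invFourier_congr (Lp.coeFn_smul c v)]
        simp only [invFourier, Pi.smul_apply, RingHom.id_apply]
        rw [smul_comm c, ← integral_smul c]
        congr 2
        funext k
        exact smul_comm _ _ _ }
    (fourierConst d) (fun v => by
      simp only [LinearMap.coe_mk, AddHom.coe_mk, invFourier]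
      rw [norm_smul, Complex.norm_real, Real.norm_of_nonneg (by positivity), L1.norm_eq_integral_norm]
      refine mul_le_mul_of_nonneg_left ((norm_integral_le_integral_norm _).trans_eq ?_)
        (by positivity)
      congr 1
      funext k
      rw [norm_smul, mul_comm Complex.I, Complex.norm_exp_ofReal_mul_I, one_mul])

lemma ev_apply (x : Sp d) (v : FL d n) : ev x v = invFourier v x := rfl

lemma norm_ev_le (x : Sp d) (v : FL d n) : ‖ev x v‖ ≤ fourierConst d * ‖v‖ :=
  LinearMap.mkContinuous_norm_le _ fourierConst_pos.le _ |> fun h => (ev x).le_of_opNorm_le h v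

lemma ev_toL1 {g : Sp d → Vec n} (hg : Integrable g) (x : Sp d) :
    ev x (hg.toL1 g) = invFourier g x :=
  invFourier_congr hg.coeFn_toL1 x

/-! ### Injectivity of the inverse Fourier transform and derivatives -/

open FourierTransform LineDeriv in
/-- Every test function is, together with its multiples by coordinates, the Fourier integral of a
Schwartz function and of its derivatives. -/
lemma exists_schwartz_fourier (ψ : Sp d → ℂ) (hψ : ContDiff ℝ (⊤ : ℕ∞) ψ)
    (hs : HasCompactSupport ψ) :
    ∃ φ : 𝓢(Sp d, ℂ),
      (∀ k, ∫ x, Complex.exp (Complex.I * ((inner ℝ k x : ℝ) : ℂ)) * φ x = ψ k) ∧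
      ∀ l k, ∫ x, Complex.exp (Complex.I * ((inner ℝ k x : ℝ) : ℂ)) *
        fderiv ℝ (φ : Sp d → ℂ) x (EuclideanSpace.single l (1 : ℝ))
          = -(Complex.I * ((k l : ℝ) : ℂ) * ψ k) := by
  have hpi : (2 * Real.pi) ≠ 0 := by positivity
  -- The kernel in use is e^{ik·x}, while `𝓕` is built on e^{-2πik·x}. With χ(k) = ψ(2πk) and φ =
  -- 𝓕χ, the integral of e^{ik·x} φ(x) is χ(k/2π) = ψ(k).
  have h1 : HasCompactSupport (fun k => ψ ((2 * Real.pi) • k)) :=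
    hs.comp_homeomorph (Homeomorph.smulOfNeZero (2 * Real.pi) hpi)
  have h2 : ContDiff ℝ (⊤ : ℕ∞) (fun k => ψ ((2 * Real.pi) • k)) :=
    hψ.comp (contDiff_const_smul _)
  set χ : 𝓢(Sp d, ℂ) := h1.toSchwartzMap h2 with hχ
  have key : ∀ (f : 𝓢(Sp d, ℂ)) k,
      ∫ x, Complex.exp (Complex.I * ((inner ℝ k x : ℝ) : ℂ)) * f x
        = (𝓕⁻ f) ((2 * Real.pi)⁻¹ • k) := by
    intro f k
    rw [SchwartzMap.fourierInv_coe, Real.fourierInv_eq']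
    congr 1
    funext x
    rw [smul_eq_mul, inner_smul_right, real_inner_comm k x]
    congr 2
    push_cast
    field_simp
  have hχk : ∀ k, χ ((2 * Real.pi)⁻¹ • k) = ψ k := by
    intro k
    change ψ ((2 * Real.pi) • (2 * Real.pi)⁻¹ • k) = ψ k
    rw [smul_smul, mul_inv_cancel₀ hpi, one_smul]
  refine ⟨𝓕 χ, fun k => ?_, fun l k => ?_⟩
  · rw [key, FourierTransform.fourierInv_fourier_eq, hχk]
  · have := key (∂_{EuclideanSpace.single l (1 : ℝ)} (𝓕 χ)) k
    rw [SchwartzMap.fourierInv_lineDerivOp_eq, FourierTransform.fourierInv_fourier_eq] at this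
    simp only [SchwartzMap.lineDerivOp_apply_eq_fderiv] at this
    rw [this]
    rw [_root_.smul_apply, SchwartzMap.smulLeftCLM_apply_apply (by fun_prop), hχk,
      real_inner_smul_left, EuclideanSpace.inner_single_right]
    have hpc : (Real.pi : ℂ) ≠ 0 := by exact_mod_cast Real.pi_ne_zero
    simp only [conj_trivial, smul_eq_mul, Complex.real_smul, one_mul]
    push_cast
    field_simp

/-- Fubini: moving the inverse Fourier transform to the test function. -/
lemma integral_smul_ev {φ : Sp d → ℂ} (hφ : Integrable φ) (v : FL d n) :
    ∫ x, φ x • ev x v = (fourierConst d : ℂ) •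
      ∫ k, (∫ x, Complex.exp (Complex.I * ((inner ℝ k x : ℝ) : ℂ)) * φ x) • v k := by
  have hint : Integrable (fun p : Sp d × Sp d =>
      Complex.exp (Complex.I * ((inner ℝ p.2 p.1 : ℝ) : ℂ)) • (φ p.1 • v p.2))
      (volume.prod volume) := by
    have h := hφ.smul_prod (L1.integrable_coeFn v)
    have hc : Continuous fun p : Sp d × Sp d =>
        Complex.exp (Complex.I * ((inner ℝ p.2 p.1 : ℝ) : ℂ)) := by fun_prop
    refine h.norm.mono' (hc.aestronglyMeasurable.smul h.aestronglyMeasurable)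
      (Eventually.of_forall fun p => ?_)
    rw [norm_smul, mul_comm Complex.I, Complex.norm_exp_ofReal_mul_I, one_mul]
  have hev : ∀ x, φ x • ev x v = (fourierConst d : ℂ) •
      ∫ k, Complex.exp (Complex.I * ((inner ℝ k x : ℝ) : ℂ)) • (φ x • v k) := by
    intro x
    rw [ev_apply, invFourier, smul_comm]
    congr 1
    rw [← integral_smul]
    congr 1
    funext k
    exact smul_comm _ _ _
  simp only [hev]
  rw [integral_smul, integral_integral_swap hint]
  congr 2
  funext k
  rw [← integral_smul_const]
  simp only [smul_smul]

lemma ae_eq_of_integral_test {f g : Sp d → Vec n} (hf : LocallyIntegrable f)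
    (hg : LocallyIntegrable g)
    (h : ∀ ψ : Sp d → ℂ, ContDiff ℝ (⊤ : ℕ∞) ψ → HasCompactSupport ψ →
      ∫ k, ψ k • f k = ∫ k, ψ k • g k) : f =ᵐ[volume] g := by
  apply ae_eq_of_integral_contDiff_smul_eq hf hg
  intro ψ h1 h2
  have := h (fun k => (ψ k : ℂ)) (Complex.ofRealCLM.contDiff.comp h1)
    (h2.comp_left Complex.ofReal_zero)
  simpa only [Complex.coe_smul] using this

/-- Any test function ψ on the frequency side is the Fourier integral of a Schwartz function φ. By
Fubini, pairing the inverse transform of `v` with φ amounts to integrating ψ·v, so the inverse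
transform determines all these integrals. -/
lemma ev_injective {v w : FL d n} (h : ∀ x, ev x v = ev x w) : v = w := by
  apply Lp.ext
  apply ae_eq_of_integral_test (L1.integrable_coeFn v).locallyIntegrable
    (L1.integrable_coeFn w).locallyIntegrable
  intro ψ h1 h2
  obtain ⟨φ, hφ, -⟩ := exists_schwartz_fourier ψ h1 h2
  have hv := integral_smul_ev φ.integrable v
  have hw := integral_smul_ev φ.integrable w
  simp only [h, hw, hφ] at hv
  have hc : (fourierConst d : ℂ) ≠ 0 := by exact_mod_cast fourierConst_pos.ne'
  exact (smul_right_injective _ hc hv).symm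

/-- Test the distributional derivative with a φ whose Fourier integral is a given ψ: the derivative
of φ then has Fourier integral -i k_l ψ(k), and ψ is arbitrary. -/
lemma isPartial_fourier {l : Fin d} {v w : FL d n}
    (h : IsPartial l (fun x => ev x v) (fun x => ev x w)) :
    ∀ᵐ k, w k = (Complex.I * ((k l : ℝ) : ℂ)) • v k := by
  have hv := (L1.integrable_coeFn v).locallyIntegrable
  apply ae_eq_of_integral_test (L1.integrable_coeFn w).locallyIntegrable
  · refine hv.continuous_smul ?_
    fun_prop
  intro ψ h1 h2
  obtain ⟨φ, hφ, hφ'⟩ := exists_schwartz_fourier ψ h1 h2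
  have hd : Integrable (fun x => fderiv ℝ (φ : Sp d → ℂ) x (EuclideanSpace.single l (1 : ℝ))) := by
    have := (LineDeriv.lineDerivOp (EuclideanSpace.single l (1 : ℝ)) φ : 𝓢(Sp d, ℂ)).integrable
      (μ := volume)
    exact this
  have hl := h φ
  rw [integral_smul_ev φ.integrable w, integral_smul_ev hd v] at hl
  simp only [hφ, hφ'] at hl
  have hc : (fourierConst d : ℂ) ≠ 0 := by exact_mod_cast fourierConst_pos.ne'
  rw [← smul_neg] at hl
  have h3 := smul_right_injective _ hc hl
  simp only [neg_smul] at h3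
  rw [integral_neg, neg_inj] at h3
  rw [← h3]
  congr 1
  funext k
  rw [smul_smul, mul_comm]

/-! ### The Wiener algebra in Fourier space -/

lemma MemW.exists_ev {f : Sp d → Vec n} (h : MemW f) : ∃ v : FL d n, ∀ x, f x = ev x v := by
  obtain ⟨g, hg, hfg⟩ := h
  exact ⟨hg.toL1 g, fun x => by rw [ev_toL1, hfg]⟩

lemma hasFourier_ev (v : FL d n) : HasFourier (fun x => ev x v) v :=
  ⟨L1.integrable_coeFn v, fun _ => rfl⟩

lemma memW_ev (v : FL d n) : MemW (fun x => ev x v) := ⟨_, hasFourier_ev v⟩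

lemma HasFourier.ae_eq {g : Sp d → Vec n} {v : FL d n} (h : HasFourier (fun x => ev x v) g) :
    g =ᵐ[volume] v := by
  have : h.1.toL1 g = v := ev_injective fun x => by rw [ev_toL1, ← h.2]
  rw [← this]
  exact h.1.coeFn_toL1.symm

/-- By injectivity the representative chosen in `hat` is immaterial up to null sets, so propagators
may be computed from any element of `FL`. -/
lemma hat_ev (v : FL d n) : hat (fun x => ev x v) =ᵐ[volume] v := by
  unfold hat
  rw [dif_pos (memW_ev v)]
  exact (memW_ev v).choose_spec.ae_eq

lemma normW_ev (v : FL d n) : normW (fun x => ev x v) = ENNReal.ofReal ‖v‖ := by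
  rw [L1.ofReal_norm_eq_lintegral]
  apply le_antisymm
  · exact iInf₂_le _ (hasFourier_ev v)
  · refine le_iInf₂ fun g hg => le_of_eq (lintegral_congr_ae ?_)
    filter_upwards [hg.ae_eq] with k hk
    rw [hk]

/-! ### Convolution as a multilinear operation on `L¹` -/

section Convolution

open scoped Convolution

variable {F₁ F₂ F₃ : Type*} [NormedAddCommGroup F₁] [NormedSpace ℂ F₁] [NormedAddCommGroup F₂]
  [NormedSpace ℂ F₂] [NormedAddCommGroup F₃] [NormedSpace ℂ F₃]

lemma integrable_weight_mul {w : Sp d → ℝ} (hw : Measurable w) (h0 : ∀ k, 0 ≤ w k) {B : ℝ}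
    (hB : ∀ k, w k ≤ B) {F : Type*} [NormedAddCommGroup F] {f : Sp d → F}
    (hf : Integrable f) : Integrable fun k => w k * ‖f k‖ := by
  refine (hf.norm.const_mul B).mono'
    (hw.aestronglyMeasurable.mul hf.aestronglyMeasurable.norm) (Eventually.of_forall fun k => ?_)
  rw [Real.norm_of_nonneg (mul_nonneg (h0 k) (norm_nonneg _))]
  exact mul_le_mul_of_nonneg_right (hB k) (norm_nonneg _)

/-- Submultiplicativity lets w(k) be distributed as w(t) w(k-t) under the convolution integral. What
remains is the integral of a scalar convolution, which factorizes. -/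
lemma integral_weight_convolution_le (L : F₁ →L[ℂ] F₂ →L[ℂ] F₃) {w : Sp d → ℝ}
    (hw : Measurable w) (h0 : ∀ k, 0 ≤ w k) {B : ℝ} (hB : ∀ k, w k ≤ B)
    (hsub : ∀ k k', w (k + k') ≤ w k * w k')
    {f : Sp d → F₁} {g : Sp d → F₂} (hf : Integrable f) (hg : Integrable g) :
    ∫ k, w k * ‖(f ⋆[L, volume] g) k‖ ≤ ‖L‖ * (∫ k, w k * ‖f k‖) * (∫ k, w k * ‖g k‖) := by
  have hwf := integrable_weight_mul hw h0 hB hf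
  have hwg := integrable_weight_mul hw h0 hB hg
  have hrhs : ‖L‖ * (∫ k, w k * ‖f k‖) * (∫ k, w k * ‖g k‖)
      = ∫ k, ‖L‖ * ((fun k => w k * ‖f k‖) ⋆[ContinuousLinearMap.mul ℝ ℝ, volume]
        (fun k => w k * ‖g k‖)) k := by
    rw [integral_const_mul, integral_convolution _ hwf hwg, ContinuousLinearMap.mul_apply', mul_assoc]
  rw [hrhs]
  refine integral_mono_ae
    (integrable_weight_mul hw h0 hB (hf.integrable_convolution L hg))
    ((hwf.integrable_convolution (ContinuousLinearMap.mul ℝ ℝ) hwg).const_mul _) ?_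
  filter_upwards [hwf.ae_convolution_exists (ContinuousLinearMap.mul ℝ ℝ) hwg] with k hk
  rw [convolution_def, convolution_def, ← integral_const_mul]
  calc w k * ‖∫ t, L (f t) (g (k - t))‖ ≤ w k * ∫ t, ‖L (f t) (g (k - t))‖ :=
        mul_le_mul_of_nonneg_left (norm_integral_le_integral_norm _) (h0 k)
    _ = ∫ t, w k * ‖L (f t) (g (k - t))‖ := (integral_const_mul _ _).symm
    _ ≤ ∫ t, ‖L‖ * ((w t * ‖f t‖) * (w (k - t) * ‖g (k - t)‖)) := by
        refine integral_mono_of_nonneg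
          (Eventually.of_forall fun t => mul_nonneg (h0 k) (norm_nonneg _))
          (hk.integrable.const_mul _) (Eventually.of_forall fun t => ?_)
        have h1 : w k ≤ w t * w (k - t) := by
          have := hsub t (k - t)
          rwa [add_sub_cancel] at this
        calc w k * ‖L (f t) (g (k - t))‖
            ≤ (w t * w (k - t)) * (‖L‖ * ‖f t‖ * ‖g (k - t)‖) :=
              mul_le_mul h1 (L.le_opNorm₂ _ _) (norm_nonneg _) (mul_nonneg (h0 _) (h0 _))
          _ = _ := by ring

/-- Convolution with respect to a bilinear map, as a bilinear map on `L¹`. -/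
def convL (L : F₁ →L[ℂ] F₂ →L[ℂ] F₃) :
    Lp F₁ 1 (volume : Measure (Sp d)) →L[ℂ] Lp F₂ 1 (volume : Measure (Sp d)) →L[ℂ]
      Lp F₃ 1 (volume : Measure (Sp d)) :=
  LinearMap.mkContinuous₂
    (LinearMap.mk₂ ℂ
      (fun f g => ((L1.integrable_coeFn f).integrable_convolution L
        (L1.integrable_coeFn g)).toL1 _)
      (fun f f' g => by
        rw [← Integrable.toL1_add]
        refine (Integrable.toL1_eq_toL1_iff _ _ _ _).2 ?_
        filter_upwards [(L1.integrable_coeFn f).ae_convolution_exists L (L1.integrable_coeFn g),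
          (L1.integrable_coeFn f').ae_convolution_exists L (L1.integrable_coeFn g)] with k h1 h2
        rw [convolution_congr L (Lp.coeFn_add f f') (Filter.EventuallyEq.refl _ _)]
        exact h1.add_distrib h2)
      (fun c f g => by
        rw [← Integrable.toL1_smul]
        refine (Integrable.toL1_eq_toL1_iff _ _ _ _).2 ?_
        rw [convolution_congr L (Lp.coeFn_smul c f) (Filter.EventuallyEq.refl _ _)]
        exact Eventually.of_forall fun k => congrFun smul_convolution k)
      (fun f g g' => by
        rw [← Integrable.toL1_add]
        refine (Integrable.toL1_eq_toL1_iff _ _ _ _).2 ?_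
        filter_upwards [(L1.integrable_coeFn f).ae_convolution_exists L (L1.integrable_coeFn g),
          (L1.integrable_coeFn f).ae_convolution_exists L (L1.integrable_coeFn g')] with k h1 h2
        rw [convolution_congr L (Filter.EventuallyEq.refl _ _) (Lp.coeFn_add g g')]
        exact h1.distrib_add h2)
      (fun c f g => by
        rw [← Integrable.toL1_smul]
        refine (Integrable.toL1_eq_toL1_iff _ _ _ _).2 ?_
        rw [convolution_congr L (Filter.EventuallyEq.refl _ _) (Lp.coeFn_smul c g)]
        exact Eventually.of_forall fun k => congrFun convolution_smul k))
    ‖L‖ (fun f g => by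
      have h := integral_weight_convolution_le L (w := fun _ : Sp d => (1 : ℝ)) measurable_const
        (fun _ => zero_le_one) (fun _ => le_rfl) (fun _ _ => by norm_num)
        (L1.integrable_coeFn f) (L1.integrable_coeFn g)
      simp only [one_mul] at h
      rw [LinearMap.mk₂_apply, L1.norm_of_fun_eq_integral_norm, L1.norm_eq_integral_norm,
        L1.norm_eq_integral_norm]
      exact h)

lemma convL_ae (L : F₁ →L[ℂ] F₂ →L[ℂ] F₃) (f : Lp F₁ 1 (volume : Measure (Sp d)))
    (g : Lp F₂ 1 (volume : Measure (Sp d))) :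
    convL L f g =ᵐ[volume] f ⋆[L, volume] g :=
  Integrable.coeFn_toL1 ((L1.integrable_coeFn f).integrable_convolution L (L1.integrable_coeFn g))

lemma integral_weight_convL_le (L : F₁ →L[ℂ] F₂ →L[ℂ] F₃) {w : Sp d → ℝ}
    (hw : Measurable w) (h0 : ∀ k, 0 ≤ w k) {B : ℝ} (hB : ∀ k, w k ≤ B)
    (hsub : ∀ k k', w (k + k') ≤ w k * w k') (f : Lp F₁ 1 (volume : Measure (Sp d)))
    (g : Lp F₂ 1 (volume : Measure (Sp d))) :
    ∫ k, w k * ‖convL L f g k‖ ≤ ‖L‖ * (∫ k, w k * ‖f k‖) * (∫ k, w k * ‖g k‖) := by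
  refine le_trans (le_of_eq (integral_congr_ae ?_))
    (integral_weight_convolution_le L hw h0 hB hsub (L1.integrable_coeFn f) (L1.integrable_coeFn g))
  filter_upwards [convL_ae L f g] with k hk
  rw [hk]

/-- The character k ↦ e^{ik·x} is multiplicative, so it distributes over the two factors of the
convolution, and the integral of a convolution is the product of the integrals. -/
lemma integral_exp_convL [CompleteSpace F₁] [CompleteSpace F₂] [CompleteSpace F₃]
    (L : F₁ →L[ℂ] F₂ →L[ℂ] F₃) (f : Lp F₁ 1 (volume : Measure (Sp d)))
    (g : Lp F₂ 1 (volume : Measure (Sp d))) (x : Sp d) :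
    ∫ k, Complex.exp (Complex.I * ((inner ℝ k x : ℝ) : ℂ)) • convL L f g k
      = L (∫ k, Complex.exp (Complex.I * ((inner ℝ k x : ℝ) : ℂ)) • f k)
        (∫ k, Complex.exp (Complex.I * ((inner ℝ k x : ℝ) : ℂ)) • g k) := by
  rw [← integral_convolution L (integrable_exp_smul (L1.integrable_coeFn f) x)
    (integrable_exp_smul (L1.integrable_coeFn g) x)]
  apply integral_congr_ae
  filter_upwards [convL_ae L f g] with k hk
  rw [hk, convolution_def, convolution_def, ← integral_smul]
  congr 1
  funext t
  rw [map_smul, map_smul, _root_.smul_apply, smul_smul, ← Complex.exp_add, ← mul_add,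
    ← Complex.ofReal_add, ← inner_add_left, sub_add_cancel]

end Convolution

/-- Complex trilinear maps on the value space. -/
abbrev Tri (n : ℕ) := Vec n →L[ℂ] Vec n →L[ℂ] Vec n →L[ℂ] Vec n

/-- The Fourier image of the pointwise product `Θ(f, g, h)`. -/
def tri (Θ : Tri n) : FL d n →L[ℂ] FL d n →L[ℂ] FL d n →L[ℂ] FL d n :=
  ((fourierConst d : ℂ) ^ 2) •
    (ContinuousLinearMap.compL ℂ (FL d n) (Lp (End n) 1 (volume : Measure (Sp d)))
      (FL d n →L[ℂ] FL d n) (convL (ContinuousLinearMap.id ℂ (End n)))).comp (convL Θ)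

lemma tri_apply (Θ : Tri n) (a b c : FL d n) :
    tri (d := d) Θ a b c = ((fourierConst d : ℂ) ^ 2) •
      convL (ContinuousLinearMap.id ℂ (End n)) (convL Θ a b) c := rfl

/-- The three evaluations on the right carry three normalizing constants and the one on the left a
single one; the square in `tri` supplies the other two. -/
lemma ev_tri (Θ : Tri n) (a b c : FL d n) (x : Sp d) :
    ev x (tri (d := d) Θ a b c) = Θ (ev x a) (ev x b) (ev x c) := by
  rw [tri_apply, map_smul]
  simp only [ev_apply, invFourier]
  rw [integral_exp_convL, integral_exp_convL]
  simp only [map_smul, _root_.smul_apply, smul_smul, fourierConst]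
  rw [ContinuousLinearMap.id_apply]
  congr 1
  ring

lemma integral_weight_smul (w : Sp d → ℝ) (a : ℂ) (u : FL d n) :
    ∫ k, w k * ‖(a • u) k‖ = ‖a‖ * ∫ k, w k * ‖u k‖ := by
  rw [← integral_const_mul]
  apply integral_congr_ae
  filter_upwards [Lp.coeFn_smul a u] with k hk
  rw [hk, Pi.smul_apply, norm_smul]
  ring

lemma mul_chain_le {q X Y i θ a b c : ℝ} (hq : 0 ≤ q) (h1 : X ≤ i * Y * c) (h2 : Y ≤ θ * a * b)
    (h3 : i ≤ 1) (hY : 0 ≤ Y) (hc : 0 ≤ c) : q * X ≤ q * θ * a * b * c := by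
  calc q * X ≤ q * (1 * (θ * a * b) * c) := by
        refine mul_le_mul_of_nonneg_left (h1.trans (mul_le_mul_of_nonneg_right ?_ hc)) hq
        exact mul_le_mul h3 h2 hY zero_le_one
    _ = q * θ * a * b * c := by ring

set_option maxHeartbeats 1000000 in
lemma integral_weight_tri_le (Θ : Tri n) {w : Sp d → ℝ}
    (hw : Measurable w) (h0 : ∀ k, 0 ≤ w k) {B : ℝ} (hB : ∀ k, w k ≤ B)
    (hsub : ∀ k k', w (k + k') ≤ w k * w k') (a b c : FL d n) :
    ∫ k, w k * ‖tri (d := d) Θ a b c k‖ ≤ (fourierConst d ^ 2 * ‖Θ‖) *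
      (∫ k, w k * ‖a k‖) * (∫ k, w k * ‖b k‖) * (∫ k, w k * ‖c k‖) := by
  have h1 := integral_weight_convL_le (ContinuousLinearMap.id ℂ (End n)) hw h0 hB hsub
    (convL Θ a b) c
  have h2 := integral_weight_convL_le Θ hw h0 hB hsub a b
  have h3 := integral_weight_smul w ((fourierConst d : ℂ) ^ 2)
    (convL (ContinuousLinearMap.id ℂ (End n)) (convL Θ a b) c)
  rw [← tri_apply] at h3
  have h4 : ‖(fourierConst d : ℂ) ^ 2‖ = fourierConst d ^ 2 := by
    rw [norm_pow, Complex.norm_real, Real.norm_of_nonneg fourierConst_pos.le]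
  rw [h4] at h3
  have hc0 : 0 ≤ ∫ k, w k * ‖c k‖ := integral_nonneg fun k => mul_nonneg (h0 k) (norm_nonneg _)
  have hab0 : 0 ≤ ∫ k, w k * ‖convL Θ a b k‖ :=
    integral_nonneg fun k => mul_nonneg (h0 k) (norm_nonneg _)
  have h5 : ‖ContinuousLinearMap.id ℂ (End n)‖ ≤ 1 := ContinuousLinearMap.norm_id_le
  rw [h3]
  exact mul_chain_le (sq_nonneg _) h1 h2 h5 hab0 hc0

lemma norm_eq_integral_weight {w : Sp d → ℝ} (h0 : ∀ k, 0 ≤ w k)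
    (h : IsMultiplier fun k => (w k : ℂ) • (1 : End n)) (v : FL d n) :
    ‖mulOp (fun k => (w k : ℂ) • (1 : End n)) v‖ = ∫ k, w k * ‖v k‖ := by
  rw [L1.norm_eq_integral_norm]
  apply integral_congr_ae
  filter_upwards [mulOp_ae h v] with k hk
  rw [hk]
  change ‖(w k : ℂ) • v k‖ = _
  rw [norm_smul, Complex.norm_real, Real.norm_of_nonneg (h0 k)]

/-! ### Families of evolution problems in a Banach space -/

section Abstract

variable {ι X : Type*} [NormedAddCommGroup X] [NormedSpace ℝ X]

lemma HasDerivAt.trilinear (T : X →L[ℝ] X →L[ℝ] X →L[ℝ] X) {a b c : ℝ → X} {a' b' c' : X} {t : ℝ}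
    (ha : HasDerivAt a a' t) (hb : HasDerivAt b b' t) (hc : HasDerivAt c c' t) :
    HasDerivAt (fun s => T (a s) (b s) (c s))
      (T a' (b t) (c t) + T (a t) b' (c t) + T (a t) (b t) c') t := by
  have h1 := T.hasFDerivAt.comp_hasDerivAt t ha
  have h2 := h1.clm_apply hb
  have h3 := h2.clm_apply hc
  exact h3

/-- A family of scales: small parameters `ε i ∈ (0, 1]` and weight operators `W i`, which define
the norms `‖W i ^ s v‖`. -/
structure Frame (ι X : Type*) [NormedAddCommGroup X] [NormedSpace ℝ X] where
  ε : ι → ℝ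
  W : ι → X →L[ℝ] X
  pos : ∀ i, 0 < ε i
  le_one : ∀ i, ε i ≤ 1
  norm_le : ∀ i v, ‖v‖ ≤ ‖W i v‖

namespace Frame

variable (F : Frame ι X)

/-- The weighted norms. -/
def N (i : ι) (s : ℕ) (v : X) : ℝ := ‖(F.W i ^ s) v‖

lemma N_nonneg (i : ι) (s : ℕ) (v : X) : 0 ≤ F.N i s v := norm_nonneg _

@[simp] lemma N_zero (i : ι) (v : X) : F.N i 0 v = ‖v‖ := by simp [N]

lemma N_add_le (i : ι) (s : ℕ) (v w : X) : F.N i s (v + w) ≤ F.N i s v + F.N i s w := by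
  simp only [N, map_add]; exact norm_add_le _ _

lemma N_neg (i : ι) (s : ℕ) (v : X) : F.N i s (-v) = F.N i s v := by
  simp only [N, map_neg, norm_neg]

lemma N_smul (i : ι) (s : ℕ) (c : ℝ) (v : X) : F.N i s (c • v) = |c| * F.N i s v := by
  simp only [N, map_smul, norm_smul, Real.norm_eq_abs]

lemma N_succ_le (i : ι) (s : ℕ) (v : X) : F.N i s v ≤ F.N i (s + 1) v := by
  simp only [N, pow_succ']
  exact F.norm_le i _

lemma N_mono (i : ι) {s s' : ℕ} (h : s ≤ s') (v : X) : F.N i s v ≤ F.N i s' v :=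
  monotone_nat_of_le_succ (f := fun s => F.N i s v) (fun s => F.N_succ_le i s v) h

lemma continuous_N (i : ι) (s : ℕ) : Continuous (F.N i s) := (F.W i ^ s).continuous.norm

/-- Powers of `ε`, as a gauge. -/
def E (m : ℕ) : ι → ℝ → ℝ := fun i _ => F.ε i ^ m

/-- `v = O(g)` in the `s`-norm, uniformly on the time intervals `[0, S / ε]`. -/
def UB (S : ℝ) (s : ℕ) (g : ι → ℝ → ℝ) (v : ι → ℝ → X) : Prop :=
  ∃ C, 0 ≤ C ∧ ∀ i t, 0 ≤ t → t * F.ε i ≤ S → F.N i s (v i t) ≤ C * g i t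

/-- Operators which are bounded in all norms. -/
def Bdd (B : ι → X → X) : Prop :=
  ∃ c, 0 ≤ c ∧ ∀ i s v, F.N i s (B i v) ≤ c * F.N i s v

/-- Operators which lose one derivative. -/
def Loses (B : ι → X → X) : Prop :=
  ∃ c, 0 ≤ c ∧ ∀ i s v, F.N i s (B i v) ≤ c * F.N i (s + 1) v

/-- Trilinear maps which are bounded in all norms. -/
def TriBdd (T : X →L[ℝ] X →L[ℝ] X →L[ℝ] X) : Prop :=
  ∃ c, 0 ≤ c ∧ ∀ i s a b e, F.N i s (T a b e) ≤ c * F.N i s a * F.N i s b * F.N i s e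

/-- `-B` generates a contraction semigroup, expressed by the energy estimate. -/
def Dissipative (B : ι → X → X) : Prop :=
  ∀ i s (w f : ℝ → X) (m t : ℝ), (∀ r, HasDerivAt w (-B i (w r) + f r) r) → 0 ≤ t →
    (∀ r ∈ Icc 0 t, F.N i s (f r) ≤ m) → F.N i s (w t) ≤ F.N i s (w 0) + t * m

variable {F} {S : ℝ} {s : ℕ} {g g' : ι → ℝ → ℝ} {v w : ι → ℝ → X}

lemma UB.anti (h : F.UB S s g v) {S' : ℝ} (hS : S' ≤ S) : F.UB S' s g v := by
  obtain ⟨C, hC, h⟩ := h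
  exact ⟨C, hC, fun i t h0 h1 => h i t h0 (h1.trans hS)⟩

lemma UB.mono_s {s' : ℕ} (h : F.UB S s g v) (hs : s' ≤ s) : F.UB S s' g v := by
  obtain ⟨C, hC, h⟩ := h
  exact ⟨C, hC, fun i t h0 h1 => (F.N_mono i hs _).trans (h i t h0 h1)⟩

lemma UB.mono (h : F.UB S s g v) (hg : ∀ i t, g i t ≤ g' i t) : F.UB S s g' v := by
  obtain ⟨C, hC, h⟩ := h
  exact ⟨C, hC, fun i t h0 h1 => (h i t h0 h1).trans (mul_le_mul_of_nonneg_left (hg i t) hC)⟩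

lemma UB.mono_E {m m' : ℕ} (h : F.UB S s (F.E m) v) (hm : m' ≤ m) : F.UB S s (F.E m') v :=
  h.mono fun i _ => pow_le_pow_of_le_one (F.pos i).le (F.le_one i) hm

lemma UB.congr (h : F.UB S s g v) (hvw : ∀ i t, w i t = v i t) : F.UB S s g w := by
  obtain ⟨C, hC, h⟩ := h
  exact ⟨C, hC, fun i t h0 h1 => by rw [hvw]; exact h i t h0 h1⟩

lemma UB.add (hv : F.UB S s g v) (hw : F.UB S s g w) : F.UB S s g (fun i t => v i t + w i t) := by
  obtain ⟨C, hC, hv⟩ := hv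
  obtain ⟨C', hC', hw⟩ := hw
  refine ⟨C + C', by positivity, fun i t h0 h1 => (F.N_add_le i s _ _).trans ?_⟩
  rw [add_mul]
  exact add_le_add (hv i t h0 h1) (hw i t h0 h1)

lemma UB.neg (hv : F.UB S s g v) : F.UB S s g (fun i t => -v i t) := by
  obtain ⟨C, hC, hv⟩ := hv
  exact ⟨C, hC, fun i t h0 h1 => by rw [F.N_neg]; exact hv i t h0 h1⟩

lemma UB.sub (hv : F.UB S s g v) (hw : F.UB S s g w) : F.UB S s g (fun i t => v i t - w i t) := by
  simp only [sub_eq_add_neg]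
  exact hv.add hw.neg

lemma UB.zero (hg : ∀ i t, 0 ≤ g i t) : F.UB S s g (fun _ _ => (0 : X)) :=
  ⟨1, zero_le_one, fun i t _ _ => by simpa [N] using hg i t⟩

lemma E_nonneg (m : ℕ) (i : ι) (t : ℝ) : 0 ≤ F.E m i t := pow_nonneg (F.pos i).le m

lemma UB.sum {κ : Type*} (J : Finset κ) {v : κ → ι → ℝ → X} (hg : ∀ i t, 0 ≤ g i t)
    (h : ∀ j ∈ J, F.UB S s g (v j)) : F.UB S s g (fun i t => ∑ j ∈ J, v j i t) := by
  classical
  induction J using Finset.induction_on with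
  | empty => simpa using UB.zero hg
  | insert j J hj ih =>
    simp only [Finset.sum_insert hj]
    exact (h j (Finset.mem_insert_self _ _)).add
      (ih fun k hk => h k (Finset.mem_insert_of_mem hk))

lemma UB.op (hv : F.UB S s g v) {B : ι → X → X} (hB : F.Bdd B) :
    F.UB S s g (fun i t => B i (v i t)) := by
  obtain ⟨C, hC, hv⟩ := hv
  obtain ⟨c, hc, hB⟩ := hB
  refine ⟨c * C, by positivity, fun i t h0 h1 => (hB i s _).trans ?_⟩
  rw [mul_assoc]
  exact mul_le_mul_of_nonneg_left (hv i t h0 h1) hc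

lemma UB.op_loses (hv : F.UB S (s + 1) g v) {B : ι → X → X} (hB : F.Loses B) :
    F.UB S s g (fun i t => B i (v i t)) := by
  obtain ⟨C, hC, hv⟩ := hv
  obtain ⟨c, hc, hB⟩ := hB
  refine ⟨c * C, by positivity, fun i t h0 h1 => (hB i s _).trans ?_⟩
  rw [mul_assoc]
  exact mul_le_mul_of_nonneg_left (hv i t h0 h1) hc

lemma UB.tri {g₁ g₂ g₃ : ι → ℝ → ℝ} {a b e : ι → ℝ → X} (ha : F.UB S s g₁ a) (hb : F.UB S s g₂ b)
    (he : F.UB S s g₃ e) {T : X →L[ℝ] X →L[ℝ] X →L[ℝ] X} (hT : F.TriBdd T)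
    (hg : ∀ i t, g₁ i t * g₂ i t * g₃ i t ≤ g i t) :
    F.UB S s g (fun i t => T (a i t) (b i t) (e i t)) := by
  obtain ⟨A, hA, ha⟩ := ha
  obtain ⟨B, hB, hb⟩ := hb
  obtain ⟨D, hD, he⟩ := he
  obtain ⟨c, hc, hT⟩ := hT
  refine ⟨c * A * B * D, by positivity, fun i t h0 h1 => (hT i s _ _ _).trans ?_⟩
  have ha := ha i t h0 h1
  have hb := hb i t h0 h1
  have he := he i t h0 h1
  calc c * F.N i s (a i t) * F.N i s (b i t) * F.N i s (e i t)
      ≤ c * (A * g₁ i t) * (B * g₂ i t) * (D * g₃ i t) := by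
        have := F.N_nonneg i s (a i t)
        have := F.N_nonneg i s (b i t)
        have := F.N_nonneg i s (e i t)
        have : 0 ≤ A * g₁ i t := by linarith
        have : 0 ≤ B * g₂ i t := by linarith
        gcongr
    _ = c * A * B * D * (g₁ i t * g₂ i t * g₃ i t) := by ring
    _ ≤ c * A * B * D * g i t := mul_le_mul_of_nonneg_left (hg i t) (by positivity)

lemma UB.tri_E {m₁ m₂ m₃ m : ℕ} {a b e : ι → ℝ → X} (ha : F.UB S s (F.E m₁) a)
    (hb : F.UB S s (F.E m₂) b) (he : F.UB S s (F.E m₃) e) {T : X →L[ℝ] X →L[ℝ] X →L[ℝ] X}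
    (hT : F.TriBdd T) (hm : m ≤ m₁ + m₂ + m₃) :
    F.UB S s (F.E m) (fun i t => T (a i t) (b i t) (e i t)) :=
  ha.tri hb he hT fun i t => by
    simp only [E, ← pow_add]
    exact pow_le_pow_of_le_one (F.pos i).le (F.le_one i) hm

lemma UB.smul_pow {m : ℕ} (k : ℕ) {m' : ℕ} (hv : F.UB S s (F.E m) v) (hm : m' ≤ m + k) :
    F.UB S s (F.E m') (fun i t => F.ε i ^ k • v i t) := by
  obtain ⟨C, hC, hv⟩ := hv
  refine ⟨C, hC, fun i t h0 h1 => ?_⟩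
  have hp := (F.pos i).le
  rw [F.N_smul, abs_of_nonneg (pow_nonneg hp _)]
  calc F.ε i ^ k * F.N i s (v i t) ≤ F.ε i ^ k * (C * F.ε i ^ m) :=
        mul_le_mul_of_nonneg_left (hv i t h0 h1) (by positivity)
    _ = C * F.ε i ^ (m + k) := by ring
    _ ≤ C * F.ε i ^ m' :=
        mul_le_mul_of_nonneg_left (pow_le_pow_of_le_one hp (F.le_one i) hm) hC

/-- Energy estimate for a forcing which is partly controlled by a gauge `φ`. -/
lemma Dissipative.bound {B : ι → X → X} (hB : F.Dissipative B) {m : ℕ} {w f₁ f₂ : ι → ℝ → X}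
    {φ : ι → ℝ → ℝ} (hw : ∀ i t, HasDerivAt (w i) (-B i (w i t) + (f₁ i t + F.ε i • f₂ i t)) t)
    (h0 : ∃ C, 0 ≤ C ∧ ∀ i, F.N i s (w i 0) ≤ C * F.ε i ^ m) (h1 : F.UB S s (F.E (m + 1)) f₁)
    (h2 : F.UB S s φ f₂) :
    ∃ C, 0 ≤ C ∧ ∀ i t, 0 ≤ t → t * F.ε i ≤ S → ∀ M, 0 ≤ M → (∀ r ∈ Icc 0 t, φ i r ≤ M) →
      F.N i s (w i t) ≤ C * F.ε i ^ m + C * (t * F.ε i) * M := by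
  obtain ⟨C₀, hC₀, h0⟩ := h0
  obtain ⟨C₁, hC₁, h1⟩ := h1
  obtain ⟨C₂, hC₂, h2⟩ := h2
  refine ⟨C₀ + C₁ * |S| + C₂, by positivity, fun i t ht hS M hM hφ => ?_⟩
  have hp := F.pos i
  have key := hB i s (w i) (fun t => f₁ i t + F.ε i • f₂ i t) (C₁ * F.ε i ^ (m + 1) +
    F.ε i * (C₂ * M)) t (hw i) ht (fun r hr => by
      have hr2 : r * F.ε i ≤ S := (mul_le_mul_of_nonneg_right hr.2 hp.le).trans hS
      refine (F.N_add_le i s _ _).trans (add_le_add (h1 i r hr.1 hr2) ?_)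
      rw [F.N_smul, abs_of_pos hp]
      refine mul_le_mul_of_nonneg_left ((h2 i r hr.1 hr2).trans ?_) hp.le
      exact mul_le_mul_of_nonneg_left (hφ r hr) hC₂)
  have hpm : 0 ≤ F.ε i ^ m := by positivity
  -- The horizon has length at most S/ε, so time integration of `f₁` costs exactly one power of ε.
  have e1 : t * (C₁ * F.ε i ^ (m + 1)) ≤ C₁ * |S| * F.ε i ^ m := by
    calc t * (C₁ * F.ε i ^ (m + 1)) = C₁ * (t * F.ε i) * F.ε i ^ m := by ring
      _ ≤ C₁ * |S| * F.ε i ^ m := by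
        have := hS.trans (le_abs_self S)
        gcongr
  have e2 : 0 ≤ t * F.ε i * M := by positivity
  have e3 : 0 ≤ C₂ * F.ε i ^ m := by positivity
  have e4 : 0 ≤ (C₀ + C₁ * |S|) * (t * F.ε i * M) := by positivity
  nlinarith [h0 i]

lemma Dissipative.uB {B : ι → X → X} (hB : F.Dissipative B) {m : ℕ} {w f : ι → ℝ → X}
    (hw : ∀ i t, HasDerivAt (w i) (-B i (w i t) + f i t) t)
    (h0 : ∃ C, 0 ≤ C ∧ ∀ i, F.N i s (w i 0) ≤ C * F.ε i ^ m) (h1 : F.UB S s (F.E (m + 1)) f) :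
    F.UB S s (F.E m) w := by
  obtain ⟨C, hC, h⟩ := hB.bound (f₂ := fun _ _ => 0) (φ := fun _ _ => 0)
    (fun i t => by simpa using hw i t) h0 h1 (UB.zero fun _ _ => le_rfl)
  refine ⟨C, hC, fun i t ht hS => ?_⟩
  simpa [E] using h i t ht hS 0 le_rfl (fun _ _ => le_rfl)

/-- Short-time absorption of linear terms. -/
lemma absorb (F : Frame ι X) (hS : 0 < S) {m : ℕ} {φ : ι → ℝ → ℝ}
    (hcont : ∀ i, ContinuousOn (φ i) {t | 0 ≤ t ∧ t * F.ε i ≤ S}) (hφ : ∀ i t, 0 ≤ φ i t)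
    (h : ∃ C, 0 ≤ C ∧ ∀ i t, 0 ≤ t → t * F.ε i ≤ S → ∀ M, 0 ≤ M → (∀ r ∈ Icc 0 t, φ i r ≤ M) →
      φ i t ≤ C * F.ε i ^ m + C * (t * F.ε i) * M) :
    ∃ S', 0 < S' ∧ S' ≤ S ∧ ∃ C, 0 ≤ C ∧ ∀ i t, 0 ≤ t → t * F.ε i ≤ S' →
      φ i t ≤ C * F.ε i ^ m := by
  obtain ⟨C, hC, h⟩ := h
  -- The horizon is chosen so that the factor C·tε of the running maximum is at most 1/2.
  have hS' : 0 < 1 / (2 * (C + 1)) := by positivity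
  refine ⟨min S (1 / (2 * (C + 1))), lt_min hS hS', min_le_left _ _, 2 * C, by positivity,
    fun i t ht htS => ?_⟩
  have hp := F.pos i
  -- The hypothesis is applied at a maximum point `r` of `φ i` on [0, t], with M the maximum itself;
  -- half of it is then absorbed on the left.
  obtain ⟨r, hr, hmax⟩ := (isCompact_Icc (a := (0 : ℝ)) (b := t)).exists_isMaxOn
    ⟨0, left_mem_Icc.2 ht⟩ ((hcont i).mono fun r hr => ⟨hr.1,
      (mul_le_mul_of_nonneg_right hr.2 hp.le).trans (htS.trans (min_le_left _ _))⟩)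
  have hr2 : r * F.ε i ≤ min S (1 / (2 * (C + 1))) :=
    (mul_le_mul_of_nonneg_right hr.2 hp.le).trans htS
  have h1 := h i r hr.1 (hr2.trans (min_le_left _ _)) (φ i r) (hφ i r)
    (fun q hq => hmax ⟨hq.1, hq.2.trans hr.2⟩)
  have h2 : C * (r * F.ε i) ≤ 1 / 2 := by
    have h3 : r * F.ε i ≤ 1 / (2 * (C + 1)) := hr2.trans (min_le_right _ _)
    calc C * (r * F.ε i) ≤ C * (1 / (2 * (C + 1))) := mul_le_mul_of_nonneg_left h3 hC
      _ ≤ (C + 1) * (1 / (2 * (C + 1))) := mul_le_mul_of_nonneg_right (by linarith) hS'.le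
      _ = 1 / 2 := by field_simp
  have h3 : C * (r * F.ε i) * φ i r ≤ 1 / 2 * φ i r := mul_le_mul_of_nonneg_right h2 (hφ i r)
  have h4 : φ i t ≤ φ i r := hmax (right_mem_Icc.2 ht)
  linarith

/-- Short-time bootstrap for cubic estimates. -/
lemma bootstrap (F : Frame ι X) (hS : 0 < S) {φ : ι → ℝ → ℝ}
    (hcont : ∀ i, ContinuousOn (φ i) {t | 0 ≤ t ∧ t * F.ε i ≤ S}) (hφ : ∀ i t, 0 ≤ φ i t)
    (h : ∃ C, 0 ≤ C ∧ ∀ i t, 0 ≤ t → t * F.ε i ≤ S → ∀ M, 0 ≤ M → (∀ r ∈ Icc 0 t, φ i r ≤ M) →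
      φ i t ≤ C + C * (t * F.ε i) * M ^ 3) :
    ∃ S', 0 < S' ∧ S' ≤ S ∧ ∃ C, 0 ≤ C ∧ ∀ i t, 0 ≤ t → t * F.ε i ≤ S' → φ i t ≤ C := by
  obtain ⟨C, hC, h⟩ := h
  set M : ℝ := C + 1 with hMdef
  have hM : 0 < M := by positivity
  -- As long as φ ≤ M + 1 and tε ≤ c, the cubic term is at most 1/2, hence φ ≤ C + 1/2 < M + 1: the
  -- bound improves itself strictly.
  set c : ℝ := 1 / (2 * M * (M + 1) ^ 3) with hc
  have hcpos : 0 < c := by positivity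
  refine ⟨min S c, lt_min hS hcpos, min_le_left _ _, M + 1, by positivity, fun i t ht htS => ?_⟩
  have hp := F.pos i
  have hsub : ∀ r ∈ Icc 0 t, r * F.ε i ≤ S ∧ r * F.ε i ≤ c := fun r hr =>
    le_min_iff.1 ((mul_le_mul_of_nonneg_right hr.2 hp.le).trans htS)
  have hco : ContinuousOn (φ i) (Icc 0 t) := (hcont i).mono fun r hr => ⟨hr.1, (hsub r hr).1⟩
  have step : ∀ r ∈ Icc 0 t, (∀ q ∈ Icc 0 r, φ i q ≤ M + 1) → φ i r < M + 1 := by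
    intro r hr hq
    have h1 := h i r hr.1 (hsub r hr).1 (M + 1) (by positivity) hq
    have h2 : C * (r * F.ε i) * (M + 1) ^ 3 ≤ M * c * (M + 1) ^ 3 := by
      have := (hsub r hr).2
      have h3 : 0 ≤ r * F.ε i := mul_nonneg hr.1 hp.le
      have : C ≤ M := by linarith
      gcongr
    have h3 : M * c * (M + 1) ^ 3 = 1 / 2 := by rw [hc]; field_simp
    linarith
  by_contra hcon
  push Not at hcon
  -- Continuity argument: were the threshold M + 1 reached, there would be a first time at which
  -- this happens. Up to that time φ ≤ M + 1, so the strict improvement excludes it.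
  set B : Set ℝ := {r ∈ Icc 0 t | M + 1 ≤ φ i r} with hB
  have hBc : IsClosed B := hco.preimage_isClosed_of_isClosed isClosed_Icc isClosed_Ici
  have hBne : B.Nonempty := ⟨t, right_mem_Icc.2 ht, hcon.le⟩
  have hBb : BddBelow B := ⟨0, fun r hr => hr.1.1⟩
  have hmem := hBc.csInf_mem hBne hBb
  set r := sInf B with hr
  have hlt : φ i r < M + 1 := by
    apply step r hmem.1
    intro q hq
    rcases eq_or_lt_of_le hq.2 with hqr | hqr
    · rw [hqr]
      by_cases h0 : r = 0
      · have := h i 0 le_rfl (by rw [zero_mul]; exact hS.le) (φ i 0) (hφ i 0) (fun p hp => by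
          rw [Icc_self, mem_singleton_iff] at hp; rw [hp])
        rw [h0]
        rw [zero_mul, mul_zero, zero_mul] at this
        linarith
      · have hq0 : 0 < r := lt_of_le_of_ne hmem.1.1 (Ne.symm h0)
        have hcw : ContinuousWithinAt (φ i) (Ico 0 r) r :=
          (hco r hmem.1).mono fun p hp => ⟨hp.1, hp.2.le.trans hmem.1.2⟩
        have hne : (𝓝[Ico 0 r] r).NeBot := by
          rw [← mem_closure_iff_nhdsWithin_neBot, closure_Ico hq0.ne]
          exact right_mem_Icc.2 hq0.le
        refine le_of_tendsto hcw ?_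
        filter_upwards [self_mem_nhdsWithin] with p hp
        by_contra hp2
        push Not at hp2
        exact absurd (csInf_le hBb ⟨⟨hp.1, hp.2.le.trans hmem.1.2⟩, hp2.le⟩)
          (not_le.2 (by rw [← hr]; exact hp.2))
    · by_contra hp2
      push Not at hp2
      exact absurd (csInf_le hBb ⟨⟨hq.1, hqr.le.trans hmem.1.2⟩, hp2.le⟩)
        (not_le.2 (by rw [← hr]; exact hqr))
  exact absurd hmem.2 (not_le.2 hlt)

end Frame

end Abstract

/-! ### ### Abstract wave systems: slow and fast parts -/

section AbstractWave

variable {ι X : Type*} [NormedAddCommGroup X] [NormedSpace ℝ X]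

/-- Triples of harmonics with a given sum. -/
def triads (j : ℤ) : Finset (ℤ × ℤ × ℤ) :=
  (harmonics 3 ×ˢ harmonics 3 ×ˢ harmonics 3).filter (fun J => J.1 + J.2.1 + J.2.2 = j)

/-- The nonlinearity of the envelope equations. -/
def envSum (T : X →L[ℝ] X →L[ℝ] X →L[ℝ] X) (j : ℤ) (U : ℤ → X) : X :=
  ∑ J ∈ triads j, T (U J.1) (U J.2.1) (U J.2.2)

lemma mem_harmonics_three {j : ℤ} :
    j ∈ harmonics 3 ↔ j = 1 ∨ j = -1 ∨ j = 3 ∨ j = -3 := by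
  have : harmonics 3 = {1, -1, 3, -3} := by decide
  simp [this]

lemma mem_of_mem_triads {j : ℤ} {J : ℤ × ℤ × ℤ} (h : J ∈ triads j) :
    J.1 ∈ harmonics 3 ∧ J.2.1 ∈ harmonics 3 ∧ J.2.2 ∈ harmonics 3 := by
  simp only [triads, Finset.mem_filter, Finset.mem_product] at h
  exact h.1

/-- A family of linear wave operators with a trilinear interaction, together with the solution
operators of the nonresonance (Sylvester) equations. -/
structure WaveSystem (F : Frame ι X) where
  A : ι → X →L[ℝ] X
  P : ι → X →L[ℝ] X
  K : ι → X →L[ℝ] X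
  Λ : ι → X →L[ℝ] X
  L₁ : X →L[ℝ] X
  L₃ : X →L[ℝ] X
  L₅ : X →L[ℝ] X
  R₃ : X →L[ℝ] X
  R₅ : X →L[ℝ] X
  conj : X →L[ℝ] X
  T : X →L[ℝ] X →L[ℝ] X →L[ℝ] X
  Ts : X →L[ℝ] X →L[ℝ] X →L[ℝ] X
  Θ : X →L[ℝ] X →L[ℝ] X →L[ℝ] X
  Θ' : X →L[ℝ] X →L[ℝ] X →L[ℝ] X
  loses_A : F.Loses fun i => A i
  loses_Λ : F.Loses fun i => Λ i
  bdd_P : F.Bdd fun i => P i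
  bdd_K : F.Bdd fun i => K i
  bdd_R₃ : F.Bdd fun _ => R₃
  bdd_R₅ : F.Bdd fun _ => R₅
  bdd_conj : F.Bdd fun _ => conj
  triBdd_T : F.TriBdd T
  triBdd_Ts : F.TriBdd Ts
  triBdd_Θ : F.TriBdd Θ
  triBdd_Θ' : F.TriBdd Θ'
  -- For b = c = z this is the derivative of z ↦ T(z, z, z) in the direction a.
  Ts_apply : ∀ a b c, Ts a b c = T a b c + T b a c + T b c a
  L₃_R₃ : ∀ v, L₃ (R₃ v) = v
  L₅_R₅ : ∀ v, L₅ (R₅ v) = v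
  -- If y' ≈ -ε⁻¹ L₁ y, then (∂ₜ + ε⁻¹ L₃) applied to ε² Θ(y, z, z) has leading part ε (L₃ Θ(y, z,
  -- z) - Θ(L₁ y, z, z)) = ε Ts(y, z, z). Thus Θ removes sources which oscillate with L₁.
  sylvester : ∀ a b c, L₃ (Θ a b c) = Θ (L₁ a) b c + Ts a b c
  sylvester' : ∀ a b c, L₅ (Θ' a b c) = Θ' (L₃ a) b c + Ts a b c
  -- P is a spectral projection of the generator. The eigenvalue Λ carries no factor 1/ε, only the
  -- loss of one derivative.
  P_comm : ∀ i v, P i ((F.ε i)⁻¹ • L₁ v + A i v) = Λ i (P i v)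
  P_eigen : ∀ i v, (F.ε i)⁻¹ • L₁ (P i v) + A i (P i v) = Λ i (P i v)
  -- Off the range of P the generator has size at least of order 1/ε; K is its inverse there,
  -- rescaled by ε⁻¹ so as to be bounded uniformly.
  K_inv : ∀ i v, (F.ε i)⁻¹ • L₁ (K i v) + A i (K i v) = (F.ε i)⁻¹ • (v - P i v)
  diss₁ : F.Dissipative fun i v => (F.ε i)⁻¹ • L₁ v + A i v
  diss₃ : F.Dissipative fun i v => (F.ε i)⁻¹ • L₃ v + A i v
  diss₅ : F.Dissipative fun i v => (F.ε i)⁻¹ • L₅ v + A i v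

/-- A family of approximate solutions of the envelope equations, with uniform bounds in the
`3`-norm and polarized initial data. -/
structure WaveSystem.Sol {F : Frame ι X} (Sy : WaveSystem F) (S : ℝ) where
  U : ι → ℤ → ℝ → X
  e : ι → ℤ → ℝ → X
  deriv₁ : ∀ i t, HasDerivAt (U i 1) (-((F.ε i)⁻¹ • Sy.L₁ (U i 1 t) + Sy.A i (U i 1 t)) +
    F.ε i • (envSum Sy.T 1 (fun j => U i j t) + e i 1 t)) t
  deriv₃ : ∀ i t, HasDerivAt (U i 3) (-((F.ε i)⁻¹ • Sy.L₃ (U i 3 t) + Sy.A i (U i 3 t)) +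
    F.ε i • (envSum Sy.T 3 (fun j => U i j t) + e i 3 t)) t
  conj₁ : ∀ i t, U i (-1) t = Sy.conj (U i 1 t)
  conj₃ : ∀ i t, U i (-3) t = Sy.conj (U i 3 t)
  bound₁ : F.UB S 3 (F.E 0) fun i => U i 1
  bound₃ : F.UB S 3 (F.E 0) fun i => U i 3
  defect₁ : F.UB S 2 (F.E 4) fun i => e i 1
  defect₃ : F.UB S 2 (F.E 4) fun i => e i 3
  init₁ : ∃ C, 0 ≤ C ∧ ∀ i, F.N i 2 (U i 1 0 - Sy.P i (U i 1 0)) ≤ C * F.ε i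
  init₃ : ∀ i, U i 3 0 = 0

namespace WaveSystem.Sol

open NLDispersive.Frame

variable {F : Frame ι X} {Sy : WaveSystem F} {S : ℝ}

/-- Restriction to a shorter time interval. -/
def anti (u : Sy.Sol S) {S' : ℝ} (h : S' ≤ S) : Sy.Sol S' :=
  { u with
    bound₁ := u.bound₁.anti h
    bound₃ := u.bound₃.anti h
    defect₁ := u.defect₁.anti h
    defect₃ := u.defect₃.anti h }

variable (u : Sy.Sol S)

/-- The polarized part of the first harmonic. -/
def z (i : ι) (t : ℝ) : X := Sy.P i (u.U i 1 t)

/-- The remainder of the first harmonic. -/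
def y (i : ι) (t : ℝ) : X := u.U i 1 t - u.z i t

/-- The nonlinearity with defect. -/
def nl (j : ℤ) (i : ι) (t : ℝ) : X := envSum Sy.T j (fun l => u.U i l t) + u.e i j t

/-- The `O(ε)` part of the derivative of `z`, divided by `ε`. -/
def fz (i : ι) (t : ℝ) : X := Sy.P i (u.nl 1 i t)

/-- The leading part of the derivative of `z`. -/
def z₁ (i : ι) (t : ℝ) : X := -Sy.Λ i (u.z i t)

/-- The time derivative of `z`. -/
def z' (i : ι) (t : ℝ) : X := u.z₁ i t + F.ε i • u.fz i t

/-- Applying P turns the generator into Λ, so the singular factor 1/ε disappears: `z` varies slowly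
and its derivative is `O(1)` with one derivative less. -/
lemma hasDerivAt_z (i : ι) (t : ℝ) : HasDerivAt (u.z i) (u.z' i t) t := by
  have h := (Sy.P i).hasFDerivAt.comp_hasDerivAt t (u.deriv₁ i t)
  have e : u.z' i t = Sy.P i (-((F.ε i)⁻¹ • Sy.L₁ (u.U i 1 t) + Sy.A i (u.U i 1 t)) +
      F.ε i • (envSum Sy.T 1 (fun j => u.U i j t) + u.e i 1 t)) := by
    rw [map_add, map_neg, Sy.P_comm, map_smul]; rfl
  rw [e]
  exact h

/-- P commutes with the generator, hence the complementary part obeys the same linear equation,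
forced by the complementary part of the nonlinearity. -/
lemma hasDerivAt_y (i : ι) (t : ℝ) : HasDerivAt (u.y i)
    (-((F.ε i)⁻¹ • Sy.L₁ (u.y i t) + Sy.A i (u.y i t)) +
      F.ε i • (u.nl 1 i t - u.fz i t)) t := by
  have h := (u.deriv₁ i t).sub (u.hasDerivAt_z i t)
  refine HasDerivAt.congr_deriv (f := u.y i) h ?_
  have h2 := Sy.P_eigen i (u.U i 1 t)
  have h3 : Sy.Λ i (Sy.P i (u.U i 1 t)) = -u.z₁ i t := by rw [z₁, neg_neg]; rfl
  rw [h3] at h2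
  have h4 : u.z₁ i t = -((F.ε i)⁻¹ • Sy.L₁ (u.z i t) + Sy.A i (u.z i t)) := by
    rw [z, h2, neg_neg]
  have h5 : u.z' i t = -((F.ε i)⁻¹ • Sy.L₁ (u.z i t) + Sy.A i (u.z i t)) + F.ε i • u.fz i t := by
    rw [← h4]; rfl
  rw [h5]
  simp only [y, nl, map_sub]
  module

lemma bound_U {j : ℤ} (hj : j ∈ harmonics 3) : F.UB S 3 (F.E 0) fun i => u.U i j := by
  rcases mem_harmonics_three.1 hj with rfl | rfl | rfl | rfl
  · exact u.bound₁
  · exact (u.bound₁.op Sy.bdd_conj).congr fun i t => u.conj₁ i t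
  · exact u.bound₃
  · exact (u.bound₃.op Sy.bdd_conj).congr fun i t => u.conj₃ i t

lemma bound_envSum {V : ι → ℤ → ℝ → X} {s m : ℕ}
    (h : ∀ j ∈ harmonics 3, F.UB S s (F.E 0) fun i => V i j) (j : ℤ) (hm : m = 0) :
    F.UB S s (F.E m) fun i t => envSum Sy.T j (fun l => V i l t) := by
  subst hm
  refine UB.sum _ (E_nonneg 0) fun J hJ => ?_
  obtain ⟨h1, h2, h3⟩ := mem_of_mem_triads hJ
  exact (h _ h1).tri_E (h _ h2) (h _ h3) Sy.triBdd_T (by omega)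

lemma bound_z : F.UB S 3 (F.E 0) u.z := u.bound₁.op Sy.bdd_P

lemma bound_nl₁ : F.UB S 2 (F.E 0) (u.nl 1) :=
  ((bound_envSum (fun _ hj => u.bound_U hj) 1 rfl).mono_s (by omega)).add
    (u.defect₁.mono_E (by omega))

lemma bound_fz : F.UB S 2 (F.E 0) u.fz := u.bound_nl₁.op Sy.bdd_P

lemma bound_z₁ : F.UB S 2 (F.E 0) u.z₁ := (u.bound_z.op_loses Sy.loses_Λ).neg

lemma bound_z' : F.UB S 2 (F.E 0) u.z' := by
  refine u.bound_z₁.add ?_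
  simpa using u.bound_fz.smul_pow (m' := 0) 1 (by omega)

/-- The slow parts of all harmonics. -/
def a (i : ι) (j : ℤ) (t : ℝ) : X :=
  if j = 1 then u.z i t else if j = -1 then Sy.conj (u.z i t) else 0

/-- The time derivatives of the slow parts. -/
def a' (i : ι) (j : ℤ) (t : ℝ) : X :=
  if j = 1 then u.z' i t else if j = -1 then Sy.conj (u.z' i t) else 0

lemma hasDerivAt_a (i : ι) (j : ℤ) (t : ℝ) : HasDerivAt (u.a i j) (u.a' i j t) t := by
  unfold a a'
  split_ifs
  · exact u.hasDerivAt_z i t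
  · exact Sy.conj.hasFDerivAt.comp_hasDerivAt t (u.hasDerivAt_z i t)
  · exact hasDerivAt_const _ _

lemma bound_a (j : ℤ) : F.UB S 3 (F.E 0) fun i => u.a i j := by
  unfold a
  split_ifs
  · exact u.bound_z
  · exact u.bound_z.op Sy.bdd_conj
  · exact UB.zero (E_nonneg 0)

lemma bound_a' (j : ℤ) : F.UB S 2 (F.E 0) fun i => u.a' i j := by
  unfold a'
  split_ifs
  · exact u.bound_z'
  · exact u.bound_z'.op Sy.bdd_conj
  · exact UB.zero (E_nonneg 0)

/-- The slow part of the nonlinearity. -/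
def g (j : ℤ) (i : ι) (t : ℝ) : X := envSum Sy.T j (fun l => u.a i l t)

/-- The time derivative of the slow part of the nonlinearity. -/
def g' (j : ℤ) (i : ι) (t : ℝ) : X := ∑ J ∈ triads j,
  (Sy.T (u.a' i J.1 t) (u.a i J.2.1 t) (u.a i J.2.2 t) +
    Sy.T (u.a i J.1 t) (u.a' i J.2.1 t) (u.a i J.2.2 t) +
    Sy.T (u.a i J.1 t) (u.a i J.2.1 t) (u.a' i J.2.2 t))

lemma hasDerivAt_g (j : ℤ) (i : ι) (t : ℝ) : HasDerivAt (u.g j i) (u.g' j i t) t := by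
  unfold g g' envSum
  exact HasDerivAt.fun_sum fun J _ => HasDerivAt.trilinear Sy.T (u.hasDerivAt_a i _ t)
    (u.hasDerivAt_a i _ t) (u.hasDerivAt_a i _ t)

lemma bound_g (j : ℤ) : F.UB S 3 (F.E 0) (u.g j) := bound_envSum (fun l _ => u.bound_a l) j rfl

lemma bound_g' (j : ℤ) : F.UB S 2 (F.E 0) (u.g' j) := by
  refine UB.sum _ (E_nonneg 0) fun J _ => ?_
  have ha := fun j => (u.bound_a j).mono_s (s' := 2) (by omega)
  exact (((u.bound_a' _).tri_E (ha _) (ha _) Sy.triBdd_T (by omega)).add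
    ((ha _).tri_E (u.bound_a' _) (ha _) Sy.triBdd_T (by omega))).add
    ((ha _).tri_E (ha _) (u.bound_a' _) Sy.triBdd_T (by omega))

/-- The gauge which measures the fast part of the solution. -/
def φ (s : ℕ) (i : ι) (t : ℝ) : ℝ := F.N i s (u.y i t) + F.N i s (u.U i 3 t)

lemma φ_nonneg (s : ℕ) (i : ι) (t : ℝ) : 0 ≤ u.φ s i t :=
  add_nonneg (F.N_nonneg _ _ _) (F.N_nonneg _ _ _)

lemma continuous_φ (s : ℕ) (i : ι) : Continuous (u.φ s i) :=
  ((F.continuous_N i s).comp (continuous_iff_continuousAt.2 fun t =>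
    (u.hasDerivAt_y i t).continuousAt)).add
  ((F.continuous_N i s).comp (continuous_iff_continuousAt.2 fun t =>
    (u.deriv₃ i t).continuousAt))

/-- The harmonics ±3 have no slow part, and the first one differs from its slow part by `y`. So `y`
and `U_3` control all deviations, the negative harmonics being conjugates. -/
lemma bound_fast {s : ℕ} {g : ι → ℝ → ℝ} (h1 : F.UB S s g u.y)
    (h3 : F.UB S s g fun i => u.U i 3) {j : ℤ} (hj : j ∈ harmonics 3) :
    F.UB S s g fun i t => u.U i j t - u.a i j t := by
  rcases mem_harmonics_three.1 hj with rfl | rfl | rfl | rfl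
  · exact h1.congr fun i t => by simp [a, y]
  · exact (h1.op Sy.bdd_conj).congr fun i t => by simp [a, y, u.conj₁]
  · exact h3.congr fun i t => by simp [a]
  · exact (h3.op Sy.bdd_conj).congr fun i t => by simp [a, u.conj₃]

/-- Telescoping of the trilinear terms, replacing one argument at a time: each summand contains one
deviation `U - a`, measured by γ, and two bounded factors. -/
lemma bound_envSum_sub {s : ℕ} {γ : ι → ℝ → ℝ} (hγ : ∀ i t, 0 ≤ γ i t) (h1 : F.UB S s γ u.y)
    (h3 : F.UB S s γ fun i => u.U i 3) (hs : s ≤ 3) (j : ℤ) :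
    F.UB S s γ fun i t => envSum Sy.T j (fun l => u.U i l t) - u.g j i t := by
  have key : F.UB S s γ fun i t => ∑ J ∈ triads j,
      (Sy.T (u.U i J.1 t - u.a i J.1 t) (u.U i J.2.1 t) (u.U i J.2.2 t) +
        Sy.T (u.a i J.1 t) (u.U i J.2.1 t - u.a i J.2.1 t) (u.U i J.2.2 t) +
        Sy.T (u.a i J.1 t) (u.a i J.2.1 t) (u.U i J.2.2 t - u.a i J.2.2 t)) := by
    refine UB.sum _ hγ fun J hJ => ?_
    obtain ⟨j1, j2, j3⟩ := mem_of_mem_triads hJ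
    have hf := fun {j} (hj : j ∈ harmonics 3) => u.bound_fast h1 h3 hj
    have hU := fun {j} (hj : j ∈ harmonics 3) => (u.bound_U hj).mono_s hs
    have ha := fun j => (u.bound_a j).mono_s hs
    refine (((hf j1).tri (hU j2) (hU j3) Sy.triBdd_T ?_).add
      ((ha _).tri (hf j2) (hU j3) Sy.triBdd_T ?_)).add
      ((ha _).tri (ha _) (hf j3) Sy.triBdd_T ?_) <;> intro i t <;> simp [E]
  refine key.congr fun i t => ?_
  simp only [g, envSum, ← Finset.sum_sub_distrib]
  refine Finset.sum_congr rfl fun J _ => ?_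
  simp only [map_sub, _root_.sub_apply]
  abel

lemma bound_y_φ (s : ℕ) : F.UB S s (u.φ s) u.y :=
  ⟨1, zero_le_one, fun i t _ _ => by
    rw [one_mul]; exact le_add_of_nonneg_right (F.N_nonneg _ _ _)⟩

lemma bound_U₃_φ (s : ℕ) : F.UB S s (u.φ s) fun i => u.U i 3 :=
  ⟨1, zero_le_one, fun i t _ _ => by
    rw [one_mul]; exact le_add_of_nonneg_left (F.N_nonneg _ _ _)⟩

end WaveSystem.Sol

end AbstractWave

/-! ### ### First-order bounds for the fast parts -/

section AbstractWave

variable {ι X : Type*} [NormedAddCommGroup X] [NormedSpace ℝ X]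

namespace Frame

variable {F : Frame ι X} {S : ℝ} {s m : ℕ} {v w : ι → ℝ → X}

/-- Bounds which are affine in the running maximum of a gauge. -/
def Lin (F : Frame ι X) (S : ℝ) (s m : ℕ) (φ : ι → ℝ → ℝ) (w : ι → ℝ → X) : Prop :=
  ∃ C, 0 ≤ C ∧ ∀ i t, 0 ≤ t → t * F.ε i ≤ S → ∀ M, 0 ≤ M → (∀ r ∈ Icc 0 t, φ i r ≤ M) →
    F.N i s (w i t) ≤ C * F.ε i ^ m + C * (t * F.ε i) * M

lemma Lin.add_uB {φ : ι → ℝ → ℝ} (h : F.Lin S s m φ fun i t => w i t - v i t)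
    (hv : F.UB S s (F.E m) v) : F.Lin S s m φ w := by
  obtain ⟨C, hC, h⟩ := h
  obtain ⟨C', hC', hv⟩ := hv
  refine ⟨C + C', by positivity, fun i t h0 h1 M hM hφ => ?_⟩
  have e : w i t = (w i t - v i t) + v i t := by abel
  rw [e]
  refine (F.N_add_le i s _ _).trans ?_
  have := h i t h0 h1 M hM hφ
  have h2 : F.N i s (v i t) ≤ C' * F.ε i ^ m := hv i t h0 h1
  have : 0 ≤ C' * (t * F.ε i) * M := by have := F.pos i; positivity
  nlinarith

lemma UB.init (hS : 0 ≤ S) (h : F.UB S s (F.E m) v) :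
    ∃ C, 0 ≤ C ∧ ∀ i, F.N i s (v i 0) ≤ C * F.ε i ^ m := by
  obtain ⟨C, hC, h⟩ := h
  exact ⟨C, hC, fun i => h i 0 le_rfl (by simpa using hS)⟩

lemma init_sub (hv : ∃ C, 0 ≤ C ∧ ∀ i, F.N i s (v i 0) ≤ C * F.ε i ^ m)
    (hw : ∃ C, 0 ≤ C ∧ ∀ i, F.N i s (w i 0) ≤ C * F.ε i ^ m) :
    ∃ C, 0 ≤ C ∧ ∀ i, F.N i s (v i 0 - w i 0) ≤ C * F.ε i ^ m := by
  obtain ⟨C, hC, h⟩ := hv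
  obtain ⟨C', hC', h'⟩ := hw
  refine ⟨C + C', by positivity, fun i => ?_⟩
  rw [sub_eq_add_neg]
  refine (F.N_add_le i s _ _).trans ?_
  rw [F.N_neg, add_mul]
  exact add_le_add (h i) (h' i)

lemma init_zero (hv : ∀ i, v i 0 = 0) : ∃ C, 0 ≤ C ∧ ∀ i, F.N i s (v i 0) ≤ C * F.ε i ^ m :=
  ⟨0, le_rfl, fun i => by simp [hv, N]⟩

end Frame

namespace WaveSystem.Sol

open NLDispersive.Frame

variable {F : Frame ι X} {Sy : WaveSystem F} {S : ℝ}

/-- The corrector ε² K g balances the slow source: the generator maps it to ε(g - P g). The new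
sources are ε² K g', small because g is slow, ε times the defect, and ε times the difference of the
full and slow nonlinearities, which is linear in the gauge. The initial value of `y` is `O(ε)` by
polarization of the data. -/
lemma lin_y (u : Sy.Sol S) (hS : 0 < S) : F.Lin S 2 1 (u.φ 2) u.y := by
  have hg' := (u.bound_g' 1).op Sy.bdd_K
  have hq : F.UB S 2 (F.E 1) fun i t => F.ε i ^ 2 • Sy.K i (u.g 1 i t) :=
    (((u.bound_g 1).op Sy.bdd_K).smul_pow 2 (by omega)).mono_s (by omega)
  have hΔ := u.bound_envSum_sub (u.φ_nonneg 2) (u.bound_y_φ 2) (u.bound_U₃_φ 2) (by omega) 1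
  refine Lin.add_uB (Sy.diss₁.bound
    (f₁ := fun i t => F.ε i ^ 1 • (u.e i 1 t - Sy.P i (u.e i 1 t)) -
      F.ε i ^ 2 • Sy.K i (u.g' 1 i t))
    (f₂ := fun i t => (envSum Sy.T 1 (fun l => u.U i l t) - u.g 1 i t) -
      Sy.P i (envSum Sy.T 1 (fun l => u.U i l t) - u.g 1 i t)) (fun i t => ?_) ?_ ?_ ?_) hq
  · have h1 := (u.hasDerivAt_y i t).sub
      (((Sy.K i).hasFDerivAt.comp_hasDerivAt t (u.hasDerivAt_g 1 i t)).const_smul (F.ε i ^ 2))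
    refine h1.congr_deriv ?_
    have h2 := Sy.K_inv i (u.g 1 i t)
    have hε := (F.pos i).ne'
    have h3 : Sy.A i (Sy.K i (u.g 1 i t)) = (F.ε i)⁻¹ • (u.g 1 i t - Sy.P i (u.g 1 i t)) -
      (F.ε i)⁻¹ • Sy.L₁ (Sy.K i (u.g 1 i t)) := by rw [← h2]; abel
    simp only [nl, fz, map_add, map_sub, map_smul, h3]
    match_scalars <;> field_simp <;> ring
  · exact init_sub (by simp only [pow_one]; exact u.init₁) (hq.init hS.le)
  · exact ((u.defect₁.sub (u.defect₁.op Sy.bdd_P)).smul_pow 1 (by omega)).sub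
      (hg'.smul_pow 2 (by omega))
  · exact hΔ.sub (hΔ.op Sy.bdd_P)

/-- Here L₃ is invertible on the whole space, so ε² R₃ g plays the role of the corrector. The term A
R₃ g costs one derivative, which the bound of g in the 3-norm provides. -/
lemma lin_U₃ (u : Sy.Sol S) (hS : 0 < S) : F.Lin S 2 1 (u.φ 2) fun i => u.U i 3 := by
  have hRg := (u.bound_g 3).op Sy.bdd_R₃
  have hq : F.UB S 2 (F.E 1) fun i t => F.ε i ^ 2 • Sy.R₃ (u.g 3 i t) :=
    (hRg.smul_pow 2 (by omega)).mono_s (by omega)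
  have hΔ := u.bound_envSum_sub (u.φ_nonneg 2) (u.bound_y_φ 2) (u.bound_U₃_φ 2) (by omega) 3
  refine Lin.add_uB (Sy.diss₃.bound
    (f₁ := fun i t => F.ε i ^ 1 • u.e i 3 t -
      F.ε i ^ 2 • (Sy.R₃ (u.g' 3 i t) + Sy.A i (Sy.R₃ (u.g 3 i t))))
    (f₂ := fun i t => envSum Sy.T 3 (fun l => u.U i l t) - u.g 3 i t) (fun i t => ?_) ?_ ?_ hΔ) hq
  · have h1 := (u.deriv₃ i t).sub
      ((Sy.R₃.hasFDerivAt.comp_hasDerivAt t (u.hasDerivAt_g 3 i t)).const_smul (F.ε i ^ 2))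
    refine h1.congr_deriv ?_
    have hε := (F.pos i).ne'
    simp only [map_sub, map_smul, Sy.L₃_R₃]
    match_scalars <;> field_simp <;> ring
  · exact init_sub (init_zero u.init₃) (hq.init hS.le)
  · exact (u.defect₃.smul_pow 1 (by omega)).sub
      ((((u.bound_g' 3).op Sy.bdd_R₃).add (hRg.op_loses Sy.loses_A)).smul_pow 2 (by omega))

/-- The fast parts are `O(ε)`. -/
theorem fast_order_one (u : Sy.Sol S) (hS : 0 < S) : ∃ S', 0 < S' ∧ S' ≤ S ∧
    F.UB S' 2 (F.E 1) u.y ∧ F.UB S' 2 (F.E 1) fun i => u.U i 3 := by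
  obtain ⟨C, hC, h1⟩ := u.lin_y hS
  obtain ⟨C', hC', h2⟩ := u.lin_U₃ hS
  obtain ⟨S', hS', hle, D, hD, h⟩ := absorb F hS (m := 1) (φ := u.φ 2)
    (fun i => (u.continuous_φ 2 i).continuousOn) (u.φ_nonneg 2)
    ⟨C + C', by positivity, fun i t h0 hS M hM hφ => by
      have e1 := h1 i t h0 hS M hM hφ
      have e2 := h2 i t h0 hS M hM hφ
      simp only [φ]
      linarith⟩
  exact ⟨S', hS', hle, ⟨D, hD, fun i t h0 h1 =>
    (le_add_of_nonneg_right (F.N_nonneg _ _ _)).trans (h i t h0 h1)⟩, ⟨D, hD, fun i t h0 h1 =>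
    (le_add_of_nonneg_left (F.N_nonneg _ _ _)).trans (h i t h0 h1)⟩⟩

/-- The cubic self-interaction of the polarized part. -/
def g₀ (u : Sy.Sol S) (i : ι) (t : ℝ) : X := Sy.T (u.z i t) (u.z i t) (u.z i t)

lemma hasDerivAt_g₀ (u : Sy.Sol S) (i : ι) (t : ℝ) :
    HasDerivAt (u.g₀ i) (Sy.Ts (u.z' i t) (u.z i t) (u.z i t)) t := by
  have h := HasDerivAt.trilinear Sy.T (u.hasDerivAt_z i t) (u.hasDerivAt_z i t)
    (u.hasDerivAt_z i t)
  rw [Sy.Ts_apply]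
  exact h

lemma bound_g₀ (u : Sy.Sol S) : F.UB S 3 (F.E 0) u.g₀ :=
  u.bound_z.tri_E u.bound_z u.bound_z Sy.triBdd_T (by omega)

/-- The time derivative of `z₁`. -/
def z₁' (u : Sy.Sol S) (i : ι) (t : ℝ) : X := -Sy.Λ i (u.z' i t)

lemma hasDerivAt_z₁ (u : Sy.Sol S) (i : ι) (t : ℝ) : HasDerivAt (u.z₁ i) (u.z₁' i t) t :=
  ((Sy.Λ i).hasFDerivAt.comp_hasDerivAt t (u.hasDerivAt_z i t)).neg

lemma bound_z₁' (u : Sy.Sol S) : F.UB S 1 (F.E 0) u.z₁' := (u.bound_z'.op_loses Sy.loses_Λ).neg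

/-- The leading part of the residual of the first corrector of the third harmonic. -/
def h₀ (u : Sy.Sol S) (i : ι) (t : ℝ) : X :=
  Sy.R₃ (Sy.Ts (u.z₁ i t) (u.z i t) (u.z i t)) + Sy.A i (Sy.R₃ (u.g₀ i t))

/-- The time derivative of `h₀`. -/
def h₀' (u : Sy.Sol S) (i : ι) (t : ℝ) : X :=
  Sy.R₃ (Sy.Ts (u.z₁' i t) (u.z i t) (u.z i t) + Sy.Ts (u.z₁ i t) (u.z' i t) (u.z i t) +
    Sy.Ts (u.z₁ i t) (u.z i t) (u.z' i t)) +
    Sy.A i (Sy.R₃ (Sy.Ts (u.z' i t) (u.z i t) (u.z i t)))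

lemma hasDerivAt_h₀ (u : Sy.Sol S) (i : ι) (t : ℝ) : HasDerivAt (u.h₀ i) (u.h₀' i t) t :=
  (Sy.R₃.hasFDerivAt.comp_hasDerivAt t (HasDerivAt.trilinear Sy.Ts (u.hasDerivAt_z₁ i t)
    (u.hasDerivAt_z i t) (u.hasDerivAt_z i t))).add
  ((Sy.A i).hasFDerivAt.comp_hasDerivAt t
    (Sy.R₃.hasFDerivAt.comp_hasDerivAt t (u.hasDerivAt_g₀ i t)))

lemma bound_h₀ (u : Sy.Sol S) : F.UB S 2 (F.E 0) u.h₀ := by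
  have hz := u.bound_z.mono_s (s' := 2) (by omega)
  exact ((u.bound_z₁.tri_E hz hz Sy.triBdd_Ts (by omega)).op Sy.bdd_R₃).add
    ((u.bound_g₀.op Sy.bdd_R₃).op_loses Sy.loses_A)

lemma bound_h₀' (u : Sy.Sol S) : F.UB S 1 (F.E 0) u.h₀' := by
  have hz2 := u.bound_z.mono_s (s' := 2) (by omega)
  have hz := u.bound_z.mono_s (s' := 1) (by omega)
  have hz' := u.bound_z'.mono_s (s' := 1) (by omega)
  have hz₁ := u.bound_z₁.mono_s (s' := 1) (by omega)
  exact ((((u.bound_z₁'.tri_E hz hz Sy.triBdd_Ts (by omega)).add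
    (hz₁.tri_E hz' hz Sy.triBdd_Ts (by omega))).add
    (hz₁.tri_E hz hz' Sy.triBdd_Ts (by omega))).op Sy.bdd_R₃).add
    (((u.bound_z'.tri_E hz2 hz2 Sy.triBdd_Ts (by omega)).op Sy.bdd_R₃).op_loses Sy.loses_A)

/-- Three numbers ±1 with sum 3 are all equal to 1, so every other triad contains a harmonic ±3. -/
lemma triads_three (J : ℤ × ℤ × ℤ) (hJ : J ∈ (triads 3).erase (1, 1, 1)) :
    (J.1 = 3 ∨ J.1 = -3) ∨ (J.2.1 = 3 ∨ J.2.1 = -3) ∨ (J.2.2 = 3 ∨ J.2.2 = -3) := by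
  revert J; decide

lemma bound_of_mem_three (u : Sy.Sol S) {s : ℕ} {γ : ι → ℝ → ℝ}
    (h3 : F.UB S s γ fun i => u.U i 3) {j : ℤ} (hj : j = 3 ∨ j = -3) :
    F.UB S s γ fun i => u.U i j := by
  rcases hj with rfl | rfl
  · exact h3
  · exact (h3.op Sy.bdd_conj).congr fun i t => u.conj₃ i t

/-- Apart from the self-interaction of the first harmonic, every source of the third one contains a
factor `U_{±3}`. These terms are linear in the quantity to be estimated and can be absorbed. -/
lemma bound_envSum_three (u : Sy.Sol S) {s : ℕ} {γ : ι → ℝ → ℝ} (hγ : ∀ i t, 0 ≤ γ i t)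
    (h3 : F.UB S s γ fun i => u.U i 3) (hs : s ≤ 3) :
    F.UB S s γ fun i t => envSum Sy.T 3 (fun l => u.U i l t) -
      Sy.T (u.U i 1 t) (u.U i 1 t) (u.U i 1 t) := by
  have hmem : ((1, 1, 1) : ℤ × ℤ × ℤ) ∈ triads 3 := by decide
  have key : F.UB S s γ fun i t => ∑ J ∈ (triads 3).erase (1, 1, 1),
      Sy.T (u.U i J.1 t) (u.U i J.2.1 t) (u.U i J.2.2 t) := by
    refine UB.sum _ hγ fun J hJ => ?_
    obtain ⟨j1, j2, j3⟩ := mem_of_mem_triads (Finset.mem_of_mem_erase hJ)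
    have hU := fun {j} (hj : j ∈ harmonics 3) => (u.bound_U hj).mono_s hs
    rcases triads_three J hJ with h | h | h
    · exact (u.bound_of_mem_three h3 h).tri (hU j2) (hU j3) Sy.triBdd_T fun i t => by simp [E]
    · exact (hU j1).tri (u.bound_of_mem_three h3 h) (hU j3) Sy.triBdd_T fun i t => by simp [E]
    · exact (hU j1).tri (hU j2) (u.bound_of_mem_three h3 h) Sy.triBdd_T fun i t => by simp [E]
  refine key.congr fun i t => ?_
  rw [envSum, ← Finset.add_sum_erase _ _ hmem]
  simp

end WaveSystem.Sol

end AbstractWave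

/-! ### ### Second order for the third harmonic, third order for the fifth -/

section AbstractWave

variable {ι X : Type*} [NormedAddCommGroup X] [NormedSpace ℝ X]

namespace WaveSystem.Sol

open NLDispersive.Frame

variable {F : Frame ι X} {Sy : WaveSystem F} {S : ℝ}

/-- The self-interaction of the first harmonic, up to terms which are linear in `y`. -/
def quad (u : Sy.Sol S) (i : ι) (t : ℝ) : X :=
  Sy.T (u.U i 1 t) (u.U i 1 t) (u.U i 1 t) - u.g₀ i t - Sy.Ts (u.y i t) (u.z i t) (u.z i t)

/-- Expanding `T(z+y, z+y, z+y)` and removing the terms of degree zero and one in `y` leaves at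
least two factors `y = O(ε)` in each summand. -/
lemma bound_quad (u : Sy.Sol S) (hy : F.UB S 2 (F.E 1) u.y) : F.UB S 2 (F.E 2) u.quad := by
  have hz := u.bound_z.mono_s (s' := 2) (by omega)
  have hU := u.bound₁.mono_s (s' := 2) (by omega)
  refine (((hy.tri_E hy hU Sy.triBdd_T (m := 2) (by omega)).add
    (hy.tri_E hz hy Sy.triBdd_T (by omega))).add
    (hz.tri_E hy hy Sy.triBdd_T (by omega))).congr fun i t => ?_
  have e : u.U i 1 t = u.z i t + u.y i t := by simp [y]
  rw [quad, g₀, Sy.Ts_apply, e]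
  simp only [map_add, _root_.add_apply]
  abel

lemma bound_fy (u : Sy.Sol S) : F.UB S 2 (F.E 0) fun i t => u.nl 1 i t - u.fz i t :=
  u.bound_nl₁.sub u.bound_fz

/-- The corrector of the third harmonic. -/
def corr₃ (u : Sy.Sol S) (i : ι) (t : ℝ) : X :=
  F.ε i ^ 2 • Sy.R₃ (u.g₀ i t) - F.ε i ^ 3 • Sy.R₃ (u.h₀ i t) +
    F.ε i ^ 2 • Sy.Θ (u.y i t) (u.z i t) (u.z i t)

/-- The residual of the corrector of the third harmonic. -/
def res₃ (u : Sy.Sol S) (i : ι) (t : ℝ) : X :=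
  F.ε i ^ 1 • (u.quad i t + u.e i 3 t) +
  F.ε i ^ 3 • (Sy.R₃ (u.h₀' i t) + Sy.A i (Sy.R₃ (u.h₀ i t)) -
    Sy.R₃ (Sy.Ts (u.fz i t) (u.z i t) (u.z i t))) -
  F.ε i ^ 2 • (Sy.Θ (F.ε i ^ 1 • (u.nl 1 i t - u.fz i t) - Sy.A i (u.y i t)) (u.z i t) (u.z i t) +
    Sy.Θ (u.y i t) (u.z' i t) (u.z i t) + Sy.Θ (u.y i t) (u.z i t) (u.z' i t) +
    Sy.A i (Sy.Θ (u.y i t) (u.z i t) (u.z i t)))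

/-- The terms of order ε² all contain `y` or the extra factor ε, which supplies the third power. A
acts on `y` and on `h₀`, both controlled in the 2-norm, whence the 1-norm here. -/
lemma bound_res₃ (u : Sy.Sol S) (hy : F.UB S 2 (F.E 1) u.y) : F.UB S 1 (F.E 3) u.res₃ := by
  have hz2 := u.bound_z.mono_s (s' := 2) (by omega)
  have hz := u.bound_z.mono_s (s' := 1) (by omega)
  have hz' := u.bound_z'.mono_s (s' := 1) (by omega)
  have hy1 := hy.mono_s (s' := 1) (by omega)
  have hfz := u.bound_fz.mono_s (s' := 1) (by omega)
  have hfy := u.bound_fy.mono_s (s' := 1) (by omega)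
  have h1 : F.UB S 1 (F.E 3) fun i t => F.ε i ^ 1 • (u.quad i t + u.e i 3 t) :=
    (((u.bound_quad hy).add (u.defect₃.mono_E (by omega))).mono_s (by omega)).smul_pow 1 (by omega)
  have h2 : F.UB S 1 (F.E 0) fun i t => Sy.R₃ (u.h₀' i t) + Sy.A i (Sy.R₃ (u.h₀ i t)) -
      Sy.R₃ (Sy.Ts (u.fz i t) (u.z i t) (u.z i t)) :=
    ((u.bound_h₀'.op Sy.bdd_R₃).add ((u.bound_h₀.op Sy.bdd_R₃).op_loses Sy.loses_A)).sub
      ((hfz.tri_E hz hz Sy.triBdd_Ts (by omega)).op Sy.bdd_R₃)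
  have h3 : F.UB S 1 (F.E 1) fun i t => F.ε i ^ 1 • (u.nl 1 i t - u.fz i t) - Sy.A i (u.y i t) :=
    (hfy.smul_pow 1 (by omega)).sub (hy.op_loses Sy.loses_A)
  exact (h1.add (h2.smul_pow 3 (by omega))).sub
    (((((h3.tri_E hz hz Sy.triBdd_Θ (m := 1) (by omega)).add
      (hy1.tri_E hz' hz Sy.triBdd_Θ (by omega))).add
      (hy1.tri_E hz hz' Sy.triBdd_Θ (by omega))).add
      ((hy.tri_E hz2 hz2 Sy.triBdd_Θ (by omega)).op_loses Sy.loses_A)).smul_pow 2 (by omega))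

/-- The three correctors act in turn. ε² R₃ g₀ cancels the slow source ε g₀ and leaves -ε² h₀ plus a
term of order ε³. Then -ε³ R₃ h₀ cancels ε² h₀. Finally ε² Θ(y, z, z) cancels the oscillating source
ε Ts(y, z, z) by the Sylvester equation. -/
lemma hasDerivAt_sub_corr₃ (u : Sy.Sol S) (i : ι) (t : ℝ) :
    HasDerivAt (fun t => u.U i 3 t - u.corr₃ i t)
      (-((F.ε i)⁻¹ • Sy.L₃ (u.U i 3 t - u.corr₃ i t) + Sy.A i (u.U i 3 t - u.corr₃ i t)) +
        (u.res₃ i t + F.ε i • (envSum Sy.T 3 (fun l => u.U i l t) -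
          Sy.T (u.U i 1 t) (u.U i 1 t) (u.U i 1 t)))) t := by
  have h1 := (u.deriv₃ i t).sub
    ((((Sy.R₃.hasFDerivAt.comp_hasDerivAt t (u.hasDerivAt_g₀ i t)).const_smul (F.ε i ^ 2)).sub
    ((Sy.R₃.hasFDerivAt.comp_hasDerivAt t (u.hasDerivAt_h₀ i t)).const_smul (F.ε i ^ 3))).add
    ((HasDerivAt.trilinear Sy.Θ (u.hasDerivAt_y i t) (u.hasDerivAt_z i t)
      (u.hasDerivAt_z i t)).const_smul (F.ε i ^ 2)))
  refine h1.congr_deriv ?_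
  have hε := (F.pos i).ne'
  have hz' : Sy.Ts (u.z' i t) (u.z i t) (u.z i t) = Sy.Ts (u.z₁ i t) (u.z i t) (u.z i t) +
      F.ε i • Sy.Ts (u.fz i t) (u.z i t) (u.z i t) := by
    simp only [z', map_add, map_smul, _root_.add_apply, _root_.smul_apply]
  have hL := Sy.sylvester (u.y i t) (u.z i t) (u.z i t)
  have hh : u.h₀ i t = Sy.R₃ (Sy.Ts (u.z₁ i t) (u.z i t) (u.z i t)) + Sy.A i (Sy.R₃ (u.g₀ i t)) :=
    rfl
  have hq : u.quad i t = Sy.T (u.U i 1 t) (u.U i 1 t) (u.U i 1 t) - u.g₀ i t -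
    Sy.Ts (u.y i t) (u.z i t) (u.z i t) := rfl
  have hLh := Sy.L₃_R₃ (u.h₀ i t)
  rw [hz']
  simp only [corr₃, res₃, hq, map_add, map_sub, map_neg, map_smul, _root_.add_apply,
    _root_.sub_apply, _root_.neg_apply, _root_.smul_apply, hL, Sy.L₃_R₃]
  generalize Sy.A i (Sy.R₃ (u.h₀ i t)) = ARh
  rw [hh]
  match_scalars <;> field_simp <;> ring

/-- The third harmonic is `O(ε²)`. -/
theorem third_order_two (u : Sy.Sol S) (hS : 0 < S) (hy : F.UB S 2 (F.E 1) u.y) :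
    ∃ S', 0 < S' ∧ S' ≤ S ∧ F.UB S' 1 (F.E 2) fun i => u.U i 3 := by
  have hz := u.bound_z.mono_s (s' := 1) (by omega)
  have hγ : ∀ i t, 0 ≤ F.N i 1 (u.U i 3 t) := fun i t => F.N_nonneg _ _ _
  -- The gauge is now the 1-norm of the third harmonic alone, since the sources involving `y` have
  -- been removed by the correctors.
  have h3 : F.UB S 1 (fun i t => F.N i 1 (u.U i 3 t)) fun i => u.U i 3 :=
    ⟨1, zero_le_one, fun i t _ _ => by rw [one_mul]⟩
  have hc : F.UB S 1 (F.E 2) u.corr₃ :=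
    ((((u.bound_g₀.op Sy.bdd_R₃).mono_s (by omega)).smul_pow 2 (by omega)).sub
      (((u.bound_h₀.op Sy.bdd_R₃).mono_s (by omega)).smul_pow 3 (by omega))).add
      (((hy.mono_s (by omega)).tri_E hz hz Sy.triBdd_Θ (m := 1) (by omega)).smul_pow 2 (by omega))
  have hlin : F.Lin S 1 2 (fun i t => F.N i 1 (u.U i 3 t)) fun i => u.U i 3 :=
    Lin.add_uB (Sy.diss₃.bound u.hasDerivAt_sub_corr₃ (init_sub (init_zero u.init₃) (hc.init hS.le))
      (u.bound_res₃ hy) (u.bound_envSum_three hγ h3 (by omega))) hc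
  obtain ⟨S', hS', hle, D, hD, h⟩ := absorb F hS (m := 2)
    (φ := fun i t => F.N i 1 (u.U i 3 t)) (fun i => ((F.continuous_N i 1).comp
      (continuous_iff_continuousAt.2 fun t => (u.deriv₃ i t).continuousAt)).continuousOn) hγ hlin
  exact ⟨S', hS', hle, D, hD, h⟩

/-- The leading part of the third harmonic, divided by `ε²`. -/
def γ (u : Sy.Sol S) (i : ι) (t : ℝ) : X := Sy.R₃ (u.g₀ i t)

/-- The time derivative of `γ`. -/
def γ' (u : Sy.Sol S) (i : ι) (t : ℝ) : X := Sy.R₃ (Sy.Ts (u.z' i t) (u.z i t) (u.z i t))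

lemma hasDerivAt_γ (u : Sy.Sol S) (i : ι) (t : ℝ) : HasDerivAt (u.γ i) (u.γ' i t) t :=
  Sy.R₃.hasFDerivAt.comp_hasDerivAt t (u.hasDerivAt_g₀ i t)

lemma bound_γ (u : Sy.Sol S) : F.UB S 3 (F.E 0) u.γ := u.bound_g₀.op Sy.bdd_R₃

lemma bound_γ' (u : Sy.Sol S) : F.UB S 2 (F.E 0) u.γ' := by
  have hz := u.bound_z.mono_s (s' := 2) (by omega)
  exact (u.bound_z'.tri_E hz hz Sy.triBdd_Ts (by omega)).op Sy.bdd_R₃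

/-- The oscillating part of the third harmonic. -/
def r (u : Sy.Sol S) (i : ι) (t : ℝ) : X := u.U i 3 t - F.ε i ^ 2 • u.γ i t

/-- The forcing of the oscillating part of the third harmonic. -/
def fr (u : Sy.Sol S) (i : ι) (t : ℝ) : X :=
  F.ε i ^ 1 • (envSum Sy.T 3 (fun l => u.U i l t) - u.g₀ i t + u.e i 3 t) - Sy.A i (u.U i 3 t) -
    F.ε i ^ 2 • u.γ' i t

/-- The slow source ε g₀ is balanced by ε⁻¹ L₃ (ε² γ). The term A `U_3` is deliberately moved into
the forcing, so that `r` oscillates with the constant operator ε⁻¹ L₃, the form required by the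
second Sylvester equation. -/
lemma hasDerivAt_r (u : Sy.Sol S) (i : ι) (t : ℝ) :
    HasDerivAt (u.r i) (-((F.ε i)⁻¹ • Sy.L₃ (u.r i t)) + u.fr i t) t := by
  have h := (u.deriv₃ i t).sub ((u.hasDerivAt_γ i t).const_smul (F.ε i ^ 2))
  refine HasDerivAt.congr_deriv (f := u.r i) h ?_
  have hε := (F.pos i).ne'
  have hL := Sy.L₃_R₃ (u.g₀ i t)
  simp only [r, fr, γ, map_sub, map_smul, hL]
  match_scalars <;> field_simp
  ring

lemma bound_r (u : Sy.Sol S) (h3 : F.UB S 1 (F.E 2) fun i => u.U i 3) :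
    F.UB S 1 (F.E 2) u.r :=
  h3.sub ((u.bound_γ.mono_s (by omega)).smul_pow 2 (by omega))

/-- A `U_3` is `O(ε²)` in the 0-norm by the 1-norm bound of `U_3`. The nonlinear terms carry a
factor ε and deviate from g₀ only by terms linear in `y`, quadratic in `y`, or containing `U_{±3}`,
which supply the other power. -/
lemma bound_fr (u : Sy.Sol S) (hy : F.UB S 2 (F.E 1) u.y)
    (h3 : F.UB S 1 (F.E 2) fun i => u.U i 3) : F.UB S 0 (F.E 2) u.fr := by
  have hz := u.bound_z.mono_s (s' := 0) (by omega)
  have e1 := (u.bound_envSum_three (E_nonneg 2) h3 (by omega)).mono_s (s' := 0) (by omega)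
  have e2 := (u.bound_quad hy).mono_s (s' := 0) (by omega)
  have e3 := ((hy.mono_s (s' := 0) (by omega)).tri_E hz hz Sy.triBdd_Ts (m := 1) (by omega))
  have e4 : F.UB S 0 (F.E 1) fun i t => envSum Sy.T 3 (fun l => u.U i l t) - u.g₀ i t + u.e i 3 t :=
    ((((e1.add e2).mono_E (by omega)).add e3).add
      ((u.defect₃.mono_s (by omega)).mono_E (by omega))).congr fun i t => by
        simp only [quad]; abel
  exact ((e4.smul_pow 1 (by omega)).sub (h3.op_loses Sy.loses_A)).sub
    ((u.bound_γ'.mono_s (by omega)).smul_pow 2 (by omega))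

/-- Three odd harmonics of modulus at most 3 with sum 5 are either a permutation of (3, 1, 1) or
contain at least two entries ±3. -/
lemma triads_five (J : ℤ × ℤ × ℤ)
    (hJ : J ∈ (((triads 5).erase (3, 1, 1)).erase (1, 3, 1)).erase (1, 1, 3)) :
    ((J.1 = 3 ∨ J.1 = -3) ∧ (J.2.1 = 3 ∨ J.2.1 = -3)) ∨
    ((J.1 = 3 ∨ J.1 = -3) ∧ (J.2.2 = 3 ∨ J.2.2 = -3)) ∨
    ((J.2.1 = 3 ∨ J.2.1 = -3) ∧ (J.2.2 = 3 ∨ J.2.2 = -3)) := by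
  revert J; decide

lemma bound_tri_of_two_three (u : Sy.Sol S) {s : ℕ} (hs : s ≤ 3)
    (h3 : F.UB S s (F.E 2) fun i => u.U i 3) {J : ℤ × ℤ × ℤ} (j1 : J.1 ∈ harmonics 3)
    (j2 : J.2.1 ∈ harmonics 3) (j3 : J.2.2 ∈ harmonics 3)
    (h : ((J.1 = 3 ∨ J.1 = -3) ∧ (J.2.1 = 3 ∨ J.2.1 = -3)) ∨
      ((J.1 = 3 ∨ J.1 = -3) ∧ (J.2.2 = 3 ∨ J.2.2 = -3)) ∨
      ((J.2.1 = 3 ∨ J.2.1 = -3) ∧ (J.2.2 = 3 ∨ J.2.2 = -3))) :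
    F.UB S s (F.E 4) fun i t => Sy.T (u.U i J.1 t) (u.U i J.2.1 t) (u.U i J.2.2 t) := by
  have hU := fun {j} (hj : j ∈ harmonics 3) => (u.bound_U hj).mono_s hs
  have hb := fun {j} (hj : j = 3 ∨ j = -3) => u.bound_of_mem_three h3 hj
  rcases h with h | h | h
  · exact (hb h.1).tri_E (hb h.2) (hU j3) Sy.triBdd_T (by omega)
  · exact (hb h.1).tri_E (hU j2) (hb h.2) Sy.triBdd_T (by omega)
  · exact (hU j1).tri_E (hb h.1) (hb h.2) Sy.triBdd_T (by omega)

/-- Triads with two entries ±3 give ε⁴. In the others, replacing `U_1 = z + y` by `z` costs a factor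
`y = O(ε)` next to `U_3 = O(ε²)`. -/
lemma bound_envSum_five (u : Sy.Sol S) (hy : F.UB S 2 (F.E 1) u.y)
    (h3 : F.UB S 1 (F.E 2) fun i => u.U i 3) :
    F.UB S 0 (F.E 3) fun i t => envSum Sy.T 5 (fun l => u.U i l t) -
      Sy.Ts (u.U i 3 t) (u.z i t) (u.z i t) := by
  have h3' := h3.mono_s (s' := 0) (by omega)
  have hy' := hy.mono_s (s' := 0) (by omega)
  have hz := u.bound_z.mono_s (s' := 0) (by omega)
  have hU := u.bound₁.mono_s (s' := 0) (by omega)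
  have key : F.UB S 0 (F.E 4) fun i t =>
      ∑ J ∈ (((triads 5).erase (3, 1, 1)).erase (1, 3, 1)).erase (1, 1, 3),
      Sy.T (u.U i J.1 t) (u.U i J.2.1 t) (u.U i J.2.2 t) := by
    refine UB.sum _ (E_nonneg 4) fun J hJ => ?_
    obtain ⟨j1, j2, j3⟩ := mem_of_mem_triads (Finset.mem_of_mem_erase (Finset.mem_of_mem_erase
      (Finset.mem_of_mem_erase hJ)))
    exact u.bound_tri_of_two_three (by omega) h3' j1 j2 j3 (triads_five J hJ)
  refine (((key.mono_E (by omega)).add (h3'.tri_E hy' hU Sy.triBdd_Ts (m := 3) (by omega))).add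
    (h3'.tri_E hz hy' Sy.triBdd_Ts (by omega))).congr fun i t => ?_
  have m1 : ((3, 1, 1) : ℤ × ℤ × ℤ) ∈ triads 5 := by decide
  have m2 : ((1, 3, 1) : ℤ × ℤ × ℤ) ∈ (triads 5).erase (3, 1, 1) := by decide
  have m3 : ((1, 1, 3) : ℤ × ℤ × ℤ) ∈ ((triads 5).erase (3, 1, 1)).erase (1, 3, 1) := by decide
  rw [envSum, ← Finset.add_sum_erase _ _ m1, ← Finset.add_sum_erase _ _ m2,
    ← Finset.add_sum_erase _ _ m3]
  have e : u.U i 1 t = u.z i t + u.y i t := by simp [y]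
  simp only [Sy.Ts_apply, e, map_add, _root_.add_apply]
  abel

/-- The corrector of the fifth harmonic. -/
def corr₅ (u : Sy.Sol S) (i : ι) (t : ℝ) : X :=
  F.ε i ^ 4 • Sy.R₅ (Sy.Ts (u.γ i t) (u.z i t) (u.z i t)) +
    F.ε i ^ 2 • Sy.Θ' (u.r i t) (u.z i t) (u.z i t)

/-- The residual of the corrector of the fifth harmonic. -/
def res₅ (u : Sy.Sol S) (i : ι) (t : ℝ) : X :=
  F.ε i ^ 1 • (envSum Sy.T 5 (fun l => u.U i l t) - Sy.Ts (u.U i 3 t) (u.z i t) (u.z i t)) -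
  F.ε i ^ 4 • (Sy.R₅ (Sy.Ts (u.γ' i t) (u.z i t) (u.z i t) + Sy.Ts (u.γ i t) (u.z' i t) (u.z i t) +
    Sy.Ts (u.γ i t) (u.z i t) (u.z' i t)) + Sy.A i (Sy.R₅ (Sy.Ts (u.γ i t) (u.z i t) (u.z i t)))) -
  F.ε i ^ 2 • (Sy.Θ' (u.fr i t) (u.z i t) (u.z i t) + Sy.Θ' (u.r i t) (u.z' i t) (u.z i t) +
    Sy.Θ' (u.r i t) (u.z i t) (u.z' i t) + Sy.A i (Sy.Θ' (u.r i t) (u.z i t) (u.z i t)))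

/-- Each occurrence of `r` or its forcing `fr` contributes ε² in addition to the explicit ε², and
the deviation of the source from Ts(U₃, z, z) is ε · O(ε³). The derivative lost by A is taken from
the 1-norm bounds. -/
lemma bound_res₅ (u : Sy.Sol S) (hy : F.UB S 2 (F.E 1) u.y)
    (h3 : F.UB S 1 (F.E 2) fun i => u.U i 3) : F.UB S 0 (F.E 4) u.res₅ := by
  have hz1 := u.bound_z.mono_s (s' := 1) (by omega)
  have hγ1 := u.bound_γ.mono_s (s' := 1) (by omega)
  have hz := u.bound_z.mono_s (s' := 0) (by omega)
  have hz' := u.bound_z'.mono_s (s' := 0) (by omega)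
  have hγ := u.bound_γ.mono_s (s' := 0) (by omega)
  have hγ' := u.bound_γ'.mono_s (s' := 0) (by omega)
  have hr1 := u.bound_r h3
  have hr := hr1.mono_s (s' := 0) (by omega)
  exact (((u.bound_envSum_five hy h3).smul_pow 1 (by omega)).sub
    ((((((hγ'.tri_E hz hz Sy.triBdd_Ts (m := 0) (by omega)).add
      (hγ.tri_E hz' hz Sy.triBdd_Ts (by omega))).add
      (hγ.tri_E hz hz' Sy.triBdd_Ts (by omega))).op Sy.bdd_R₅).add
      (((hγ1.tri_E hz1 hz1 Sy.triBdd_Ts (by omega)).op Sy.bdd_R₅).op_loses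
        Sy.loses_A)).smul_pow 4 (by omega))).sub
    ((((((u.bound_fr hy h3).tri_E hz hz Sy.triBdd_Θ' (m := 2) (by omega)).add
      (hr.tri_E hz' hz Sy.triBdd_Θ' (by omega))).add
      (hr.tri_E hz hz' Sy.triBdd_Θ' (by omega))).add
      ((hr1.tri_E hz1 hz1 Sy.triBdd_Θ' (by omega)).op_loses Sy.loses_A)).smul_pow 2 (by omega))

/-- The response of the fifth harmonic is `O(ε³)`. -/
theorem fifth_order_three (u : Sy.Sol S) (hS : 0 < S) (hy : F.UB S 2 (F.E 1) u.y)
    (h3 : F.UB S 1 (F.E 2) fun i => u.U i 3) {D : ι → ℝ → X}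
    (hD : ∀ i t, HasDerivAt (D i) (-((F.ε i)⁻¹ • Sy.L₅ (D i t) + Sy.A i (D i t)) +
      F.ε i • envSum Sy.T 5 (fun l => u.U i l t)) t) (hD0 : ∀ i, D i 0 = 0) :
    F.UB S 0 (F.E 3) D := by
  have hz := u.bound_z.mono_s (s' := 0) (by omega)
  have hr := (u.bound_r h3).mono_s (s' := 0) (by omega)
  have hγ := u.bound_γ.mono_s (s' := 0) (by omega)
  have hc : F.UB S 0 (F.E 3) u.corr₅ :=
    (((hγ.tri_E hz hz Sy.triBdd_Ts (m := 0) (by omega)).op Sy.bdd_R₅).smul_pow 4 (by omega)).add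
    ((hr.tri_E hz hz Sy.triBdd_Θ' (m := 2) (by omega)).smul_pow 2 (by omega))
  have key : F.UB S 0 (F.E 3) fun i t => D i t - u.corr₅ i t := by
    refine Sy.diss₅.uB (f := u.res₅) (fun i t => ?_) (init_sub (init_zero hD0) (hc.init hS.le))
      (u.bound_res₅ hy h3)
    have h1 := (hD i t).sub
      (((Sy.R₅.hasFDerivAt.comp_hasDerivAt t (HasDerivAt.trilinear Sy.Ts (u.hasDerivAt_γ i t)
        (u.hasDerivAt_z i t) (u.hasDerivAt_z i t))).const_smul (F.ε i ^ 4)).add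
      ((HasDerivAt.trilinear Sy.Θ' (u.hasDerivAt_r i t) (u.hasDerivAt_z i t)
        (u.hasDerivAt_z i t)).const_smul (F.ε i ^ 2)))
    refine h1.congr_deriv ?_
    have hε := (F.pos i).ne'
    have hL := Sy.sylvester' (u.r i t) (u.z i t) (u.z i t)
    -- The split `U_3 = ε² γ + r` sorts the source: the slow part is removed by inverting L₅, the
    -- part oscillating with L₃ by Θ'. The residual no longer involves the unknown, so no shortening
    -- of the time interval is needed.
    have hT : Sy.Ts (u.U i 3 t) (u.z i t) (u.z i t) = F.ε i ^ 2 • Sy.Ts (u.γ i t) (u.z i t) (u.z i t)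
        + Sy.Ts (u.r i t) (u.z i t) (u.z i t) := by
      simp only [r, map_sub, map_smul, _root_.sub_apply, _root_.smul_apply]
      abel
    simp only [corr₅, res₅, hT, map_add, map_sub, map_neg, map_smul, _root_.add_apply,
      _root_.neg_apply, _root_.smul_apply, hL, Sy.L₅_R₅]
    match_scalars <;> field_simp <;> ring
  exact (key.add hc).congr fun i t => by abel

end WaveSystem.Sol

end AbstractWave

/-! ### ### Groups with bounded generators and energy estimates -/

section AbstractGroup

variable {ι X : Type*} [NormedAddCommGroup X] [NormedSpace ℝ X]

/-- `G` is the group generated by `-B`. -/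
structure IsGroup (B : X →L[ℝ] X) (G : ℝ → X →L[ℝ] X) : Prop where
  zero : G 0 = 1
  add : ∀ t s, G (t + s) = G t * G s
  comm : ∀ t v, B (G t v) = G t (B v)
  deriv : ∀ t, HasDerivAt G (-(B * G t)) t

namespace IsGroup

variable {B : X →L[ℝ] X} {G : ℝ → X →L[ℝ] X}

lemma neg_apply (h : IsGroup B G) (t : ℝ) (v : X) : G t (G (-t) v) = v := by
  have := h.add t (-t)
  rw [add_neg_cancel, h.zero] at this
  exact (congrArg (fun A : X →L[ℝ] X => A v) this).symm

lemma continuous (h : IsGroup B G) : Continuous G :=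
  continuous_iff_continuousAt.2 fun t => (h.deriv t).continuousAt

/-- The variation of constants formula. -/
def duhamel (G : ℝ → X →L[ℝ] X) (w₀ : X) (f : ℝ → X) (t : ℝ) : X :=
  G t (w₀ + ∫ s in (0 : ℝ)..t, G (-s) (f s))

lemma duhamel_eq [CompleteSpace X] (h : IsGroup B G) (w₀ : X) {f : ℝ → X} (hf : Continuous f)
    (t : ℝ) : duhamel G w₀ f t = G t w₀ + ∫ s in (0 : ℝ)..t, G (t - s) (f s) := by
  have hc : Continuous fun s => G (-s) (f s) := (h.continuous.comp continuous_neg).clm_apply hf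
  rw [duhamel, map_add, ← ContinuousLinearMap.intervalIntegral_comp_comm _
    (hc.intervalIntegrable _ _)]
  simp only [sub_eq_add_neg, h.add]
  rfl

lemma duhamel_zero (h : IsGroup B G) (w₀ : X) (f : ℝ → X) : duhamel G w₀ f 0 = w₀ := by
  simp [duhamel, h.zero]

lemma hasDerivAt_duhamel [CompleteSpace X] (h : IsGroup B G) (w₀ : X) {f : ℝ → X}
    (hf : Continuous f) (t : ℝ) :
    HasDerivAt (duhamel G w₀ f) (-B (duhamel G w₀ f t) + f t) t := by
  have hc : Continuous fun s => G (-s) (f s) := (h.continuous.comp continuous_neg).clm_apply hf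
  have h1 := (hc.integral_hasStrictDerivAt 0 t).hasDerivAt.const_add w₀
  have h2 := (h.deriv t).clm_apply h1
  refine HasDerivAt.congr_deriv (f := duhamel G w₀ f) h2 ?_
  rw [h.neg_apply]
  rfl

end IsGroup

namespace Frame

variable {F : Frame ι X}

/-- Transporting the solution to the final time, r ↦ G(t - r) w(r) has derivative G(t - r) f(r),
since the generator terms cancel. The mean value inequality and the contraction property conclude.
-/
lemma dissipative_of_isGroup {B : ι → X →L[ℝ] X} {G : ι → ℝ → X →L[ℝ] X}
    (h : ∀ i, IsGroup (B i) (G i)) (hG : ∀ i s t v, F.N i s (G i t v) ≤ F.N i s v) :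
    F.Dissipative fun i v => B i v := by
  intro i s w f m t hw ht hm
  have hd : ∀ r, HasDerivAt (fun r => (F.W i ^ s) (G i (t - r) (w r)))
      ((F.W i ^ s) (G i (t - r) (f r))) r := by
    intro r
    have h1 : HasDerivAt (fun r => G i (t - r)) (B i * G i (t - r)) r := by
      have := ((h i).deriv (t - r)).comp_const_sub t r
      rwa [neg_neg] at this
    have h2 := (F.W i ^ s).hasFDerivAt.comp_hasDerivAt r (h1.clm_apply (hw r))
    refine h2.congr_deriv ?_
    congr 1
    rw [map_add, map_neg, ← (h i).comm]
    change B i (G i (t - r) (w r)) + _ = _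
    abel
  have hb : ∀ r ∈ Ico 0 t, ‖(F.W i ^ s) (G i (t - r) (f r))‖ ≤ m := fun r hr =>
    (hG i s _ _).trans (hm r ⟨hr.1, hr.2.le⟩)
  have h3 := norm_image_sub_le_of_norm_deriv_le_segment' (fun r _ => (hd r).hasDerivWithinAt) hb t
    (right_mem_Icc.2 ht)
  simp only [sub_self, sub_zero, (h i).zero] at h3
  have h4 := hG i s t (w 0)
  have h5 := norm_le_norm_add_norm_sub ((F.W i ^ s) (G i t (w 0))) ((F.W i ^ s) (w t))
  rw [norm_sub_rev] at h5
  have h6 : ‖(F.W i ^ s) (w t) - (F.W i ^ s) (G i t (w 0))‖ ≤ m * t := h3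
  change ‖(F.W i ^ s) (w t)‖ ≤ _
  change ‖(F.W i ^ s) (G i t (w 0))‖ ≤ _ at h4
  linarith

end Frame

end AbstractGroup

/-! ### Restriction of scalars for trilinear maps -/

section RestrictScalars

variable {X : Type*} [NormedAddCommGroup X] [NormedSpace ℂ X] [NormedSpace ℝ X]
  [IsScalarTower ℝ ℂ X]

/-- A complex trilinear map as a real trilinear map. -/
def triR (T : X →L[ℂ] X →L[ℂ] X →L[ℂ] X) : X →L[ℝ] X →L[ℝ] X →L[ℝ] X :=
  (ContinuousLinearMap.compL ℝ X (X →L[ℂ] X →L[ℂ] X) (X →L[ℝ] X →L[ℝ] X)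
    ((ContinuousLinearMap.compL ℝ X (X →L[ℂ] X) (X →L[ℝ] X)
      (ContinuousLinearMap.restrictScalarsL ℂ X X ℝ ℝ)).comp
      (ContinuousLinearMap.restrictScalarsL ℂ X (X →L[ℂ] X) ℝ ℝ))) (T.restrictScalars ℝ)

lemma triR_apply (T : X →L[ℂ] X →L[ℂ] X →L[ℂ] X) (a b c : X) : triR T a b c = T a b c := rfl

end RestrictScalars

/-! ### Weights -/

/-- The truncated weight `min (1 + |k|) (1 + R)`. -/
def wt (R : ℝ) (k : Sp d) : ℝ := min (1 + ‖k‖) (1 + R)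

lemma one_le_wt {R : ℝ} (hR : 0 ≤ R) (k : Sp d) : 1 ≤ wt R k :=
  le_min (by linarith [norm_nonneg k]) (by linarith)

lemma wt_nonneg {R : ℝ} (hR : 0 ≤ R) (k : Sp d) : 0 ≤ wt R k :=
  zero_le_one.trans (one_le_wt hR k)

lemma wt_le (R : ℝ) (k : Sp d) : wt R k ≤ 1 + R := min_le_right _ _

lemma measurable_wt (R : ℝ) : Measurable (wt (d := d) R) := by
  unfold wt; fun_prop

/-- If one weight is saturated, the product is at least 1 + R because the other is at least 1.
Otherwise (1+|k|)(1+|k'|) dominates 1+|k+k'|. -/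
lemma wt_add_le {R : ℝ} (hR : 0 ≤ R) (k k' : Sp d) : wt R (k + k') ≤ wt R k * wt R k' := by
  have h1 := one_le_wt hR k
  have h2 := one_le_wt hR k'
  have hn := norm_add_le k k'
  have h3 : wt R (k + k') ≤ 1 + R := wt_le _ _
  have h4 : wt R (k + k') ≤ 1 + ‖k + k'‖ := min_le_left _ _
  have hk := norm_nonneg k
  have hk' := norm_nonneg k'
  rcases min_choice (1 + ‖k‖) (1 + R) with h | h
  · rcases min_choice (1 + ‖k'‖) (1 + R) with h' | h'
    · have e1 : wt R k = 1 + ‖k‖ := h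
      have e2 : wt R k' = 1 + ‖k'‖ := h'
      rw [e1, e2]
      nlinarith
    · have e2 : wt R k' = 1 + R := h'
      rw [e2] at h2 ⊢
      nlinarith
  · have e1 : wt R k = 1 + R := h
    rw [e1] at h1 ⊢
    nlinarith

lemma isMultiplier_ofReal {m : Sp d → ℝ} (hm : Measurable m) {c : ℝ} (hc : ∀ k, |m k| ≤ c) :
    IsMultiplier (fun k => (m k : ℂ) • (1 : End n)) := by
  refine ⟨(Complex.measurable_ofReal.comp hm).stronglyMeasurable.smul_const 1, c, fun k => ?_⟩
  rw [norm_smul, Complex.norm_real, Real.norm_eq_abs]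
  calc |m k| * ‖(1 : End n)‖ ≤ |m k| * 1 :=
        mul_le_mul_of_nonneg_left ContinuousLinearMap.norm_id_le (abs_nonneg _)
    _ ≤ c := by rw [mul_one]; exact hc k

lemma isMultiplier_wt_pow {R : ℝ} (hR : 0 ≤ R) (s : ℕ) :
    IsMultiplier (fun k : Sp d => ((wt R k ^ s : ℝ) : ℂ) • (1 : End n)) := by
  refine isMultiplier_ofReal ((measurable_wt R).pow_const s) (c := (1 + R) ^ s) fun k => ?_
  have h0 : 0 ≤ wt R k := zero_le_one.trans (one_le_wt hR k)
  rw [abs_of_nonneg (pow_nonneg h0 s)]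
  exact pow_le_pow_left₀ h0 (wt_le R k) s

/-- Multiplication by the weight. -/
def weightOp (R : ℝ) : FL d n →L[ℂ] FL d n := mulOp fun k => ((wt R k : ℝ) : ℂ) • (1 : End n)

lemma weightOp_pow {R : ℝ} (hR : 0 ≤ R) (s : ℕ) :
    (weightOp R : FL d n →L[ℂ] FL d n) ^ s
      = mulOp fun k => ((wt R k ^ s : ℝ) : ℂ) • (1 : End n) := by
  induction s with
  | zero => simp [mulOp_one]
  | succ s ih =>
    have h1 : IsMultiplier (fun k : Sp d => ((wt R k : ℝ) : ℂ) • (1 : End n)) := by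
      simpa using isMultiplier_wt_pow hR 1
    rw [pow_succ, ih, weightOp, ← mulOp_mul (isMultiplier_wt_pow hR s) h1]
    congr 1
    funext k
    rw [smul_mul_smul_comm, one_mul, ← Complex.ofReal_mul, ← pow_succ]

/-- The weighted norm. -/
def wnorm (R : ℝ) (s : ℕ) (v : FL d n) : ℝ := ‖((weightOp R) ^ s) v‖

lemma wnorm_eq {R : ℝ} (hR : 0 ≤ R) (s : ℕ) (v : FL d n) :
    wnorm R s v = ∫ k, wt R k ^ s * ‖v k‖ := by
  rw [wnorm, weightOp_pow hR]
  exact norm_eq_integral_weight (fun k => pow_nonneg (wt_nonneg hR k) s)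
    (isMultiplier_wt_pow hR s) v

lemma integrable_wnorm {R : ℝ} (hR : 0 ≤ R) (s : ℕ) (v : FL d n) :
    Integrable fun k => wt R k ^ s * ‖v k‖ :=
  integrable_weight_mul ((measurable_wt R).pow_const s)
    (fun k => pow_nonneg (wt_nonneg hR k) s)
    (fun k => pow_le_pow_left₀ (wt_nonneg hR k) (wt_le R k) s)
    (L1.integrable_coeFn v)

lemma wnorm_le_of_ae {R : ℝ} (hR : 0 ≤ R) {s s' : ℕ} {v w : FL d n} {c : ℝ}
    (h : ∀ᵐ k, wt R k ^ s * ‖v k‖ ≤ c * (wt R k ^ s' * ‖w k‖)) :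
    wnorm R s v ≤ c * wnorm R s' w := by
  rw [wnorm_eq hR, wnorm_eq hR, ← integral_const_mul]
  exact integral_mono_ae (integrable_wnorm hR s v) ((integrable_wnorm hR s' w).const_mul c) h

lemma norm_le_norm_weightOp {R : ℝ} (hR : 0 ≤ R) (v : FL d n) : ‖v‖ ≤ ‖weightOp R v‖ := by
  have h := wnorm_le_of_ae hR (s := 0) (s' := 1) (v := v) (w := v) (c := 1)
    (Eventually.of_forall fun k => by
      rw [pow_zero, pow_one, one_mul, one_mul]
      exact le_mul_of_one_le_left (norm_nonneg _) (one_le_wt hR k))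
  simpa [wnorm] using h

lemma wnorm_mulOp_le {R : ℝ} (hR : 0 ≤ R) (s : ℕ) {m : Sp d → End n} (hm : IsMultiplier m) {c : ℝ}
    (hc : ∀ k, ‖m k‖ ≤ c) (v : FL d n) : wnorm R s (mulOp m v) ≤ c * wnorm R s v := by
  apply wnorm_le_of_ae hR
  filter_upwards [mulOp_ae hm v] with k hk
  rw [hk]
  calc wt R k ^ s * ‖m k (v k)‖ ≤ wt R k ^ s * (c * ‖v k‖) :=
        mul_le_mul_of_nonneg_left ((m k).le_of_opNorm_le (hc k) _)
          (pow_nonneg (wt_nonneg hR k) s)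
    _ = c * (wt R k ^ s * ‖v k‖) := by ring

lemma wnorm_mulOp_le_succ {R : ℝ} (hR : 0 ≤ R) (s : ℕ) {m : Sp d → End n} (hm : IsMultiplier m)
    {c : ℝ} {v : FL d n} (hc : ∀ᵐ k, ‖m k (v k)‖ ≤ c * wt R k * ‖v k‖) :
    wnorm R s (mulOp m v) ≤ c * wnorm R (s + 1) v := by
  apply wnorm_le_of_ae hR
  filter_upwards [mulOp_ae hm v, hc] with k hk h1
  rw [hk]
  calc wt R k ^ s * ‖m k (v k)‖ ≤ wt R k ^ s * (c * wt R k * ‖v k‖) :=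
        mul_le_mul_of_nonneg_left h1 (pow_nonneg (wt_nonneg hR k) s)
    _ = c * (wt R k ^ (s + 1) * ‖v k‖) := by ring

set_option maxHeartbeats 1000000 in
lemma wnorm_tri_le {R : ℝ} (hR : 0 ≤ R) (s : ℕ) (Θ : Tri n) (a b c : FL d n) :
    wnorm R s (tri (d := d) Θ a b c) ≤
      (fourierConst d ^ 2 * ‖Θ‖) * wnorm R s a * wnorm R s b * wnorm R s c := by
  have h0 : ∀ k : Sp d, 0 ≤ wt R k ^ s := fun k => pow_nonneg (wt_nonneg hR k) s
  have h1 : ∀ k : Sp d, wt R k ^ s ≤ (1 + R) ^ s := fun k =>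
    pow_le_pow_left₀ (wt_nonneg hR k) (wt_le R k) s
  have h2 : ∀ k k' : Sp d, wt R (k + k') ^ s ≤ wt R k ^ s * wt R k' ^ s := fun k k' => by
    rw [← mul_pow]
    exact pow_le_pow_left₀ (wt_nonneg hR _) (wt_add_le hR k k') s
  have h3 := integral_weight_tri_le Θ ((measurable_wt R).pow_const s) h0 h1 h2 a b c
  rw [← wnorm_eq hR, ← wnorm_eq hR, ← wnorm_eq hR, ← wnorm_eq hR] at h3
  exact h3

/-! ### Complex conjugation and modulation -/

/-- Complex conjugation on the value space, as a real-linear map. -/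
def conjL : Vec n →L[ℝ] Vec n :=
  LinearMap.mkContinuous
    { toFun := conjV
      map_add' := fun v w => by ext i; simp [conjV]
      map_smul' := fun c v => by ext i; simp [conjV] }
    1 (fun v => by
      simp only [LinearMap.coe_mk, AddHom.coe_mk, one_mul]
      refine le_of_eq ?_
      simp [EuclideanSpace.norm_eq, conjV])

lemma conjL_apply (v : Vec n) : conjL v = conjV v := rfl

lemma norm_conjV (v : Vec n) : ‖conjV v‖ = ‖v‖ := by
  simp [EuclideanSpace.norm_eq, conjV]

lemma conjV_smul (c : ℂ) (v : Vec n) : conjV (c • v) = (starRingEnd ℂ) c • conjV v := by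
  ext i; simp [conjV]

/-- The Fourier image of complex conjugation: `v ↦ conj v(-k)`. -/
def conjOp : FL d n →L[ℝ] FL d n :=
  (conjL.compLpL 1 volume).comp
    (Lp.compMeasurePreservingₗᵢ ℝ (fun k : Sp d => -k)
      (Measure.measurePreserving_neg volume)).toContinuousLinearMap

lemma conjOp_ae (v : FL d n) : conjOp v =ᵐ[volume] fun k => conjV (v (-k)) := by
  have h1 := conjL.coeFn_compLpL (p := 1) (μ := volume)
    (Lp.compMeasurePreserving (fun k : Sp d => -k) (Measure.measurePreserving_neg volume) v)
  have h2 := Lp.coeFn_compMeasurePreserving v (Measure.measurePreserving_neg (volume : Measure (Sp d)))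
  refine EventuallyEq.trans h1 ?_
  filter_upwards [h2] with k hk
  rw [hk]; rfl

lemma ev_conjOp (x : Sp d) (v : FL d n) : ev x (conjOp v) = conjV (ev x v) := by
  rw [ev_apply, invFourier_congr (conjOp_ae v), ev_apply, invFourier, invFourier, conjV_smul,
    Complex.conj_ofReal]
  congr 1
  rw [← conjL_apply, ← conjL.integral_comp_comm (integrable_exp_smul (L1.integrable_coeFn v) x)]
  rw [← integral_neg_eq_self]
  congr 1
  funext k
  rw [conjL_apply, conjV_smul, neg_neg, ← Complex.exp_conj]
  simp

lemma wnorm_conjOp {R : ℝ} (hR : 0 ≤ R) (s : ℕ) (v : FL d n) :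
    wnorm R s (conjOp v) = wnorm R s v := by
  rw [wnorm_eq hR, wnorm_eq hR, ← integral_neg_eq_self (fun k => wt R k ^ s * ‖v k‖)]
  apply integral_congr_ae
  filter_upwards [conjOp_ae v] with k hk
  rw [hk, norm_conjV]
  simp [wt]

/-- Translation of Fourier transforms, i.e. modulation. -/
def shiftOp (a : Sp d) : FL d n →L[ℂ] FL d n :=
  (Lp.compMeasurePreservingₗᵢ ℂ (fun k : Sp d => k - a)
    (measurePreserving_sub_right volume a)).toContinuousLinearMap

lemma shiftOp_ae (a : Sp d) (v : FL d n) : shiftOp a v =ᵐ[volume] fun k => v (k - a) :=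
  Lp.coeFn_compMeasurePreserving v (measurePreserving_sub_right volume a)

lemma norm_shiftOp (a : Sp d) (v : FL d n) : ‖shiftOp a v‖ = ‖v‖ :=
  Lp.norm_compMeasurePreserving v (measurePreserving_sub_right volume a)

lemma ev_shiftOp (a x : Sp d) (v : FL d n) :
    ev x (shiftOp a v) = Complex.exp (Complex.I * ((inner ℝ a x : ℝ) : ℂ)) • ev x v := by
  rw [ev_apply, invFourier_congr (shiftOp_ae a v), ev_apply, invFourier, invFourier, smul_comm]
  congr 1
  rw [← integral_smul, ← integral_add_right_eq_self _ a]
  congr 1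
  funext k
  rw [add_sub_cancel_right, inner_add_left, Complex.ofReal_add, mul_add, Complex.exp_add, smul_smul,
    mul_comm]

/-- A symbol composed with a shift. -/
lemma mulOp_shiftOp {m m' : Sp d → End n} (h : IsMultiplier m) (h' : IsMultiplier m') {a : Sp d}
    (hm : ∀ k, m (k + a) = m' k) (v : FL d n) : mulOp m (shiftOp a v) = shiftOp a (mulOp m' v) := by
  apply Lp.ext
  have h1 := (measurePreserving_sub_right volume a).quasiMeasurePreserving.ae (mulOp_ae h' v)
  filter_upwards [mulOp_ae h (shiftOp a v), shiftOp_ae a (mulOp m' v), shiftOp_ae a v, h1]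
    with k e1 e2 e3 e4
  rw [e1, e2, e3, e4, ← hm, sub_add_cancel]

/-- A symbol composed with conjugation. -/
lemma mulOp_conjOp {m m' : Sp d → End n} (h : IsMultiplier m) (h' : IsMultiplier m')
    (hm : ∀ k v, m k (conjV v) = conjV (m' (-k) v)) (v : FL d n) :
    mulOp m (conjOp v) = conjOp (mulOp m' v) := by
  apply Lp.ext
  have h1 := (Measure.measurePreserving_neg (volume : Measure (Sp d))).quasiMeasurePreserving.ae
    (mulOp_ae h' v)
  filter_upwards [mulOp_ae h (conjOp v), conjOp_ae (mulOp m' v), conjOp_ae v, h1]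
    with k e1 e2 e3 e4
  rw [e1, e2, e3, e4, ← hm]

/-! ### Unitary groups of Fourier multipliers -/

lemma continuous_expEnd : Continuous (NormedSpace.exp : End n → End n) := by
  let +nondep : NormedAlgebra ℚ (End n) := .restrictScalars ℚ ℂ (End n)
  exact NormedSpace.exp_continuous

lemma expEnd_add {x y : End n} (h : Commute x y) :
    NormedSpace.exp (x + y) = NormedSpace.exp x * NormedSpace.exp y := by
  let +nondep : NormedAlgebra ℚ (End n) := .restrictScalars ℚ ℂ (End n)
  exact NormedSpace.exp_add_of_commute h

lemma norm_exp_le_one {x : End n} (hx : x ∈ skewAdjoint (End n)) : ‖NormedSpace.exp x‖ ≤ 1 := by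
  let +nondep : NormedAlgebra ℚ (End n) := .restrictScalars ℚ ℂ (End n)
  have h := (Unitary.mem_iff.1 (NormedSpace.exp_mem_unitary_of_mem_skewAdjoint hx)).1
  have h1 := CStarRing.norm_star_mul_self (x := NormedSpace.exp x)
  rw [h] at h1
  have h2 : ‖(1 : End n)‖ ≤ 1 := ContinuousLinearMap.norm_id_le
  nlinarith [norm_nonneg (NormedSpace.exp x)]

lemma smul_mem_skewAdjoint (t : ℝ) {x : End n} (hx : x ∈ skewAdjoint (End n)) :
    (t : ℂ) • x ∈ skewAdjoint (End n) := by
  rw [skewAdjoint.mem_iff] at hx ⊢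
  rw [star_smul, hx, smul_neg, Complex.star_def, Complex.conj_ofReal]

/-- Symbols with values in the skew-adjoint matrices. -/
def IsSkew (b : Sp d → End n) : Prop :=
  StronglyMeasurable b ∧ ∀ k, b k ∈ skewAdjoint (End n)

/-- The unitary group generated by `-b`. -/
def sg (b : Sp d → End n) (t : ℝ) : FL d n →L[ℂ] FL d n :=
  mulOp fun k => NormedSpace.exp (-((t : ℂ) • b k))

variable {b : Sp d → End n}

lemma IsSkew.norm_exp_le (hb : IsSkew b) (t : ℝ) (k : Sp d) :
    ‖NormedSpace.exp (-((t : ℂ) • b k))‖ ≤ 1 :=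
  norm_exp_le_one (neg_mem (smul_mem_skewAdjoint t (hb.2 k)))

lemma IsSkew.isMultiplier (hb : IsSkew b) (t : ℝ) :
    IsMultiplier fun k => NormedSpace.exp (-((t : ℂ) • b k)) :=
  ⟨continuous_expEnd.comp_stronglyMeasurable (hb.1.const_smul (t : ℂ)).neg, 1,
    hb.norm_exp_le t⟩

lemma sg_zero : sg b 0 = 1 := by
  unfold sg
  simp [mulOp_one]

lemma sg_add (hb : IsSkew b) (t s : ℝ) : sg b (t + s) = sg b t * sg b s := by
  unfold sg
  rw [← mulOp_mul (hb.isMultiplier t) (hb.isMultiplier s)]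
  congr 1
  funext k
  rw [← expEnd_add]
  · congr 1
    push_cast
    rw [add_smul, neg_add]
  · exact ((Commute.refl (b k)).smul_left _).smul_right _ |>.neg_left.neg_right

lemma norm_sg_le (hb : IsSkew b) (t : ℝ) (v : FL d n) : ‖sg b t v‖ ≤ ‖v‖ := by
  simpa [sg] using norm_mulOp_le (hb.isMultiplier t) (hb.norm_exp_le t) v

lemma wnorm_sg_le (hb : IsSkew b) {R : ℝ} (hR : 0 ≤ R) (s : ℕ) (t : ℝ) (v : FL d n) :
    wnorm R s (sg b t v) ≤ wnorm R s v := by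
  simpa [sg] using wnorm_mulOp_le hR s (hb.isMultiplier t) (hb.norm_exp_le t) v

/-- The group is strongly continuous. -/
lemma continuous_sg (hb : IsSkew b) (v : FL d n) : Continuous fun t => sg b t v := by
  rw [continuous_iff_continuousAt]
  intro t₀
  rw [ContinuousAt, tendsto_iff_norm_sub_tendsto_zero]
  have key : ∀ t, ‖sg b t v - sg b t₀ v‖ = ∫ k, ‖NormedSpace.exp (-((t : ℂ) • b k)) (v k)
      - NormedSpace.exp (-((t₀ : ℂ) • b k)) (v k)‖ := by
    intro t
    rw [L1.norm_eq_integral_norm]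
    apply integral_congr_ae
    filter_upwards [mulOp_ae (hb.isMultiplier t) v, mulOp_ae (hb.isMultiplier t₀) v,
      Lp.coeFn_sub (sg b t v) (sg b t₀ v)] with k h1 h2 h3
    rw [h3, Pi.sub_apply, sg, sg, h1, h2]
  simp only [key]
  have h0 : (0 : ℝ) = ∫ k : Sp d, (0 : ℝ) := by simp
  rw [h0]
  refine tendsto_integral_filter_of_dominated_convergence (fun k => 2 * ‖v k‖) ?_ ?_
    ((L1.integrable_coeFn v).norm.const_mul 2) ?_
  · exact Eventually.of_forall fun t => (((hb.isMultiplier t).integrable v).sub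
      ((hb.isMultiplier t₀).integrable v)).norm.aestronglyMeasurable
  · refine Eventually.of_forall fun t => Eventually.of_forall fun k => ?_
    rw [norm_norm]
    have h1 := (NormedSpace.exp (-((t : ℂ) • b k))).le_of_opNorm_le (hb.norm_exp_le t k) (v k)
    have h2 := (NormedSpace.exp (-((t₀ : ℂ) • b k))).le_of_opNorm_le (hb.norm_exp_le t₀ k) (v k)
    linarith [norm_sub_le (NormedSpace.exp (-((t : ℂ) • b k)) (v k))
      (NormedSpace.exp (-((t₀ : ℂ) • b k)) (v k))]
  · refine Eventually.of_forall fun k => ?_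
    have hc : Continuous fun t : ℝ => ‖NormedSpace.exp (-((t : ℂ) • b k)) (v k)
        - NormedSpace.exp (-((t₀ : ℂ) • b k)) (v k)‖ := by
      have : Continuous fun t : ℝ => NormedSpace.exp (-((t : ℂ) • b k)) :=
        continuous_expEnd.comp (by fun_prop)
      fun_prop
    simpa using hc.tendsto t₀

/-- The group is only strongly continuous for unbounded symbols. The contraction property takes care
of the variation of the argument, strong continuity at the fixed vector f(r₀) of the rest. -/
lemma continuousOn_sg_apply (hb : IsSkew b) {f : ℝ → FL d n} {s : Set ℝ} (hf : ContinuousOn f s)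
    (t : ℝ) : ContinuousOn (fun r => sg b (t - r) (f r)) s := by
  intro r₀ hr₀
  rw [ContinuousWithinAt, tendsto_iff_norm_sub_tendsto_zero]
  have h1 : Tendsto (fun r => ‖f r - f r₀‖) (𝓝[s] r₀) (𝓝 0) :=
    tendsto_iff_norm_sub_tendsto_zero.1 (hf r₀ hr₀)
  have h2 : Tendsto (fun r => ‖sg b (t - r) (f r₀) - sg b (t - r₀) (f r₀)‖) (𝓝[s] r₀) (𝓝 0) :=
    tendsto_iff_norm_sub_tendsto_zero.1
      (((continuous_sg hb (f r₀)).comp (continuous_const.sub continuous_id)).continuousAt.tendsto.mono_left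
        nhdsWithin_le_nhds)
  have h3 := h1.add h2
  rw [add_zero] at h3
  refine squeeze_zero (fun _ => norm_nonneg _) (fun r => ?_) h3
  calc ‖sg b (t - r) (f r) - sg b (t - r₀) (f r₀)‖
      = ‖sg b (t - r) (f r - f r₀) + (sg b (t - r) (f r₀) - sg b (t - r₀) (f r₀))‖ := by
        rw [map_sub]; congr 1; abel
    _ ≤ _ := (norm_add_le _ _).trans (add_le_add (norm_sg_le hb _ _) le_rfl)

lemma sub_sub_smul_neg {M : Type*} [AddCommGroup M] [Module ℝ M] [Module ℂ M]
    [IsScalarTower ℝ ℂ M] (t : ℝ) (x y z : M) :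
    x - y - t • -z = x + ((-1 : ℂ) • y + (t : ℂ) • z) := by
  have h : (t : ℂ) • z = t • z := by
    rw [← mul_one (t : ℂ), ← Complex.real_smul, smul_assoc, one_smul]
  rw [smul_neg, h, neg_one_smul]
  abel

lemma mulOp_taylor {e b : Sp d → End n} (he : IsMultiplier e) (hb : IsMultiplier b) (c : ℂ) :
    mulOp (fun k => e k + ((-1 : ℂ) • (1 : End n) + c • b k))
      = mulOp e + ((-1 : ℂ) • (1 : FL d n →L[ℂ] FL d n) + c • mulOp b) := by
  rw [mulOp_add he (((isMultiplier_const 1).smul _).add (hb.smul _)),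
    mulOp_add ((isMultiplier_const 1).smul _) (hb.smul _), mulOp_smul (isMultiplier_const 1),
    mulOp_smul hb, mulOp_one]

-- Boundedness of the symbol makes the Taylor remainder of the exponential uniform in the frequency,
-- so differentiability holds in operator norm. The truncation of frequencies serves this purpose.
set_option maxHeartbeats 1000000 in
lemma hasDerivAt_sg_zero (hb : IsSkew b) (hm : IsMultiplier b) :
    HasDerivAt (sg b) (-(mulOp b)) 0 := by
  obtain ⟨c, hc⟩ := hm.2
  have hc0 : 0 ≤ c := (norm_nonneg _).trans (hc 0)
  rw [hasDerivAt_iff_isLittleO_nhds_zero, Asymptotics.isLittleO_iff]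
  intro η hη
  have h0 := (hasFDerivAt_exp_zero (𝕂 := ℂ) (𝔸 := End n))
  rw [hasFDerivAt_iff_isLittleO_nhds_zero, Asymptotics.isLittleO_iff] at h0
  have h1 := h0 (c := η / (c + 1)) (by positivity)
  rw [Metric.eventually_nhds_iff] at h1 ⊢
  obtain ⟨δ, hδ, h1⟩ := h1
  refine ⟨δ / (c + 1), by positivity, fun t ht => ?_⟩
  rw [dist_zero_right] at ht
  have hm2 : IsMultiplier fun k => NormedSpace.exp (-((t : ℂ) • b k)) + (((-1 : ℂ) • (1 : End n)) +
      (t : ℂ) • b k) :=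
    (hb.isMultiplier t).add (((isMultiplier_const 1).smul _).add (hm.smul _))
  have e : sg b (0 + t) - sg b 0 - t • -(mulOp b) = mulOp fun k => NormedSpace.exp (-((t : ℂ) • b k))
      + (((-1 : ℂ) • (1 : End n)) + (t : ℂ) • b k) := by
    rw [mulOp_taylor (hb.isMultiplier t) hm, zero_add, sg_zero]
    exact sub_sub_smul_neg t _ _ _
  rw [e]
  have hbound : ∀ k, ‖NormedSpace.exp (-((t : ℂ) • b k)) + (((-1 : ℂ) • (1 : End n)) +
      (t : ℂ) • b k)‖ ≤ η * ‖t‖ := by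
    intro k
    have hn : ‖-((t : ℂ) • b k)‖ ≤ ‖t‖ * c := by
      rw [norm_neg, norm_smul, Complex.norm_real]
      exact mul_le_mul_of_nonneg_left (hc k) (norm_nonneg _)
    have hlt : ‖t‖ * c < δ := by
      rw [lt_div_iff₀ (by positivity)] at ht
      nlinarith [norm_nonneg t]
    have h2 := h1 (y := -((t : ℂ) • b k)) (by rw [dist_zero_right]; exact hn.trans_lt hlt)
    rw [zero_add, NormedSpace.exp_zero, _root_.one_apply_eq_self] at h2
    have h3 : NormedSpace.exp (-((t : ℂ) • b k)) - 1 - -((t : ℂ) • b k) =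
        NormedSpace.exp (-((t : ℂ) • b k)) + (((-1 : ℂ) • (1 : End n)) + (t : ℂ) • b k) := by
      module
    rw [h3] at h2
    refine h2.trans ?_
    calc η / (c + 1) * ‖-((t : ℂ) • b k)‖ ≤ η / (c + 1) * (‖t‖ * c) := by gcongr
      _ = η * ‖t‖ * (c / (c + 1)) := by ring
      _ ≤ η * ‖t‖ * 1 := by
        gcongr
        rw [div_le_one (by positivity)]; linarith
      _ = η * ‖t‖ := mul_one _
  exact opNorm_mulOp_le hm2 hbound

lemma sg_comm (hb : IsSkew b) {m : Sp d → End n} (hm : IsMultiplier m)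
    (hc : ∀ k, Commute (m k) (b k)) (t : ℝ) (v : FL d n) :
    mulOp m (sg b t v) = sg b t (mulOp m v) := by
  have := mulOp_comm hm (hb.isMultiplier t) fun k =>
    (((hc k).smul_right (t : ℂ)).neg_right).exp_right
  exact congrArg (fun L : FL d n →L[ℂ] FL d n => L v) this

set_option maxHeartbeats 1000000 in
lemma isGroup_sg (hb : IsSkew b) (hm : IsMultiplier b) :
    IsGroup ((mulOp b).restrictScalars ℝ) (fun t => (sg b t).restrictScalars ℝ) where
  zero := by simp only [sg_zero]; rfl
  add t s := by simp only [sg_add hb]; rfl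
  comm t v := sg_comm hb hm (fun k => Commute.refl _) t v
  deriv t := by
    have h0 := hasDerivAt_sg_zero hb hm
    have h1 : HasDerivAt (fun s => sg b (s - t)) (-(mulOp b)) t :=
      HasDerivAt.comp_sub_const t t (by rwa [sub_self])
    have h2 := h1.mul_const (sg b t)
    have h3 : (fun s => sg b (s - t) * sg b t) = sg b := by
      funext s
      rw [← sg_add hb, sub_add_cancel]
    rw [h3] at h2
    exact (ContinuousLinearMap.restrictScalarsL ℂ (FL d n) (FL d n) ℝ ℝ).hasFDerivAt.comp_hasDerivAt
      t h2

/-! ### Matrices as operators -/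

/-- Matrices as operators on `ℂ^n`. -/
def cl : Matrix (Fin n) (Fin n) ℂ ≃⋆ₐ[ℂ] End n := Matrix.toEuclideanCLM (n := Fin n) (𝕜 := ℂ)

lemma cl_apply (M : Matrix (Fin n) (Fin n) ℂ) (v : Vec n) : cl M v = mulV M v := rfl

lemma continuous_cl : Continuous (cl : Matrix (Fin n) (Fin n) ℂ → End n) :=
  LinearMap.continuous_of_finiteDimensional
    (cl (n := n)).toAlgEquiv.toLinearMap

open scoped Matrix.Norms.L2Operator in
lemma cl_exp (M : Matrix (Fin n) (Fin n) ℂ) :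
    cl (NormedSpace.exp M) = NormedSpace.exp (cl M) := by
  let +nondep : NormedAlgebra ℚ (End n) := .restrictScalars ℚ ℂ (End n)
  let +nondep : NormedAlgebra ℚ (Matrix (Fin n) (Fin n) ℂ) := .restrictScalars ℚ ℂ _
  exact NormedSpace.map_exp (cl (n := n)) continuous_cl M

variable {A : Fin d → Matrix (Fin n) (Fin n) ℝ} {E : Matrix (Fin n) (Fin n) ℝ}

lemma symbolA_add (β β' : Sp d) : symbolA A (β + β') = symbolA A β + symbolA A β' := by
  simp [symbolA, add_smul, Finset.sum_add_distrib]

lemma symbolA_smul (c : ℝ) (β : Sp d) : symbolA A (c • β) = (c : ℂ) • symbolA A β := by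
  simp [symbolA, mul_smul, Finset.smul_sum]

/-- The symbol of `-i A(∂)`, as a linear map. -/
def clA (A : Fin d → Matrix (Fin n) (Fin n) ℝ) : Sp d →L[ℝ] End n :=
  LinearMap.toContinuousLinearMap
    { toFun := fun β => cl (symbolA A β)
      map_add' := fun β β' => by rw [symbolA_add, map_add]
      map_smul' := fun c β => by
        rw [symbolA_smul, map_smul]; rfl }

lemma clA_apply (β : Sp d) : clA A β = cl (symbolA A β) := rfl

lemma isSelfAdjoint_cl {M : Matrix (Fin n) (Fin n) ℂ} (h : M.IsHermitian) :
    IsSelfAdjoint (cl M) := by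
  rw [isSelfAdjoint_iff, ← map_star]
  congr 1

lemma isHermitian_symbolA (hA : ∀ l, (A l).IsSymm) (β : Sp d) : (symbolA A β).IsHermitian := by
  rw [Matrix.IsHermitian, symbolA, Matrix.conjTranspose_sum]
  refine Finset.sum_congr rfl fun l _ => ?_
  ext i j
  have := (hA l).apply i j
  simp [this]

lemma isHermitian_symbolL (hA : ∀ l, (A l).IsSymm) (hE : E.transpose = -E) (α : ℝ) (β : Sp d) :
    (symbolL A E α β).IsHermitian := by
  have hA := isHermitian_symbolA hA β
  ext i j
  have h1 : star (symbolA A β j i) = symbolA A β i j := hA.apply i j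
  have h2 : E j i = -E i j := by
    have := congrFun (congrFun hE i) j
    simpa using this
  simp only [symbolL, Matrix.conjTranspose_apply, Matrix.sub_apply, Matrix.add_apply,
    Matrix.neg_apply, Matrix.smul_apply, star_sub, star_add, star_neg, h1, smul_eq_mul, star_mul',
    Matrix.map_apply, h2]
  by_cases hij : i = j
  · subst hij; simp
  · simp [Matrix.one_apply_ne hij, Matrix.one_apply_ne (Ne.symm hij)]

lemma I_smul_mem_skewAdjoint {x : End n} (hx : IsSelfAdjoint x) :
    Complex.I • x ∈ skewAdjoint (End n) := by
  rw [skewAdjoint.mem_iff, star_smul, hx.star_eq]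
  simp

lemma symbolL_add (α : ℝ) (β β' : Sp d) :
    symbolL A E α (β + β') = symbolL A E α β + symbolA A β' := by
  rw [symbolL, symbolA_add, symbolL]; abel

lemma symbolL_eq (α : ℝ) (β : Sp d) :
    symbolL A E α β = symbolL A E 0 β - (α : ℂ) • (1 : Matrix (Fin n) (Fin n) ℂ) := by
  simp only [symbolL, Complex.ofReal_zero, zero_smul]; abel

/-- `cl M v` is conjugated to the operator of the conjugate matrix. -/
lemma conjV_mulV (M : Matrix (Fin n) (Fin n) ℂ) (v : Vec n) :
    conjV (mulV M v) = mulV (M.map (starRingEnd ℂ)) (conjV v) := by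
  ext i
  simp [conjV, mulV, Matrix.mulVec, dotProduct]

/-! ### Spectral decomposition -/

/-- The rank one operator `|v⟩⟨v|`. -/
def rk (v : Vec n) : End n := (innerSL ℂ v).smulRight v

lemma rk_apply (v x : Vec n) : rk v x = (inner ℂ v x : ℂ) • v := rfl

lemma norm_rk_le (v : Vec n) : ‖rk v‖ ≤ ‖v‖ * ‖v‖ := by
  rw [rk, ContinuousLinearMap.norm_smulRight_apply, innerSL_apply_norm]

lemma continuous_rk : Continuous (rk : Vec n → End n) := by
  have h : (rk : Vec n → End n) = fun v =>
      ContinuousLinearMap.smulRightL ℂ (Vec n) (Vec n) (innerSL ℂ v) v := rfl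
  rw [h]
  fun_prop

section Spectral

variable {ψ : Fin n → Vec n} {M : End n} {μ : Fin n → ℂ}

lemma ext_of_orthonormal (hψ : Orthonormal ℂ ψ) {B B' : End n} (h : ∀ l, B (ψ l) = B' (ψ l)) : B = B' := by
  have hs : Submodule.span ℂ (Set.range ψ) = ⊤ :=
    hψ.linearIndependent.span_eq_top_of_card_eq_finrank' (by simp)
  exact ContinuousLinearMap.ext_on (s := Set.range ψ) (by rw [hs]; simp)
    (by rintro _ ⟨l, rfl⟩; exact h l)

lemma rk_apply_of_orthonormal (hψ : Orthonormal ℂ ψ) (l m : Fin n) : rk (ψ l) (ψ m) = if l = m then ψ m else 0 := by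
  rw [rk_apply, orthonormal_iff_ite.1 hψ]
  split_ifs with h
  · rw [one_smul, h]
  · rw [zero_smul]

lemma sum_rk (hψ : Orthonormal ℂ ψ) : ∑ l, rk (ψ l) = (1 : End n) := by
  apply ext_of_orthonormal hψ
  intro m
  rw [_root_.sum_apply]
  simp [rk_apply_of_orthonormal hψ]

lemma mul_rk {v : Vec n} {c : ℂ} (h : M v = c • v) : M * rk v = c • rk v := by
  ext1 x
  change M (rk v x) = c • rk v x
  rw [rk_apply, map_smul, h, smul_comm]

lemma rk_mul (hψ : Orthonormal ℂ ψ) (hM : ∀ l, M (ψ l) = μ l • ψ l) (l : Fin n) :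
    rk (ψ l) * M = μ l • rk (ψ l) := by
  apply ext_of_orthonormal hψ
  intro m
  change rk (ψ l) (M (ψ m)) = μ l • rk (ψ l) (ψ m)
  rw [hM, map_smul, rk_apply_of_orthonormal hψ]
  split_ifs with h
  · rw [h]
  · simp

end Spectral

/-! ### Trilinear maps -/

/-- Linearity in each of three arguments. -/
structure IsTrilinear (f : Vec n → Vec n → Vec n → Vec n) : Prop where
  add₁ : ∀ a a' b c, f (a + a') b c = f a b c + f a' b c
  smul₁ : ∀ (r : ℂ) a b c, f (r • a) b c = r • f a b c
  add₂ : ∀ a b b' c, f a (b + b') c = f a b c + f a b' c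
  smul₂ : ∀ (r : ℂ) a b c, f a (r • b) c = r • f a b c
  add₃ : ∀ a b c c', f a b (c + c') = f a b c + f a b c'
  smul₃ : ∀ (r : ℂ) a b c, f a b (r • c) = r • f a b c

/-- A trilinear function as a bundled map. -/
def mkTri (f : Vec n → Vec n → Vec n → Vec n) (hf : IsTrilinear f) : Tri n :=
  LinearMap.toContinuousLinearMap
    { toFun := fun a => LinearMap.toContinuousLinearMap
        { toFun := fun b => LinearMap.toContinuousLinearMap
            { toFun := fun c => f a b c
              map_add' := hf.add₃ a b
              map_smul' := fun r c => hf.smul₃ r a b c }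
          map_add' := fun b b' => by ext1 c; exact hf.add₂ a b b' c
          map_smul' := fun r b => by ext1 c; exact hf.smul₂ r a b c }
      map_add' := fun a a' => by ext1 b; ext1 c; exact hf.add₁ a a' b c
      map_smul' := fun r a => by ext1 b; ext1 c; exact hf.smul₁ r a b c }

lemma mkTri_apply {f : Vec n → Vec n → Vec n → Vec n} (hf : IsTrilinear f) (a b c : Vec n) :
    mkTri f hf a b c = f a b c := rfl

lemma isTrilinear_extT (T : Trilin n) : IsTrilinear (extT T) := by
  constructor <;> intros <;> ext i <;>
    simp only [extT, PiLp.add_apply, PiLp.smul_apply, smul_eq_mul, ← Finset.sum_add_distrib,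
      Finset.mul_sum] <;>
    refine Finset.sum_congr rfl fun _ _ => Finset.sum_congr rfl fun _ _ =>
      Finset.sum_congr rfl fun _ _ => ?_ <;> ring

lemma isTrilinear_symm (Θ : Tri n) :
    IsTrilinear fun a b c => Θ a b c + Θ b a c + Θ b c a := by
  constructor <;> intros <;>
    simp only [map_add, map_smul, _root_.add_apply, _root_.smul_apply, smul_add] <;> abel

lemma extT_conjV (T : Trilin n) (a b c : Vec n) :
    conjV (extT T a b c) = extT T (conjV a) (conjV b) (conjV c) := by
  ext i
  simp [extT, conjV]

/-! ### The Sylvester equation -/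

/-- `X ↦ M X - X N`. -/
def sylv (M N : End n) : End n →ₗ[ℂ] End n :=
  LinearMap.mulLeft ℂ M - LinearMap.mulRight ℂ N

lemma sylv_apply (M N X : End n) : sylv M N X = M * X - X * N := rfl

lemma aeval_mul_of_sylv {M N X : End n} (h : M * X = X * N) (p : Polynomial ℂ) :
    Polynomial.aeval M p * X = X * Polynomial.aeval N p := by
  induction p using Polynomial.induction_on' with
  | add p q hp hq => rw [map_add, map_add, add_mul, mul_add, hp, hq]
  | monomial k a =>
    rw [Polynomial.aeval_monomial, Polynomial.aeval_monomial, mul_assoc, ← mul_assoc X,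
      ← Algebra.commutes a X, mul_assoc]
    congr 1
    exact (SemiconjBy.pow_right (show SemiconjBy X N M from h.symm) k).symm

/-- The Sylvester operator of matrices without common eigenvalues is bijective. -/
lemma sylv_bijective {M N : Matrix (Fin n) (Fin n) ℂ}
    (h : Disjoint (spectrum ℂ M) (spectrum ℂ N)) :
    Function.Bijective (sylv (cl M) (cl N)) := by
  have hinj : Function.Injective (sylv (cl M) (cl N)) := by
    rw [injective_iff_map_eq_zero]
    intro X hX
    rw [sylv_apply, sub_eq_zero] at hX
    -- From M X = X N follows p(M) X = X p(N) for every polynomial p. With p the characteristic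
    -- polynomial of N the right side vanishes, while p(M) is invertible because no root of p is an
    -- eigenvalue of M; hence X = 0.
    have h1 := aeval_mul_of_sylv hX N.charpoly
    have h2 : Polynomial.aeval (cl N) N.charpoly = 0 := by
      rw [Polynomial.aeval_algHom_apply, Matrix.aeval_self_charpoly, map_zero]
    rw [h2, mul_zero] at h1
    have h3 : IsUnit (Polynomial.aeval (cl M) N.charpoly) := by
      by_contra hcon
      have h4 := (IsAlgClosed.splits N.charpoly).eq_prod_roots_of_monic N.charpoly_monic
      rw [h4] at hcon
      obtain ⟨z, hz, hz0⟩ := spectrum.exists_mem_of_not_isUnit_aeval_prod hcon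
      rw [AlgEquiv.spectrum_eq] at hz
      exact Set.disjoint_left.1 h hz (Matrix.mem_spectrum_of_isRoot_charpoly hz0)
    exact (h3.mul_right_eq_zero).1 h1
  exact ⟨hinj, LinearMap.injective_iff_surjective.1 hinj⟩

/-! ### Truncated symbols -/

/-- Truncation of frequencies. -/
def cut (R : ℝ) (k : Sp d) : Sp d := if ‖k‖ ≤ R then k else 0

lemma measurable_cut (R : ℝ) : Measurable (cut (d := d) R) :=
  Measurable.ite (measurableSet_le measurable_norm measurable_const) measurable_id measurable_const

lemma norm_cut_le {R : ℝ} (hR : 0 ≤ R) (k : Sp d) : ‖cut R k‖ ≤ R := by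
  unfold cut
  split_ifs with h
  · exact h
  · simpa using hR

lemma norm_cut_le_wt {R : ℝ} (hR : 0 ≤ R) (k : Sp d) : ‖cut R k‖ ≤ wt R k := by
  refine le_min ?_ (by linarith [norm_cut_le hR k])
  unfold cut
  split_ifs with h
  · linarith
  · rw [norm_zero]; positivity

/-- The low-frequency projection. -/
def lowSym (n : ℕ) (R : ℝ) (k : Sp d) : End n := ((if ‖k‖ ≤ R then 1 else 0 : ℝ) : ℂ) • (1 : End n)

lemma isMultiplier_lowSym (R : ℝ) : IsMultiplier (lowSym (d := d) n R) := by
  refine isMultiplier_ofReal (c := 1) (Measurable.ite (measurableSet_le measurable_norm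
    measurable_const) measurable_const measurable_const) fun k => ?_
  split_ifs <;> simp

lemma lowSym_apply (R : ℝ) (k : Sp d) (v : Vec n) :
    lowSym n R k v = if ‖k‖ ≤ R then v else 0 := by
  unfold lowSym
  split_ifs <;> simp

lemma norm_lowSym_le (R : ℝ) (k : Sp d) : ‖lowSym n R k‖ ≤ 1 := by
  refine ContinuousLinearMap.opNorm_le_bound _ zero_le_one fun v => ?_
  rw [lowSym_apply]
  split_ifs <;> simp

/-- The low-frequency projection on `FL`. -/
def low (R : ℝ) : FL d n →L[ℂ] FL d n := mulOp (lowSym n R)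

lemma wnorm_low_le {R : ℝ} (hR : 0 ≤ R) (R' : ℝ) (s : ℕ) (v : FL d n) :
    wnorm R s (low R' v) ≤ wnorm R s v := by
  simpa [low] using wnorm_mulOp_le hR s (isMultiplier_lowSym R') (norm_lowSym_le R') v

/-- High frequencies are small in weaker norms. -/
lemma wnorm_sub_low_le {R : ℝ} (hR : 0 < R) (s : ℕ) (v : FL d n) :
    wnorm R s (v - low R v) ≤ R⁻¹ * wnorm R (s + 1) v := by
  apply wnorm_le_of_ae hR.le
  filter_upwards [Lp.coeFn_sub v (low R v), mulOp_ae (isMultiplier_lowSym R) v] with k h1 h2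
  rw [h1, Pi.sub_apply, low, h2, lowSym_apply]
  have hw := wt_nonneg hR.le k
  split_ifs with h
  · rw [sub_self, norm_zero, mul_zero]; positivity
  · rw [sub_zero]
    have h3 : R ≤ wt R k := by
      push Not at h
      exact le_min (by linarith) (by linarith)
    have h4 : 1 ≤ R⁻¹ * wt R k := by
      rw [inv_mul_eq_div, one_le_div hR]; exact h3
    calc wt R k ^ s * ‖v k‖ = 1 * (wt R k ^ s * ‖v k‖) := (one_mul _).symm
      _ ≤ (R⁻¹ * wt R k) * (wt R k ^ s * ‖v k‖) :=
        mul_le_mul_of_nonneg_right h4 (by positivity)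
      _ = _ := by ring

lemma ev_mulOp_const (M : End n) (x : Sp d) (v : FL d n) :
    ev x (mulOp (fun _ => M) v) = M (ev x v) := by
  rw [ev_apply, invFourier_congr (mulOp_ae (isMultiplier_const M) v), ev_apply, invFourier,
    invFourier, map_smul, ← M.integral_comp_comm (integrable_exp_smul (L1.integrable_coeFn v) x)]
  simp only [map_smul]

/-- For fixed b, c solve M X - X N = Ts(·, b, c) for a matrix X and put Θ(a, b, c) = -i X a; the
factor -i compensates the i in front of both matrices. Uniqueness of X makes the result trilinear.
-/
lemma exists_sylvester {M N : Matrix (Fin n) (Fin n) ℂ}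
    (h : Disjoint (spectrum ℂ M) (spectrum ℂ N)) (Ts : Tri n) :
    ∃ Θ : Tri n, ∀ a b c,
      (Complex.I • cl M) (Θ a b c) = Θ ((Complex.I • cl N) a) b c + Ts a b c := by
  let S := LinearEquiv.ofBijective _ (sylv_bijective h)
  have hf : IsTrilinear fun a b c => (-Complex.I • S.symm ((Ts.flip b).flip c)) a := by
    constructor <;> intros <;>
      simp only [map_add, map_smul, _root_.add_apply, _root_.smul_apply,
        smul_add, ContinuousLinearMap.flip_add, ContinuousLinearMap.flip_smul,
        smul_comm (-Complex.I)]
  refine ⟨mkTri _ hf, fun a b c => ?_⟩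
  simp only [mkTri_apply]
  have h1 : S (S.symm ((Ts.flip b).flip c)) = (Ts.flip b).flip c := S.apply_symm_apply _
  set X := S.symm ((Ts.flip b).flip c)
  have h2 : cl M (X a) - X (cl N a) = Ts a b c := congrArg (fun B : End n => B a) h1
  rw [← h2]
  simp only [_root_.smul_apply, map_smul, smul_smul]
  simp

/-! ### ### The concrete symbols and their spectral decomposition -/

/-- The data of the envelope problem. -/
structure Problem (d n : ℕ) [NeZero n] where
  A : Fin d → Matrix (Fin n) (Fin n) ℝ
  symm : ∀ l, (A l).IsSymm
  E : Matrix (Fin n) (Fin n) ℝ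
  skew : E.transpose = -E
  T : Trilin n
  κ : Sp d
  ω : ℝ
  w : Fin n → Sp d → ℝ
  ψ : Fin n → Sp d → Vec n
  eig : IsSmoothEigendecomposition A E κ ω w ψ
  res₃ : NonResonant (symbolL A E (3 * ω) ((3 : ℝ) • κ)) (symbolL A E ω κ)
  res₅ : NonResonant (symbolL A E (5 * ω) ((5 : ℝ) • κ)) (symbolL A E (3 * ω) ((3 : ℝ) • κ))

namespace Problem

variable [NeZero n] (p : Problem d n)

/-- The symbol `i 𝓛(jω, jκ)`. -/
def L (j : ℝ) : End n := Complex.I • cl (symbolL p.A p.E (j * p.ω) (j • p.κ))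

lemma L_one : p.L 1 = Complex.I • cl (symbolL p.A p.E p.ω p.κ) := by
  rw [L, one_mul, one_smul]

lemma L_mem (j : ℝ) : p.L j ∈ skewAdjoint (End n) :=
  I_smul_mem_skewAdjoint (isSelfAdjoint_cl (isHermitian_symbolL p.symm p.skew _ _))

/-- The truncated symbol of `A(∂)`. -/
def aSym (R : ℝ) (k : Sp d) : End n := Complex.I • clA p.A (cut R k)

lemma norm_aSym_le (R : ℝ) (k : Sp d) : ‖p.aSym R k‖ ≤ ‖clA p.A‖ * ‖cut R k‖ := by
  rw [aSym, norm_smul, Complex.norm_I, one_mul]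
  exact (clA p.A).le_opNorm _

lemma isMultiplier_aSym {R : ℝ} (hR : 0 ≤ R) : IsMultiplier (p.aSym R) := by
  refine ⟨?_, ‖clA p.A‖ * R, fun k => (p.norm_aSym_le R k).trans
    (mul_le_mul_of_nonneg_left (norm_cut_le hR k) (norm_nonneg _))⟩
  exact ((clA p.A).continuous.comp_stronglyMeasurable
    (measurable_cut R).stronglyMeasurable).const_smul Complex.I

/-- The symbol of the `j`-th envelope equation. -/
def bSym (ε R j : ℝ) (k : Sp d) : End n := ((ε⁻¹ : ℝ) : ℂ) • p.L j + p.aSym R k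

lemma isMultiplier_bSym {R : ℝ} (hR : 0 ≤ R) (ε j : ℝ) : IsMultiplier (p.bSym ε R j) :=
  ((isMultiplier_const (p.L j)).smul _).add (p.isMultiplier_aSym hR)

lemma aSym_mem (R : ℝ) (k : Sp d) : p.aSym R k ∈ skewAdjoint (End n) :=
  I_smul_mem_skewAdjoint (isSelfAdjoint_cl (isHermitian_symbolA p.symm _))

lemma isSkew_bSym {R : ℝ} (hR : 0 ≤ R) (ε j : ℝ) : IsSkew (p.bSym ε R j) :=
  ⟨(p.isMultiplier_bSym hR ε j).1, fun k =>
    add_mem (smul_mem_skewAdjoint _ (p.L_mem j)) (p.aSym_mem R k)⟩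

lemma mulOp_bSym {R : ℝ} (hR : 0 ≤ R) (ε j : ℝ) (v : FL d n) :
    mulOp (p.bSym ε R j) v = ε⁻¹ • mulOp (fun _ => p.L j) v + mulOp (p.aSym R) v := by
  have h := mulOp_add ((isMultiplier_const (p.L j)).smul ((ε⁻¹ : ℝ) : ℂ)) (p.isMultiplier_aSym hR)
  rw [mulOp_smul (isMultiplier_const _)] at h
  exact congrArg (fun B : FL d n →L[ℂ] FL d n => B v) h

/-- The base point of the spectral decomposition. -/
def base (ε R : ℝ) (k : Sp d) : Sp d := p.κ + ε • cut R k

/-- The eigenvalues of `bSym ε R 1`. -/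
def ev (ε R : ℝ) (l : Fin n) (k : Sp d) : ℂ :=
  ((ε⁻¹ : ℝ) : ℂ) * (Complex.I * ((p.w l (p.base ε R k) - p.ω : ℝ) : ℂ))

lemma measurable_base (ε R : ℝ) : Measurable (p.base ε R) :=
  ((measurable_cut R).const_smul ε).const_add p.κ

/-- As A is linear in the frequency, the symbol equals (i/ε)(𝓛(0, κ + εk) - ω) with k truncated. It
is therefore diagonal in the given eigenbasis at the base point. -/
lemma bSym_apply {ε : ℝ} (hε : 0 < ε) (R : ℝ) (l : Fin n) (k : Sp d) :
    p.bSym ε R 1 k (p.ψ l (p.base ε R k)) = p.ev ε R l k • p.ψ l (p.base ε R k) := by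
  have h1 : p.bSym ε R 1 k = ((ε⁻¹ : ℝ) : ℂ) • Complex.I •
      (cl (symbolL p.A p.E 0 (p.base ε R k)) - (p.ω : ℂ) • (1 : End n)) := by
    have h2 : symbolA p.A (cut R k) = ((ε⁻¹ : ℝ) : ℂ) • symbolA p.A (ε • cut R k) := by
      rw [← symbolA_smul, smul_smul, inv_mul_cancel₀ hε.ne', one_smul]
    have h3 : cl (symbolL p.A p.E p.ω (p.base ε R k)) =
        cl (symbolL p.A p.E 0 (p.base ε R k)) - (p.ω : ℂ) • (1 : End n) := by
      rw [symbolL_eq, map_sub, map_smul, map_one]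
    rw [← h3, base, symbolL_add, bSym, L_one, aSym, clA_apply, h2, map_smul, map_add, smul_add,
      smul_add, smul_comm Complex.I]
  rw [h1]
  simp only [_root_.smul_apply, _root_.sub_apply, cl_apply, p.eig.eigen, ev, mul_smul]
  rw [Complex.ofReal_sub, sub_smul]
  rfl

lemma orthonormal (β : Sp d) : Orthonormal ℂ fun l => p.ψ l β := p.eig.orthonormal β

lemma norm_rk_psi_le (l : Fin n) (β : Sp d) : ‖rk (p.ψ l β)‖ ≤ 1 := by
  refine (norm_rk_le _).trans ?_
  rw [(p.orthonormal β).1 l, mul_one]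

/-- The eigenvectors are continuous only away from frequency 0. One exceptional point does not
affect measurability, and measurability is all a multiplier requires. -/
lemma stronglyMeasurable_rk (ε R : ℝ) (l : Fin n) :
    StronglyMeasurable fun k => rk (p.ψ l (p.base ε R k)) := by
  have h : Measurable (p.ψ l) :=
    measurable_of_continuousOn_compl_singleton 0 (p.eig.smooth_ψ l).continuousOn
  exact continuous_rk.comp_stronglyMeasurable (h.comp (p.measurable_base ε R)).stronglyMeasurable

lemma exists_lipschitz : ∃ C : ℝ, 0 ≤ C ∧ ∀ l β β', |p.w l β' - p.w l β| ≤ C * ‖β' - β‖ := by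
  obtain ⟨C, hC⟩ := p.eig.lipschitz
  refine ⟨|C| * d, by positivity, fun l β β' => (hC l β β').trans ?_⟩
  calc C * ∑ i, |β' i - β i| ≤ |C| * ∑ _i : Fin d, ‖β' - β‖ := by
        refine mul_le_mul (le_abs_self C) (Finset.sum_le_sum fun i _ => ?_)
          (Finset.sum_nonneg fun _ _ => abs_nonneg _) (abs_nonneg _)
        exact PiLp.norm_apply_le (β' - β) i
    _ = |C| * d * ‖β' - β‖ := by simp [mul_assoc]

lemma continuous_w (l : Fin n) : Continuous (p.w l) := by
  obtain ⟨C, hC, h⟩ := p.exists_lipschitz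
  refine (LipschitzWith.of_dist_le_mul (K := ⟨C, hC⟩) fun β' β => ?_).continuous
  rw [Real.dist_eq, dist_eq_norm]
  exact h l β β'

lemma measurable_ev (ε R : ℝ) (l : Fin n) : Measurable (p.ev ε R l) := by
  have h := (p.continuous_w l).measurable.comp (p.measurable_base ε R)
  have : Measurable fun k => ((p.w l (p.base ε R k) - p.ω : ℝ) : ℂ) :=
    Complex.measurable_ofReal.comp (h.sub_const _)
  exact (this.const_mul _).const_mul _

/-- The constant in the gap condition. -/
lemma exists_gap : ∃ c : ℝ, 0 < c ∧ ∀ β, ∀ l, l ≠ 0 → c ≤ |p.w l β - p.ω| := by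
  obtain ⟨c, hc, h⟩ := p.eig.gap
  exact ⟨c, hc, fun β l hl => by rw [abs_sub_comm]; exact h β l hl⟩

/-- This is where the factor 1/ε cancels: since `w_1(κ) = ω`, Lipschitz continuity bounds |w_1(κ +
εk) - ω| by Cε|k|. -/
lemma norm_ev_zero_le : ∃ C : ℝ, 0 ≤ C ∧ ∀ ε R k, 0 < ε → ‖p.ev ε R 0 k‖ ≤ C * ‖cut R k‖ := by
  obtain ⟨C, hC, h⟩ := p.exists_lipschitz
  refine ⟨C, hC, fun ε R k hε => ?_⟩
  have h1 := h 0 p.κ (p.base ε R k)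
  rw [p.eig.first, base, add_sub_cancel_left, norm_smul, Real.norm_of_nonneg hε.le] at h1
  rw [ev, norm_mul, norm_mul, Complex.norm_I, one_mul, Complex.norm_real, Complex.norm_real,
    Real.norm_of_nonneg (inv_nonneg.2 hε.le), Real.norm_eq_abs, base]
  calc ε⁻¹ * |p.w 0 (p.κ + ε • cut R k) - p.ω| ≤ ε⁻¹ * (C * (ε * ‖cut R k‖)) := by gcongr
    _ = C * ‖cut R k‖ := by field_simp

/-- The spectral projection on the first eigenvector. -/
def pSym (ε R : ℝ) (k : Sp d) : End n := rk (p.ψ 0 (p.base ε R k))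

/-- The first eigenvalue. -/
def lSym (ε R : ℝ) (k : Sp d) : End n := p.ev ε R 0 k • (1 : End n)

/-- The partial inverse. -/
def kSym (ε R : ℝ) (k : Sp d) : End n :=
  ∑ l ∈ Finset.univ.erase 0, ((ε⁻¹ : ℝ) : ℂ) • (p.ev ε R l k)⁻¹ • rk (p.ψ l (p.base ε R k))

lemma isMultiplier_pSym (ε R : ℝ) : IsMultiplier (p.pSym ε R) :=
  ⟨p.stronglyMeasurable_rk ε R 0, 1, fun _ => p.norm_rk_psi_le 0 _⟩

lemma isMultiplier_lSym {ε R : ℝ} (hε : 0 < ε) (hR : 0 ≤ R) : IsMultiplier (p.lSym ε R) := by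
  obtain ⟨C, hC, h⟩ := p.norm_ev_zero_le
  refine ⟨(p.measurable_ev ε R 0).stronglyMeasurable.smul_const 1, C * R * 1, fun k => ?_⟩
  rw [lSym, norm_smul]
  exact mul_le_mul ((h ε R k hε).trans (mul_le_mul_of_nonneg_left (norm_cut_le hR k) hC))
    ContinuousLinearMap.norm_id_le (norm_nonneg _) (by positivity)

/-- The factor ε⁻¹ cancels against the size |w_l - ω|/ε of the eigenvalues, leaving 1/|w_l - ω|,
which the gap condition bounds for all frequencies. -/
lemma exists_norm_kSym_le : ∃ C : ℝ, 0 ≤ C ∧ ∀ ε R k, 0 < ε → ‖p.kSym ε R k‖ ≤ C := by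
  obtain ⟨c, hc, h⟩ := p.exists_gap
  refine ⟨∑ l ∈ Finset.univ.erase (0 : Fin n), c⁻¹, by positivity, fun ε R k hε => ?_⟩
  refine norm_sum_le_of_le _ fun l hl => ?_
  have hg := h (p.base ε R k) l (Finset.ne_of_mem_erase hl)
  rw [norm_smul, norm_smul, norm_inv, ev, norm_mul, norm_mul, Complex.norm_I, one_mul,
    Complex.norm_real, Complex.norm_real, Real.norm_of_nonneg (inv_nonneg.2 hε.le),
    Real.norm_eq_abs, mul_inv, inv_inv]
  calc ε⁻¹ * (ε * |p.w l (p.base ε R k) - p.ω|⁻¹ * ‖rk (p.ψ l (p.base ε R k))‖)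
      = |p.w l (p.base ε R k) - p.ω|⁻¹ * ‖rk (p.ψ l (p.base ε R k))‖ := by field_simp
    _ ≤ c⁻¹ * 1 := mul_le_mul (inv_anti₀ hc hg) (p.norm_rk_psi_le l _) (norm_nonneg _)
        (inv_nonneg.2 hc.le)
    _ = c⁻¹ := mul_one _

lemma isMultiplier_kSym {ε : ℝ} (hε : 0 < ε) (R : ℝ) : IsMultiplier (p.kSym ε R) := by
  obtain ⟨C, -, h⟩ := p.exists_norm_kSym_le
  refine ⟨?_, C, fun k => h ε R k hε⟩
  refine Finset.stronglyMeasurable_fun_sum _ fun l _ => ?_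
  have h1 : StronglyMeasurable fun k => (p.ev ε R l k)⁻¹ • rk (p.ψ l (p.base ε R k)) :=
    (p.measurable_ev ε R l).inv.stronglyMeasurable.smul (p.stronglyMeasurable_rk ε R l)
  exact h1.const_smul ((ε⁻¹ : ℝ) : ℂ)

lemma ev_ne_zero {ε : ℝ} (hε : 0 < ε) (R : ℝ) (k : Sp d) {l : Fin n} (hl : l ≠ 0) :
    p.ev ε R l k ≠ 0 := by
  obtain ⟨c, hc, h⟩ := p.exists_gap
  have h1 : p.w l (p.base ε R k) - p.ω ≠ 0 := by
    intro h0
    have := h (p.base ε R k) l hl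
    rw [h0, abs_zero] at this
    linarith
  have h2 : ((ε⁻¹ : ℝ) : ℂ) ≠ 0 := Complex.ofReal_ne_zero.2 (inv_ne_zero hε.ne')
  exact mul_ne_zero h2 (mul_ne_zero Complex.I_ne_zero (Complex.ofReal_ne_zero.2 h1))

lemma bSym_mul_pSym {ε : ℝ} (hε : 0 < ε) (R : ℝ) (k : Sp d) :
    p.bSym ε R 1 k * p.pSym ε R k = p.lSym ε R k * p.pSym ε R k := by
  rw [lSym, smul_mul_assoc, one_mul]
  exact mul_rk (p.bSym_apply hε R 0 k)

lemma pSym_mul_bSym {ε : ℝ} (hε : 0 < ε) (R : ℝ) (k : Sp d) :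
    p.pSym ε R k * p.bSym ε R 1 k = p.lSym ε R k * p.pSym ε R k := by
  rw [lSym, smul_mul_assoc, one_mul]
  exact rk_mul (p.orthonormal _) (fun l => p.bSym_apply hε R l k) 0

lemma sum_erase_rk (ε R : ℝ) (k : Sp d) :
    ∑ l ∈ Finset.univ.erase 0, rk (p.ψ l (p.base ε R k)) = 1 - p.pSym ε R k := by
  rw [← sum_rk (p.orthonormal (p.base ε R k)), ← Finset.add_sum_erase _ _ (Finset.mem_univ 0), pSym,
    add_sub_cancel_left]

lemma bSym_mul_kSym {ε : ℝ} (hε : 0 < ε) (R : ℝ) (k : Sp d) :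
    p.bSym ε R 1 k * p.kSym ε R k = ((ε⁻¹ : ℝ) : ℂ) • (1 - p.pSym ε R k) := by
  rw [kSym, Finset.mul_sum, ← p.sum_erase_rk, Finset.smul_sum]
  refine Finset.sum_congr rfl fun l hl => ?_
  rw [mul_smul_comm, mul_smul_comm, mul_rk (p.bSym_apply hε R l k), smul_smul (p.ev ε R l k)⁻¹,
    inv_mul_cancel₀ (p.ev_ne_zero hε R k (Finset.ne_of_mem_erase hl)), one_smul]

lemma kSym_mul_bSym {ε : ℝ} (hε : 0 < ε) (R : ℝ) (k : Sp d) :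
    p.kSym ε R k * p.bSym ε R 1 k = ((ε⁻¹ : ℝ) : ℂ) • (1 - p.pSym ε R k) := by
  rw [kSym, Finset.sum_mul, ← p.sum_erase_rk, Finset.smul_sum]
  refine Finset.sum_congr rfl fun l hl => ?_
  rw [smul_mul_assoc, smul_mul_assoc, rk_mul (p.orthonormal _) (fun l => p.bSym_apply hε R l k),
    smul_smul (p.ev ε R l k)⁻¹,
    inv_mul_cancel₀ (p.ev_ne_zero hε R k (Finset.ne_of_mem_erase hl)), one_smul]

end Problem

/-! ### ### Families of parameters and the frame of truncated weights -/

/-- The truncation radius. -/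
def rad (ε : ℝ) : ℝ := (ε ^ 4)⁻¹

lemma rad_pos {ε : ℝ} (hε : 0 < ε) : 0 < rad ε := by unfold rad; positivity

/-- A family of small parameters. -/
structure Params (ι : Type*) where
  ε : ι → ℝ
  pos : ∀ i, 0 < ε i
  le_one : ∀ i, ε i ≤ 1

section

variable {ι : Type*} (q : Params ι)

/-- The truncation radii. -/
def Params.R (i : ι) : ℝ := rad (q.ε i)

lemma Params.R_pos (i : ι) : 0 < q.R i := rad_pos (q.pos i)

variable (d n) in
/-- The frame of truncated weights. -/
def Params.frame : Frame ι (FL d n) where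
  ε := q.ε
  W i := (weightOp (q.R i)).restrictScalars ℝ
  pos := q.pos
  le_one := q.le_one
  norm_le i v := norm_le_norm_weightOp (q.R_pos i).le v

lemma Params.frame_N (i : ι) (s : ℕ) (v : FL d n) : (q.frame d n).N i s v = wnorm (q.R i) s v := by
  have h : ∀ s, (((weightOp (q.R i)).restrictScalars ℝ : FL d n →L[ℝ] FL d n) ^ s) v
      = ((weightOp (q.R i)) ^ s) v := by
    intro s
    induction s with
    | zero => rfl
    | succ s ih =>
      rw [pow_succ', pow_succ']
      exact congrArg (weightOp (q.R i)) ih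
  exact congrArg norm (h s)

lemma Params.bdd_mulOp {m : ι → Sp d → End n} (hm : ∀ i, IsMultiplier (m i)) {c : ℝ} (hc0 : 0 ≤ c)
    (hc : ∀ i k, ‖m i k‖ ≤ c) :
    (q.frame d n).Bdd fun i => ((mulOp (m i)).restrictScalars ℝ : FL d n →L[ℝ] FL d n) :=
  ⟨c, hc0, fun i s v => by
    rw [q.frame_N, q.frame_N]
    exact wnorm_mulOp_le (q.R_pos i).le s (hm i) (hc i) v⟩

lemma Params.loses_mulOp {m : ι → Sp d → End n} (hm : ∀ i, IsMultiplier (m i)) {c : ℝ} (hc0 : 0 ≤ c)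
    (hc : ∀ i k, ‖m i k‖ ≤ c * ‖cut (q.R i) k‖) :
    (q.frame d n).Loses fun i => ((mulOp (m i)).restrictScalars ℝ : FL d n →L[ℝ] FL d n) :=
  ⟨c, hc0, fun i s v => by
    rw [q.frame_N, q.frame_N]
    refine wnorm_mulOp_le_succ (q.R_pos i).le s (hm i) (Eventually.of_forall fun k => ?_)
    refine (m i k).le_of_opNorm_le ((hc i k).trans ?_) _
    exact mul_le_mul_of_nonneg_left (norm_cut_le_wt (q.R_pos i).le k) hc0⟩

set_option maxHeartbeats 1000000 in
lemma Params.triBdd_tri (Θ : Tri n) : (q.frame d n).TriBdd (triR (tri (d := d) Θ)) :=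
  ⟨fourierConst d ^ 2 * ‖Θ‖, by positivity, fun i s a b c => by
    rw [q.frame_N, q.frame_N, q.frame_N, q.frame_N, triR_apply]
    exact wnorm_tri_le (q.R_pos i).le s Θ a b c⟩

end

lemma isUnit_I_smul {M : End n} (h : IsUnit M) : IsUnit (Complex.I • M) :=
  (isUnit_smul_iff (Units.mk0 Complex.I Complex.I_ne_zero) M).2 h

/-- A constant matrix as a real-linear operator on `FL`. -/
def cst (M : End n) : FL d n →L[ℝ] FL d n := (mulOp fun _ => M).restrictScalars ℝ

lemma cst_inverse {M : End n} (h : IsUnit M) (v : FL d n) : cst M (cst (Ring.inverse M) v) = v := by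
  have := mulOp_mulOp (isMultiplier_const (d := d) M) (isMultiplier_const (Ring.inverse M)) v
  simp only [Ring.mul_inverse_cancel _ h, mulOp_one] at this
  exact this

-- Constant matrices and `tri` both act pointwise after the inverse transform, so an algebraic
-- identity on ℂ^n passes to `FL` by injectivity.
set_option maxHeartbeats 1000000 in
lemma cst_tri {L L' : End n} {Θ Ts : Tri n} (h : ∀ a b c, L (Θ a b c) = Θ (L' a) b c + Ts a b c)
    (a b c : FL d n) : cst L (triR (tri (d := d) Θ) a b c)
      = triR (tri (d := d) Θ) (cst L' a) b c + triR (tri (d := d) Ts) a b c := by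
  apply ev_injective
  intro x
  simp only [triR_apply]
  rw [map_add]
  change NLDispersive.ev x (mulOp (fun _ => L) _)
    = NLDispersive.ev x (tri (d := d) Θ (mulOp (fun _ => L') a) b c) + _
  rw [ev_mulOp_const, ev_tri, ev_tri, ev_tri, ev_mulOp_const, h]

/-! ### ### The envelope problem as a wave system -/

namespace Problem

variable [NeZero n] (p : Problem d n)

/-- The nonlinearity. -/
def tT : Tri n := mkTri (extT p.T) (isTrilinear_extT p.T)

/-- The symmetrized nonlinearity. -/
def tTs : Tri n := mkTri _ (isTrilinear_symm p.tT)

lemma exists_Θ₃ : ∃ Θ : Tri n, ∀ a b c, p.L 3 (Θ a b c) = Θ (p.L 1 a) b c + p.tTs a b c := by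
  rw [L_one]
  exact exists_sylvester p.res₃.2 p.tTs

lemma exists_Θ₅ : ∃ Θ : Tri n, ∀ a b c, p.L 5 (Θ a b c) = Θ (p.L 3 a) b c + p.tTs a b c :=
  exists_sylvester p.res₅.2 p.tTs

lemma isUnit_L_three : IsUnit (p.L 3) := by
  have h := (p.res₃.1.map (cl (n := n)))
  exact isUnit_I_smul h

lemma isUnit_L_five : IsUnit (p.L 5) :=
  isUnit_I_smul (p.res₅.1.map (cl (n := n)))

variable {ι : Type*} (q : Params ι)

/-- The truncated operator `ε⁻¹ i 𝓛(jω, jκ) + A(∂)`. -/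
def gen (j : ℝ) (i : ι) : FL d n →L[ℝ] FL d n :=
  (mulOp (p.bSym (q.ε i) (q.R i) j)).restrictScalars ℝ

lemma gen_apply (j : ℝ) (i : ι) (v : FL d n) : p.gen q j i v =
    (q.ε i)⁻¹ • cst (p.L j) v + (mulOp (p.aSym (q.R i))).restrictScalars ℝ v :=
  p.mulOp_bSym (q.R_pos i).le _ _ v

/-- The group generated by `-gen`. -/
def grp (j : ℝ) (i : ι) (t : ℝ) : FL d n →L[ℝ] FL d n :=
  (sg (p.bSym (q.ε i) (q.R i) j) t).restrictScalars ℝ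

lemma isGroup (j : ℝ) (i : ι) : IsGroup (p.gen q j i) (p.grp q j i) :=
  isGroup_sg (p.isSkew_bSym (q.R_pos i).le _ _) (p.isMultiplier_bSym (q.R_pos i).le _ _)

lemma N_grp_le (j : ℝ) (i : ι) (s : ℕ) (t : ℝ) (v : FL d n) :
    (q.frame d n).N i s (p.grp q j i t v) ≤ (q.frame d n).N i s v := by
  rw [q.frame_N, q.frame_N]
  exact wnorm_sg_le (p.isSkew_bSym (q.R_pos i).le _ _) (q.R_pos i).le s t v

lemma dissipative (j : ℝ) : (q.frame d n).Dissipative fun i v =>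
    (q.ε i)⁻¹ • cst (p.L j) v + (mulOp (p.aSym (q.R i))).restrictScalars ℝ v := by
  have h := Frame.dissipative_of_isGroup (F := q.frame d n) (fun i => p.isGroup q j i)
    (fun i s t v => p.N_grp_le q j i s t v)
  simp only [gen_apply] at h
  exact h

lemma mulOp_bSym_mulOp {ε : ℝ} {R : ℝ} (hR : 0 ≤ R) {m : Sp d → End n} (hm : IsMultiplier m)
    (v : FL d n) : ε⁻¹ • cst (p.L 1) (mulOp m v) + mulOp (p.aSym R) (mulOp m v)
      = mulOp (fun k => p.bSym ε R 1 k * m k) v := by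
  rw [← mulOp_mulOp (p.isMultiplier_bSym hR _ _) hm, mulOp_bSym p hR]
  rfl

lemma mulOp_mulOp_bSym {ε : ℝ} {R : ℝ} (hR : 0 ≤ R) {m : Sp d → End n} (hm : IsMultiplier m)
    (v : FL d n) : mulOp m (ε⁻¹ • cst (p.L 1) v + mulOp (p.aSym R) v)
      = mulOp (fun k => m k * p.bSym ε R 1 k) v := by
  rw [← mulOp_mulOp hm (p.isMultiplier_bSym hR _ _), mulOp_bSym p hR]
  rfl

lemma mulOp_compl {ε R : ℝ} (v : FL d n) :
    mulOp (fun k => ((ε⁻¹ : ℝ) : ℂ) • (1 - p.pSym ε R k)) v = ε⁻¹ • (v - mulOp (p.pSym ε R) v) := by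
  have h1 := (p.isMultiplier_pSym ε R).smul (-1)
  have h2 : (fun k => ((ε⁻¹ : ℝ) : ℂ) • (1 - p.pSym ε R k)) =
      fun k => ((ε⁻¹ : ℝ) : ℂ) • ((1 : End n) + (-1 : ℂ) • p.pSym ε R k) := by
    funext k; rw [neg_one_smul, sub_eq_add_neg]
  rw [h2, mulOp_smul ((isMultiplier_const 1).add h1), mulOp_add (isMultiplier_const 1) h1,
    mulOp_smul (p.isMultiplier_pSym ε R), mulOp_one, neg_one_smul, ← sub_eq_add_neg]
  rfl

/-- The partial inverse, on the other side. -/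
lemma kSym_gen {ε : ℝ} (hε : 0 < ε) {R : ℝ} (hR : 0 ≤ R) (v : FL d n) :
    mulOp (p.kSym ε R) (ε⁻¹ • cst (p.L 1) v + mulOp (p.aSym R) v)
      = ε⁻¹ • (v - mulOp (p.pSym ε R) v) := by
  rw [p.mulOp_mulOp_bSym hR (p.isMultiplier_kSym hε R)]
  simp only [p.kSym_mul_bSym hε]
  exact p.mulOp_compl v

lemma gen_kSym {ε : ℝ} (hε : 0 < ε) {R : ℝ} (hR : 0 ≤ R) (v : FL d n) :
    ε⁻¹ • cst (p.L 1) (mulOp (p.kSym ε R) v) + mulOp (p.aSym R) (mulOp (p.kSym ε R) v)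
      = ε⁻¹ • (v - mulOp (p.pSym ε R) v) := by
  rw [p.mulOp_bSym_mulOp hR (p.isMultiplier_kSym hε R)]
  simp only [p.bSym_mul_kSym hε]
  exact p.mulOp_compl v

lemma pSym_gen {ε : ℝ} (hε : 0 < ε) {R : ℝ} (hR : 0 ≤ R) (v : FL d n) :
    mulOp (p.pSym ε R) (ε⁻¹ • cst (p.L 1) v + mulOp (p.aSym R) v)
      = mulOp (p.lSym ε R) (mulOp (p.pSym ε R) v) := by
  rw [p.mulOp_mulOp_bSym hR (p.isMultiplier_pSym ε R),
    mulOp_mulOp (p.isMultiplier_lSym hε hR) (p.isMultiplier_pSym ε R)]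
  simp only [p.pSym_mul_bSym hε]

lemma gen_pSym {ε : ℝ} (hε : 0 < ε) {R : ℝ} (hR : 0 ≤ R) (v : FL d n) :
    ε⁻¹ • cst (p.L 1) (mulOp (p.pSym ε R) v) + mulOp (p.aSym R) (mulOp (p.pSym ε R) v)
      = mulOp (p.lSym ε R) (mulOp (p.pSym ε R) v) := by
  rw [p.mulOp_bSym_mulOp hR (p.isMultiplier_pSym ε R),
    mulOp_mulOp (p.isMultiplier_lSym hε hR) (p.isMultiplier_pSym ε R)]
  simp only [p.bSym_mul_pSym hε]

set_option maxHeartbeats 2000000 in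
/-- The wave system associated with the envelope problem. -/
def system : WaveSystem (q.frame d n) where
  A i := (mulOp (p.aSym (q.R i))).restrictScalars ℝ
  P i := (mulOp (p.pSym (q.ε i) (q.R i))).restrictScalars ℝ
  K i := (mulOp (p.kSym (q.ε i) (q.R i))).restrictScalars ℝ
  Λ i := (mulOp (p.lSym (q.ε i) (q.R i))).restrictScalars ℝ
  L₁ := cst (p.L 1)
  L₃ := cst (p.L 3)
  L₅ := cst (p.L 5)
  R₃ := cst (Ring.inverse (p.L 3))
  R₅ := cst (Ring.inverse (p.L 5))
  conj := conjOp
  T := triR (tri (d := d) p.tT)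
  Ts := triR (tri (d := d) p.tTs)
  Θ := triR (tri (d := d) p.exists_Θ₃.choose)
  Θ' := triR (tri (d := d) p.exists_Θ₅.choose)
  loses_A := q.loses_mulOp (fun i => p.isMultiplier_aSym (q.R_pos i).le) (norm_nonneg _)
    fun i k => p.norm_aSym_le _ k
  loses_Λ := by
    obtain ⟨C, hC, h⟩ := p.norm_ev_zero_le
    refine q.loses_mulOp (fun i => p.isMultiplier_lSym (q.pos i) (q.R_pos i).le) hC fun i k => ?_
    rw [lSym, norm_smul]
    exact (mul_le_of_le_one_right (norm_nonneg _) ContinuousLinearMap.norm_id_le).trans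
      (h _ _ k (q.pos i))
  bdd_P := q.bdd_mulOp (fun i => p.isMultiplier_pSym _ _) zero_le_one
    fun i k => p.norm_rk_psi_le 0 _
  bdd_K := by
    obtain ⟨C, hC, h⟩ := p.exists_norm_kSym_le
    exact q.bdd_mulOp (fun i => p.isMultiplier_kSym (q.pos i) _) hC fun i k => h _ _ k (q.pos i)
  bdd_R₃ := q.bdd_mulOp (fun _ => isMultiplier_const _) (norm_nonneg _) fun _ _ => le_rfl
  bdd_R₅ := q.bdd_mulOp (fun _ => isMultiplier_const _) (norm_nonneg _) fun _ _ => le_rfl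
  bdd_conj := ⟨1, zero_le_one, fun i s v => by
    rw [q.frame_N, q.frame_N, wnorm_conjOp (q.R_pos i).le, one_mul]⟩
  triBdd_T := q.triBdd_tri _
  triBdd_Ts := q.triBdd_tri _
  triBdd_Θ := q.triBdd_tri _
  triBdd_Θ' := q.triBdd_tri _
  Ts_apply a b c := by
    apply ev_injective
    intro x
    simp only [triR_apply, map_add, ev_tri]
    rfl
  L₃_R₃ := cst_inverse p.isUnit_L_three
  L₅_R₅ := cst_inverse p.isUnit_L_five
  sylvester := cst_tri p.exists_Θ₃.choose_spec
  sylvester' := cst_tri p.exists_Θ₅.choose_spec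
  P_comm i v := p.pSym_gen (q.pos i) (q.R_pos i).le v
  P_eigen i v := p.gen_pSym (q.pos i) (q.R_pos i).le v
  K_inv i v := p.gen_kSym (q.pos i) (q.R_pos i).le v
  diss₁ := p.dissipative q 1
  diss₃ := p.dissipative q 3
  diss₅ := p.dissipative q 5

end Problem

/-! ### From functions in the Wiener algebra to their Fourier transforms -/

lemma ContinuousInW.exists_lift {τ : ℝ} {v : ℝ → Sp d → Vec n} (h : ContinuousInW τ v) :
    ∃ V : ℝ → FL d n, (∀ t ∈ Icc 0 τ, ∀ x, v t x = ev x (V t)) ∧ ContinuousOn V (Icc 0 τ) := by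
  have h1 : ∀ t, ∃ V : FL d n, t ∈ Icc 0 τ → ∀ x, v t x = ev x V := by
    intro t
    by_cases ht : t ∈ Icc 0 τ
    · obtain ⟨V, hV⟩ := (h.1 t ht).exists_ev
      exact ⟨V, fun _ => hV⟩
    · exact ⟨0, fun h => absurd h ht⟩
  choose V hV using h1
  refine ⟨V, hV, fun t ht => ?_⟩
  rw [ContinuousWithinAt, tendsto_iff_norm_sub_tendsto_zero]
  have h2 := h.2 t ht
  have h3 : Tendsto (fun s => ENNReal.ofReal ‖V s - V t‖) (𝓝[Icc 0 τ] t) (𝓝 0) := by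
    refine h2.congr' ?_
    filter_upwards [self_mem_nhdsWithin] with s hs
    rw [← normW_ev]
    congr 1
    funext x
    rw [hV s hs, hV t ht, map_sub]
  have h4 := (ENNReal.tendsto_toReal ENNReal.zero_ne_top).comp h3
  simpa [Function.comp_def, ENNReal.toReal_ofReal (norm_nonneg _)] using h4

lemma propagator_ev {A : Fin d → Matrix (Fin n) (Fin n) ℝ} {B : Matrix (Fin n) (Fin n) ℂ}
    {b : Sp d → End n} (hb : IsSkew b) (hB : ∀ k, b k = cl (B + Complex.I • symbolA A k)) (t : ℝ)
    {f : Sp d → Vec n} {v : FL d n} (hf : ∀ x, f x = ev x v) (x : Sp d) :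
    propagator A B t f x = ev x (sg b t v) := by
  obtain rfl : f = fun x => ev x v := funext hf
  rw [ev_apply, propagator]
  apply invFourier_congr
  filter_upwards [hat_ev v, mulOp_ae (hb.isMultiplier t) v] with k h1 h2
  rw [h1, sg, h2, hB, ← cl_apply, cl_exp, map_neg, map_smul]

/-- Duhamel's formula is assumed pointwise in x. Point evaluation is a bounded functional and
commutes with the integral in `L¹`, so injectivity of the family of evaluations lifts the identity
to `L¹`. -/
lemma IsMild.duhamel {A : Fin d → Matrix (Fin n) (Fin n) ℝ} {B : Matrix (Fin n) (Fin n) ℂ}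
    {v₀ : Sp d → Vec n} {F : ℝ → Sp d → Vec n} {τ : ℝ} {v : ℝ → Sp d → Vec n}
    (h : IsMild A B v₀ F τ v) {b : Sp d → End n} (hb : IsSkew b)
    (hB : ∀ k, b k = cl (B + Complex.I • symbolA A k)) {V₀ : FL d n} (hV₀ : ∀ x, v₀ x = ev x V₀)
    {V G : ℝ → FL d n} (hV : ∀ t ∈ Icc 0 τ, ∀ x, v t x = ev x (V t))
    (hG : ∀ t ∈ Icc 0 τ, ∀ x, F t x = ev x (G t)) (hGc : ContinuousOn G (Icc 0 τ)) {t : ℝ}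
    (ht : t ∈ Icc 0 τ) : V t = sg b t V₀ + ∫ s in (0 : ℝ)..t, sg b (t - s) (G s) := by
  apply ev_injective
  intro x
  have hsub : uIcc 0 t ⊆ Icc 0 τ := by
    rw [uIcc_of_le ht.1]
    exact Icc_subset_Icc le_rfl ht.2
  have hi : IntervalIntegrable (fun s => sg b (t - s) (G s)) volume 0 t :=
    ((continuousOn_sg_apply hb hGc t).mono hsub).intervalIntegrable
  rw [← hV t ht, h.2 t ht, map_add, propagator_ev hb hB t hV₀]
  congr 1
  have h1 := (ev (n := n) x).intervalIntegral_comp_comm hi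
  rw [← h1]
  refine intervalIntegral.integral_congr fun s hs => ?_
  exact propagator_ev hb hB (t - s) (hG s (hsub hs)) x

lemma MemWs.of_succ {s : ℕ} : ∀ {f : Sp d → Vec n}, MemWs (s + 1) f → MemWs s f := by
  induction s with
  | zero => intro f h; exact h.1
  | succ s ih =>
    intro f h
    exact ⟨h.1, fun l => by
      obtain ⟨g, hg, hg2⟩ := h.2 l
      exact ⟨g, hg, ih hg2⟩⟩

lemma norm_le_sum_coord (k : Sp d) : ‖k‖ ≤ ∑ l, |k l| := by
  have h : k = ∑ l, k l • EuclideanSpace.single l (1 : ℝ) := by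
    ext i
    simp [Finset.sum_apply, Pi.single_apply]
  calc ‖k‖ = ‖∑ l, k l • EuclideanSpace.single l (1 : ℝ)‖ := by rw [← h]
    _ ≤ ∑ l, |k l| := norm_sum_le_of_le _ fun l _ => by simp [norm_smul]

/-- Induction on the regularity, using that the weight is at most 1 + ∑|k_l| and that ∂_l multiplies
the transform by i k_l. The constants do not depend on the truncation R, so they hold uniformly in
ε. -/
lemma MemWs.exists_lift {s : ℕ} : ∀ {f : Sp d → Vec n}, MemWs s f →
    ∃ v : FL d n, (∀ x, f x = ev x v) ∧ ∃ C, 0 ≤ C ∧ ∀ R, 0 ≤ R → wnorm R s v ≤ C := by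
  induction s with
  | zero =>
    intro f h
    obtain ⟨v, hv⟩ := MemW.exists_ev h
    exact ⟨v, hv, ‖v‖, norm_nonneg _, fun R _ => by simp [wnorm]⟩
  | succ s ih =>
    intro f h
    obtain ⟨v, hv, C, hC, hb⟩ := ih h.of_succ
    have h1 : ∀ l, ∃ w : FL d n, (∀ᵐ k, w k = (Complex.I * ((k l : ℝ) : ℂ)) • v k) ∧
        ∃ C, 0 ≤ C ∧ ∀ R, 0 ≤ R → wnorm R s w ≤ C := by
      intro l
      obtain ⟨g, hg, hg2⟩ := h.2 l
      obtain ⟨w, hw, hw2⟩ := ih hg2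
      obtain rfl : f = fun x => ev x v := funext hv
      obtain rfl : g = fun x => ev x w := funext hw
      exact ⟨w, isPartial_fourier hg, hw2⟩
    choose w hw D hD hwD using h1
    refine ⟨v, hv, C + ∑ l, D l, add_nonneg hC (Finset.sum_nonneg fun l _ => hD l), fun R hR => ?_⟩
    have h2 : wnorm R (s + 1) v ≤ wnorm R s v + ∑ l, wnorm R s (w l) := by
      simp only [wnorm_eq hR]
      rw [← integral_finsetSum _ fun l _ => integrable_wnorm hR s (w l),
        ← integral_add (integrable_wnorm hR s v)
          (integrable_finsetSum _ fun l _ => integrable_wnorm hR s (w l))]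
      refine integral_mono_ae (integrable_wnorm hR _ v) ((integrable_wnorm hR s v).add
          (integrable_finsetSum _ fun l _ => integrable_wnorm hR s (w l))) ?_
      filter_upwards [ae_all_iff.2 hw] with k hk
      have e1 : ∀ l, ‖w l k‖ = |k l| * ‖v k‖ := fun l => by
        rw [hk l, norm_smul, norm_mul, Complex.norm_I, one_mul, Complex.norm_real,
          Real.norm_eq_abs]
      have e2 : wt R k ≤ 1 + ∑ l, |k l| :=
        (min_le_left _ _).trans (by linarith [norm_le_sum_coord k])
      have e3 : 0 ≤ wt R k ^ s * ‖v k‖ := mul_nonneg (pow_nonneg (wt_nonneg hR k) s) (norm_nonneg _)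
      simp only [e1]
      calc wt R k ^ (s + 1) * ‖v k‖ = wt R k * (wt R k ^ s * ‖v k‖) := by ring
        _ ≤ (1 + ∑ l, |k l|) * (wt R k ^ s * ‖v k‖) := mul_le_mul_of_nonneg_right e2 e3
        _ = wt R k ^ s * ‖v k‖ + ∑ l, wt R k ^ s * (|k l| * ‖v k‖) := by
          rw [add_mul, one_mul, Finset.sum_mul]
          congr 1
          exact Finset.sum_congr rfl fun l _ => by ring
    exact h2.trans (add_le_add (hb R hR) (Finset.sum_le_sum fun l _ => hwD l R hR))

lemma continuous_ev (v : FL d n) : Continuous fun x => ev x v := by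
  simp only [ev_apply, invFourier]
  have h : Continuous fun x : Sp d =>
      ∫ k, Complex.exp (Complex.I * ((inner ℝ k x : ℝ) : ℂ)) • v k := by
    refine continuous_of_dominated (bound := fun k => ‖v k‖)
      (fun x => (integrable_exp_smul (L1.integrable_coeFn v) x).aestronglyMeasurable)
      (fun x => Eventually.of_forall fun k => ?_) (L1.integrable_coeFn v).norm
      (Eventually.of_forall fun k => by fun_prop)
    rw [norm_smul, mul_comm Complex.I, Complex.norm_exp_ofReal_mul_I, one_mul]
  exact h.const_smul ((((2 * Real.pi) ^ (-(d : ℝ) / 2) : ℝ)) : ℂ)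

/-- An inverse transform of an `L¹` function is continuous, so a relation holding almost everywhere
holds everywhere; injectivity then applies. -/
lemma mulOp_const_eq_zero {M : End n} {v : FL d n} (h : ∀ᵐ x, M (ev x v) = 0) :
    mulOp (fun _ => M) v = 0 := by
  apply ev_injective
  intro x
  rw [ev_mulOp_const, map_zero]
  have h1 : (fun x => M (ev x v)) =ᵐ[volume] fun _ => 0 := h
  exact congrFun ((Continuous.ae_eq_iff_eq volume (M.continuous.comp (continuous_ev v))
    continuous_const).1 h1) x

lemma cut_of_le {R : ℝ} {k : Sp d} (h : ‖k‖ ≤ R) : cut R k = k := if_pos h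

lemma low_conjOp (R : ℝ) (v : FL d n) : low R (conjOp v) = conjOp (low R v) := by
  refine mulOp_conjOp (isMultiplier_lowSym R) (isMultiplier_lowSym R) (fun k v => ?_) v
  rw [lowSym_apply, lowSym_apply, norm_neg]
  split_ifs
  · rfl
  · exact (map_zero (conjL (n := n))).symm

lemma sg_low_comm {b : Sp d → End n} (hb : IsSkew b) (R t : ℝ) (v : FL d n) :
    low R (sg b t v) = sg b t (low R v) :=
  sg_comm hb (isMultiplier_lowSym R) (fun k => (Commute.one_left (b k)).smul_left _) t v

/-- Symbols which agree on low frequencies generate the same group there. -/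
lemma sg_low_congr {b b' : Sp d → End n} (hb : IsSkew b) (hb' : IsSkew b') {R : ℝ}
    (h : ∀ k, ‖k‖ ≤ R → b k = b' k) (t : ℝ) (v : FL d n) :
    sg b t (low R v) = sg b' t (low R v) := by
  refine mulOp_ext (hb.isMultiplier t) (hb'.isMultiplier t) ?_
  filter_upwards [mulOp_ae (isMultiplier_lowSym R) v] with k hk
  rw [low, hk, lowSym_apply]
  split_ifs with hkR
  · rw [h k hkR]
  · rw [map_zero, map_zero]

lemma sg_integral_bound {b : Sp d → End n} (hb : IsSkew b) {R : ℝ} (hR : 0 ≤ R) (s : ℕ)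
    {f : ℝ → FL d n} {t m : ℝ} (ht : 0 ≤ t) (hf : ContinuousOn f (Icc 0 t))
    (hm : ∀ r ∈ Icc 0 t, wnorm R s (f r) ≤ m) (v : FL d n) :
    wnorm R s (sg b t v + ∫ r in (0 : ℝ)..t, sg b (t - r) (f r)) ≤ wnorm R s v + t * m := by
  have hi : IntervalIntegrable (fun r => sg b (t - r) (f r)) volume 0 t :=
    ((continuousOn_sg_apply hb hf t).mono (by rw [uIcc_of_le ht])).intervalIntegrable
  have h1 : wnorm R s (∫ r in (0 : ℝ)..t, sg b (t - r) (f r)) ≤ m * |t - 0| := by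
    rw [wnorm, ← ContinuousLinearMap.intervalIntegral_comp_comm _ hi]
    refine intervalIntegral.norm_integral_le_of_norm_le_const fun r hr => ?_
    rw [uIoc_of_le ht] at hr
    exact (wnorm_sg_le hb hR s (t - r) (f r)).trans (hm r ⟨hr.1.le, hr.2⟩)
  rw [sub_zero, abs_of_nonneg ht, mul_comm] at h1
  have h2 : wnorm R s (sg b t v + ∫ r in (0 : ℝ)..t, sg b (t - r) (f r)) ≤
      wnorm R s (sg b t v) + wnorm R s (∫ r in (0 : ℝ)..t, sg b (t - r) (f r)) := by
    simp only [wnorm, map_add]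
    exact norm_add_le _ _
  linarith [wnorm_sg_le hb hR s t v]

/-! ### ### Estimates for the envelope nonlinearity -/

section

open NLDispersive.Frame

variable {ι X : Type*} [NormedAddCommGroup X] [NormedSpace ℝ X] {F : Frame ι X}

lemma Frame.N_envSum_le {T : X →L[ℝ] X →L[ℝ] X →L[ℝ] X} {c : ℝ} (hc : 0 ≤ c)
    (hT : ∀ i s a b e, F.N i s (T a b e) ≤ c * F.N i s a * F.N i s b * F.N i s e) (i : ι) (s : ℕ)
    (j : ℤ) {U : ℤ → X} {M : ℝ} (hM : ∀ j ∈ harmonics 3, F.N i s (U j) ≤ M) :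
    F.N i s (envSum T j U) ≤ (triads j).card * (c * M ^ 3) := by
  have h : ∀ J : Finset (ℤ × ℤ × ℤ), (∀ j ∈ J, F.N i s (T (U j.1) (U j.2.1) (U j.2.2)) ≤ c * M ^ 3) →
      F.N i s (∑ j ∈ J, T (U j.1) (U j.2.1) (U j.2.2)) ≤ J.card * (c * M ^ 3) := by
    intro J hJ
    rw [N, map_sum]
    refine (norm_sum_le_of_le _ hJ).trans ?_
    rw [Finset.sum_const, nsmul_eq_mul]
  refine h _ fun J hJ => (hT i s _ _ _).trans ?_
  obtain ⟨h1, h2, h3⟩ := mem_of_mem_triads hJ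
  have := F.N_nonneg i s (U J.1)
  have := F.N_nonneg i s (U J.2.1)
  have := F.N_nonneg i s (U J.2.2)
  calc c * F.N i s (U J.1) * F.N i s (U J.2.1) * F.N i s (U J.2.2) ≤ c * M * M * M := by
        have := (F.N_nonneg i s (U J.1)).trans (hM _ h1)
        gcongr
        · exact hM _ h1
        · exact hM _ h2
        · exact hM _ h3
    _ = c * M ^ 3 := by ring

lemma continuousOn_envSum (T : X →L[ℝ] X →L[ℝ] X →L[ℝ] X) (j : ℤ) {U : ℤ → ℝ → X} {s : Set ℝ}
    (h : ∀ j ∈ harmonics 3, ContinuousOn (U j) s) :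
    ContinuousOn (fun t => envSum T j fun l => U l t) s := by
  unfold envSum
  refine continuousOn_finsetSum _ fun J hJ => ?_
  obtain ⟨h1, h2, h3⟩ := mem_of_mem_triads hJ
  exact ((T.continuous.comp_continuousOn (h _ h1)).clm_apply (h _ h2)).clm_apply (h _ h3)

lemma Frame.UB.envSum {S : ℝ} {s : ℕ} {T : X →L[ℝ] X →L[ℝ] X →L[ℝ] X} (hT : F.TriBdd T)
    {V : ι → ℤ → ℝ → X} (hV : ∀ j ∈ harmonics 3, F.UB S s (F.E 0) fun i => V i j) (j : ℤ) :
    F.UB S s (F.E 0) fun i t => envSum T j fun l => V i l t :=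
  UB.sum _ (E_nonneg 0) fun J hJ => by
    obtain ⟨j1, j2, j3⟩ := mem_of_mem_triads hJ
    exact (hV _ j1).tri_E (hV _ j2) (hV _ j3) hT (by omega)

lemma Frame.UB.envSum_sub {S : ℝ} {s m : ℕ} {T : X →L[ℝ] X →L[ℝ] X →L[ℝ] X} (hT : F.TriBdd T)
    {V U : ι → ℤ → ℝ → X} (hV : ∀ j ∈ harmonics 3, F.UB S s (F.E 0) fun i => V i j)
    (hU : ∀ j ∈ harmonics 3, F.UB S s (F.E 0) fun i => U i j)
    (hVU : ∀ j ∈ harmonics 3, F.UB S s (F.E m) fun i t => V i j t - U i j t) (j : ℤ) :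
    F.UB S s (F.E m) fun i t =>
      (NLDispersive.envSum T j fun l => V i l t) - NLDispersive.envSum T j fun l => U i l t := by
  have key : F.UB S s (F.E m) fun i t => ∑ J ∈ triads j,
      (T (V i J.1 t - U i J.1 t) (V i J.2.1 t) (V i J.2.2 t) +
        T (U i J.1 t) (V i J.2.1 t - U i J.2.1 t) (V i J.2.2 t) +
        T (U i J.1 t) (U i J.2.1 t) (V i J.2.2 t - U i J.2.2 t)) := by
    refine UB.sum _ (E_nonneg m) fun J hJ => ?_
    obtain ⟨j1, j2, j3⟩ := mem_of_mem_triads hJ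
    exact (((hVU _ j1).tri_E (hV _ j2) (hV _ j3) hT (by omega)).add
      ((hU _ j1).tri_E (hVU _ j2) (hV _ j3) hT (by omega))).add
      ((hU _ j1).tri_E (hU _ j2) (hVU _ j3) hT (by omega))
  refine key.congr fun i t => ?_
  simp only [NLDispersive.envSum, ← Finset.sum_sub_distrib]
  refine Finset.sum_congr rfl fun J _ => ?_
  simp only [map_sub, _root_.sub_apply]
  abel

/-- Transfer of bounds between families which agree on the relevant time intervals. -/
lemma Frame.UB.congr_on {S : ℝ} {s : ℕ} {g : ι → ℝ → ℝ} {v w : ι → ℝ → X}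
    (h : F.UB S s g v) (hvw : ∀ i t, 0 ≤ t → t * F.ε i ≤ S → w i t = v i t) :
    F.UB S s g w := by
  obtain ⟨C, hC, h⟩ := h
  exact ⟨C, hC, fun i t h0 h1 => by rw [hvw i t h0 h1]; exact h i t h0 h1⟩

end

section

variable {ι : Type*} {q : Params ι} {S : ℝ}

lemma Params.UB_low {s : ℕ} {g : ι → ℝ → ℝ} {v : ι → ℝ → FL d n}
    (h : (q.frame d n).UB S s g v) :
    (q.frame d n).UB S s g fun i t => low (q.R i) (v i t) := by
  obtain ⟨C, hC, h⟩ := h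
  refine ⟨C, hC, fun i t h0 h1 => le_trans ?_ (h i t h0 h1)⟩
  rw [q.frame_N, q.frame_N]
  exact wnorm_low_le (q.R_pos i).le _ s _

/-- One derivative buys a factor R⁻¹ = ε⁴. The radius is chosen to make truncation errors smaller
than the target order ε³, with one power to spare. -/
lemma Params.UB_sub_low {s : ℕ} {v : ι → ℝ → FL d n}
    (h : (q.frame d n).UB S (s + 1) ((q.frame d n).E 0) v) :
    (q.frame d n).UB S s ((q.frame d n).E 4) fun i t => v i t - low (q.R i) (v i t) := by
  obtain ⟨C, hC, h⟩ := h
  refine ⟨C, hC, fun i t h0 h1 => ?_⟩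
  have h2 := h i t h0 h1
  simp only [Frame.E, pow_zero, mul_one] at h2 ⊢
  rw [q.frame_N] at h2 ⊢
  refine (wnorm_sub_low_le (q.R_pos i) s _).trans ?_
  have h3 : (q.R i)⁻¹ = q.ε i ^ 4 := inv_inv _
  rw [h3, mul_comm]
  exact mul_le_mul_of_nonneg_right h2 (pow_nonneg (q.pos i).le 4)

lemma Params.mem_horizon {i : ι} {t : ℝ} : t ∈ Icc 0 (S / q.ε i) ↔ 0 ≤ t ∧ t * q.ε i ≤ S := by
  rw [mem_Icc, le_div_iff₀ (q.pos i)]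

lemma Params.mem_horizon_of_le {S' : ℝ} (hS' : S' ≤ S) {i : ι} {t : ℝ} (h0 : 0 ≤ t)
    (h1 : t * q.ε i ≤ S') : t ∈ Icc 0 (S / q.ε i) :=
  q.mem_horizon.2 ⟨h0, le_trans h1 hS'⟩

end

/-! ### ### Envelope solutions on the Fourier side: uniform bounds -/

namespace Problem

variable [NeZero n] (p : Problem d n) {ι : Type*} (q : Params ι)

/-- The full symbol of the `j`-th envelope equation. -/
def fSym (ε j : ℝ) (k : Sp d) : End n := ((ε⁻¹ : ℝ) : ℂ) • p.L j + Complex.I • clA p.A k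

lemma isSkew_fSym (ε j : ℝ) : IsSkew (p.fSym ε j) := by
  refine ⟨?_, fun k => add_mem (smul_mem_skewAdjoint _ (p.L_mem j))
    (I_smul_mem_skewAdjoint (isSelfAdjoint_cl (isHermitian_symbolA p.symm _)))⟩
  have h : Continuous (p.fSym ε j) :=
    continuous_const.add ((clA p.A).continuous.const_smul Complex.I)
  exact h.stronglyMeasurable

lemma fSym_eq_bSym {ε R j : ℝ} {k : Sp d} (h : ‖k‖ ≤ R) : p.fSym ε j k = p.bSym ε R j k := by
  rw [fSym, bSym, aSym, cut_of_le h]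

lemma sg_fSym_low (j : ℝ) (i : ι) (t : ℝ) (v : FL d n) :
    sg (p.fSym (q.ε i) j) t (low (q.R i) v) = p.grp q j i t (low (q.R i) v) :=
  sg_low_congr (p.isSkew_fSym _ _) (p.isSkew_bSym (q.R_pos i).le _ _)
    (fun _ hk => p.fSym_eq_bSym hk) t v

lemma low_sg_fSym (j : ℝ) (i : ι) (t : ℝ) (v : FL d n) :
    low (q.R i) (sg (p.fSym (q.ε i) j) t v) = p.grp q j i t (low (q.R i) v) := by
  rw [sg_low_comm (p.isSkew_fSym _ _), sg_fSym_low]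

/-- The nonlinearity on the Fourier side. -/
def nl : FL d n →L[ℝ] FL d n →L[ℝ] FL d n →L[ℝ] FL d n := triR (tri (d := d) p.tT)

/-- Fourier transforms of a family of solutions of the envelope equations, with common initial
data. -/
structure Envelopes (S : ℝ) where
  v₀ : FL d n
  v₁ : FL d n
  bound₀ : ∃ C, 0 ≤ C ∧ ∀ R, 0 ≤ R → wnorm R 3 v₀ ≤ C
  bound₁ : ∃ C, 0 ≤ C ∧ ∀ R, 0 ≤ R → wnorm R 3 v₁ ≤ C
  pol : cst (p.L 1) v₀ = 0
  V : ι → ℤ → ℝ → FL d n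
  cont : ∀ i j, ContinuousOn (V i j) (Icc 0 (S / q.ε i))
  conj : ∀ i j, 0 < j → ∀ t, V i (-j) t = conjOp (V i j t)
  duhamel₁ : ∀ i, ∀ t ∈ Icc 0 (S / q.ε i), V i 1 t =
    sg (p.fSym (q.ε i) 1) t (v₀ + q.ε i • v₁) + ∫ s in (0 : ℝ)..t, sg (p.fSym (q.ε i) 1) (t - s)
      (q.ε i • envSum p.nl 1 fun l => V i l s)
  duhamel₃ : ∀ i, ∀ t ∈ Icc 0 (S / q.ε i), V i 3 t =
    sg (p.fSym (q.ε i) 3) t 0 + ∫ s in (0 : ℝ)..t, sg (p.fSym (q.ε i) 3) (t - s)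
      (q.ε i • envSum p.nl 3 fun l => V i l s)

namespace Envelopes

open NLDispersive.Frame

variable {p q} {S : ℝ} (H : p.Envelopes q S)

/-- The initial data of the harmonics. -/
def init (i : ι) (j : ℤ) : FL d n := if j = 1 then H.v₀ + q.ε i • H.v₁ else 0

lemma duhamel {j : ℤ} (hj : j = 1 ∨ j = 3) (i : ι) {t : ℝ} (ht : t ∈ Icc 0 (S / q.ε i)) :
    H.V i j t = sg (p.fSym (q.ε i) j) t (H.init i j) +
      ∫ s in (0 : ℝ)..t, sg (p.fSym (q.ε i) j) (t - s)
        (q.ε i • envSum p.nl j fun l => H.V i l s) := by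
  rcases hj with rfl | rfl
  · have := H.duhamel₁ i t ht
    simpa [init] using this
  · have := H.duhamel₃ i t ht
    simpa [init] using this

lemma bound_init : ∃ C, 0 ≤ C ∧ ∀ i j, (q.frame d n).N i 3 (H.init i j) ≤ C := by
  obtain ⟨C₀, h0, hC₀⟩ := H.bound₀
  obtain ⟨C₁, h1, hC₁⟩ := H.bound₁
  refine ⟨C₀ + C₁, by positivity, fun i j => ?_⟩
  unfold init
  split_ifs
  · refine ((q.frame d n).N_add_le i 3 _ _).trans (add_le_add ?_ ?_)
    · rw [q.frame_N]; exact hC₀ _ (q.R_pos i).le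
    · rw [(q.frame d n).N_smul, abs_of_pos (q.pos i), q.frame_N]
      have h2 : 0 ≤ wnorm (q.R i) 3 H.v₁ := norm_nonneg _
      nlinarith [hC₁ _ (q.R_pos i).le, q.le_one i, q.pos i]
  · simp only [N, map_zero, norm_zero]; positivity

lemma continuousOn_nl (i : ι) (j : ℤ) :
    ContinuousOn (fun s => q.ε i • envSum p.nl j fun l => H.V i l s) (Icc 0 (S / q.ε i)) :=
  (continuousOn_envSum p.nl j fun l _ => H.cont i l).const_smul (q.ε i)

lemma N_V_le {M : ℝ} {i : ι} {t : ℝ} (h : (q.frame d n).N i 3 (H.V i 1 t) +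
    (q.frame d n).N i 3 (H.V i 3 t) ≤ M) {j : ℤ} (hj : j ∈ harmonics 3) :
    (q.frame d n).N i 3 (H.V i j t) ≤ M := by
  have h1 := (q.frame d n).N_nonneg i 3 (H.V i 1 t)
  have h3 := (q.frame d n).N_nonneg i 3 (H.V i 3 t)
  have hc : ∀ v, (q.frame d n).N i 3 (conjOp v) = (q.frame d n).N i 3 v := fun v => by
    rw [q.frame_N, q.frame_N, wnorm_conjOp (q.R_pos i).le]
  rcases mem_harmonics_three.1 hj with rfl | rfl | rfl | rfl
  · linarith
  · rw [H.conj i 1 one_pos, hc]; linarith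
  · linarith
  · rw [H.conj i 3 (by norm_num), hc]; linarith

/-- Uniform bounds on a short time interval. -/
lemma exists_bound (hS : 0 < S) : ∃ S', 0 < S' ∧ S' ≤ S ∧
    ∀ j ∈ harmonics 3, (q.frame d n).UB S' 3 ((q.frame d n).E 0) fun i => H.V i j := by
  obtain ⟨C, hC, hinit⟩ := H.bound_init
  obtain ⟨c, hc, hT⟩ := q.triBdd_tri (d := d) p.tT
  have hV : ∀ j : ℤ, j = 1 ∨ j = 3 → ∀ i t, t ∈ Icc 0 (S / q.ε i) → ∀ M, 0 ≤ M →
      (∀ r ∈ Icc 0 t, (q.frame d n).N i 3 (H.V i 1 r) + (q.frame d n).N i 3 (H.V i 3 r) ≤ M) →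
      (q.frame d n).N i 3 (H.V i j t) ≤ C + (((triads 1).card + (triads 3).card : ℝ) * c) *
        (t * q.ε i) * M ^ 3 := by
    intro j hj i t ht M hM hr
    have hsub : Icc 0 t ⊆ Icc 0 (S / q.ε i) := Icc_subset_Icc le_rfl ht.2
    rw [H.duhamel hj i ht, q.frame_N]
    refine (sg_integral_bound (p.isSkew_fSym _ _) (q.R_pos i).le 3 ht.1
      ((H.continuousOn_nl i j).mono hsub) (m := q.ε i * ((triads j).card * (c * M ^ 3)))
      (fun r hrt => ?_) _).trans ?_
    · rw [← q.frame_N, (q.frame d n).N_smul, abs_of_pos (q.pos i)]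
      exact mul_le_mul_of_nonneg_left (N_envSum_le hc hT i 3 j
        fun l hl => H.N_V_le (hr r hrt) hl) (q.pos i).le
    · rw [← q.frame_N]
      refine add_le_add (hinit i j) ?_
      have h1 : ((triads j).card : ℝ) ≤ (triads 1).card + (triads 3).card := by
        rcases hj with rfl | rfl
        · exact le_add_of_nonneg_right (Nat.cast_nonneg _)
        · exact le_add_of_nonneg_left (Nat.cast_nonneg _)
      have h2 : 0 ≤ c * (t * q.ε i) * M ^ 3 := by
        have := q.pos i
        have := ht.1
        positivity
      nlinarith
  obtain ⟨S', hS', hle, C', hC', hb⟩ := (q.frame d n).bootstrap hS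
    (φ := fun i t => (q.frame d n).N i 3 (H.V i 1 t) + (q.frame d n).N i 3 (H.V i 3 t))
    (fun i => by
      have hset : {t | 0 ≤ t ∧ t * (q.frame d n).ε i ≤ S} = Icc 0 (S / q.ε i) := by
        ext t; exact q.mem_horizon.symm
      rw [hset]
      exact (((q.frame d n).continuous_N i 3).comp_continuousOn (H.cont i 1)).add
        (((q.frame d n).continuous_N i 3).comp_continuousOn (H.cont i 3)))
    (fun i t => add_nonneg (N_nonneg _ _ _ _) (N_nonneg _ _ _ _))
    -- The gauge is the sum of the norms of two harmonics, each of which contributes C and the same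
    -- nonlinear constant.
    ⟨2 * C + 2 * (((triads 1).card + (triads 3).card : ℝ) * c), by positivity,
      fun i t h0 hS M hM hr => by
        have ht : t ∈ Icc 0 (S / q.ε i) := q.mem_horizon.2 ⟨h0, hS⟩
        have e1 := hV 1 (Or.inl rfl) i t ht M hM hr
        have e3 := hV 3 (Or.inr rfl) i t ht M hM hr
        have h1 : 0 ≤ C * ((t * q.ε i) * M ^ 3) := by
          have := q.pos i
          positivity
        have h2 : 0 ≤ ((triads 1).card + (triads 3).card : ℝ) * c := by positivity
        change _ ≤ _ + _ * (t * q.ε i) * M ^ 3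
        nlinarith⟩
  refine ⟨S', hS', hle, fun j hj => ⟨C', hC', fun i t h0 h1 => ?_⟩⟩
  simp only [Frame.E, pow_zero, mul_one]
  exact H.N_V_le (hb i t h0 h1) hj

end Envelopes

end Problem

/-! ### ### Truncated harmonics as approximate solutions for all times -/

namespace Problem

variable [NeZero n] {p : Problem d n} {ι : Type*} {q : Params ι}

namespace Envelopes

open NLDispersive.Frame

variable {S : ℝ} (H : p.Envelopes q S)

/-- The forcing of the `j`-th harmonic, extended continuously to all times. -/
def forcing (i : ι) (j : ℤ) (s : ℝ) : FL d n :=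
  q.ε i • envSum p.nl j fun l => H.V i l (max 0 (min s (S / q.ε i)))

lemma forcing_eq {i : ι} {s : ℝ} (hs : s ∈ Icc 0 (S / q.ε i)) (j : ℤ) :
    H.forcing i j s = q.ε i • envSum p.nl j fun l => H.V i l s := by
  rw [forcing, min_eq_left hs.2, max_eq_right hs.1]

lemma continuous_forcing (hS : 0 < S) (i : ι) (j : ℤ) : Continuous (H.forcing i j) := by
  have hc : Continuous fun s : ℝ => max 0 (min s (S / q.ε i)) := by fun_prop
  exact (H.continuousOn_nl i j).comp_continuous hc fun s =>
    ⟨le_max_left _ _, max_le (div_pos hS (q.pos i)).le (min_le_right _ _)⟩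

/-- The low-frequency part of a harmonic, extended to all times. -/
def ext (i : ι) (j : ℤ) : ℝ → FL d n :=
  IsGroup.duhamel (p.grp q j i) (low (q.R i) (H.init i j))
    fun s => low (q.R i) (H.forcing i j s)

lemma hasDerivAt_ext (hS : 0 < S) (i : ι) (j : ℤ) (t : ℝ) : HasDerivAt (H.ext i j)
    (-p.gen q j i (H.ext i j t) + low (q.R i) (H.forcing i j t)) t :=
  (p.isGroup q j i).hasDerivAt_duhamel _
    ((low (q.R i)).continuous.comp (H.continuous_forcing hS i j)) t

/-- The low-frequency projection commutes with the full group, and the full and truncated symbols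
agree on low frequencies. So the projected solution satisfies Duhamel's formula of the truncated
equation, with the projected forcing. -/
lemma ext_eq (hS : 0 < S) {j : ℤ} (hj : j = 1 ∨ j = 3) {i : ι} {t : ℝ}
    (ht : t ∈ Icc 0 (S / q.ε i)) : H.ext i j t = low (q.R i) (H.V i j t) := by
  have hsub : uIcc 0 t ⊆ Icc 0 (S / q.ε i) := by
    rw [uIcc_of_le ht.1]
    exact Icc_subset_Icc le_rfl ht.2
  have hi : IntervalIntegrable (fun s => sg (p.fSym (q.ε i) j) (t - s)
      (q.ε i • envSum p.nl j fun l => H.V i l s)) volume 0 t :=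
    ((continuousOn_sg_apply (p.isSkew_fSym _ _) (H.continuousOn_nl i j) t).mono
      hsub).intervalIntegrable
  have hc : Continuous fun s => low (q.R i) (H.forcing i j s) :=
    (low (q.R i)).continuous.comp (H.continuous_forcing hS i j)
  rw [ext, (p.isGroup q j i).duhamel_eq _ hc, H.duhamel hj i ht, map_add,
    low_sg_fSym, ← ContinuousLinearMap.intervalIntegral_comp_comm _ hi]
  congr 1
  refine intervalIntegral.integral_congr fun s hs => ?_
  rw [low_sg_fSym, H.forcing_eq (hsub hs)]

/-- The low-frequency parts of all harmonics. -/
def U (i : ι) (j : ℤ) (t : ℝ) : FL d n :=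
  if 0 < j then H.ext i j t else conjOp (H.ext i (-j) t)

lemma U_eq (hS : 0 < S) {j : ℤ} (hj : j ∈ harmonics 3) {i : ι} {t : ℝ}
    (ht : t ∈ Icc 0 (S / q.ε i)) : H.U i j t = low (q.R i) (H.V i j t) := by
  rcases mem_harmonics_three.1 hj with rfl | rfl | rfl | rfl
  · rw [U, if_pos one_pos]; exact H.ext_eq hS (Or.inl rfl) ht
  · rw [U, if_neg (by norm_num), H.conj i 1 one_pos, low_conjOp]
    exact congrArg conjOp (H.ext_eq hS (Or.inl rfl) ht)
  · rw [U, if_pos (by norm_num)]; exact H.ext_eq hS (Or.inr rfl) ht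
  · rw [U, if_neg (by norm_num), H.conj i 3 (by norm_num), low_conjOp]
    exact congrArg conjOp (H.ext_eq hS (Or.inr rfl) ht)

/-- The defect caused by the truncation. -/
def defect (i : ι) (j : ℤ) (t : ℝ) : FL d n :=
  (q.ε i)⁻¹ • low (q.R i) (H.forcing i j t) - envSum p.nl j fun l => H.U i l t

lemma smul_defect (i : ι) (j : ℤ) (t : ℝ) :
    q.ε i • ((envSum p.nl j fun l => H.U i l t) + H.defect i j t)
      = low (q.R i) (H.forcing i j t) := by
  rw [defect, add_sub_cancel, smul_smul, mul_inv_cancel₀ (q.pos i).ne', one_smul]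

lemma hasDerivAt_U (hS : 0 < S) (i : ι) {j : ℤ} (hj : 0 < j) (t : ℝ) : HasDerivAt (H.U i j)
    (-((q.ε i)⁻¹ • cst (p.L j) (H.U i j t) + (mulOp (p.aSym (q.R i))).restrictScalars ℝ (H.U i j t))
      + q.ε i • ((envSum p.nl j fun l => H.U i l t) + H.defect i j t)) t := by
  have h : H.U i j = H.ext i j := by funext s; rw [U, if_pos hj]
  rw [H.smul_defect, h, ← p.gen_apply]
  exact H.hasDerivAt_ext hS i j t

section Bounds

variable {S' : ℝ}

lemma bound_U (hS : 0 < S) (hS' : S' ≤ S)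
    (hV : ∀ j ∈ harmonics 3, (q.frame d n).UB S' 3 ((q.frame d n).E 0) fun i => H.V i j)
    {j : ℤ} (hj : j ∈ harmonics 3) :
    (q.frame d n).UB S' 3 ((q.frame d n).E 0) fun i => H.U i j :=
  (q.UB_low (hV j hj)).congr_on fun _ _ h0 h1 => H.U_eq hS hj (q.mem_horizon_of_le hS' h0 h1)

lemma bound_V_sub_U (hS : 0 < S) (hS' : S' ≤ S)
    (hV : ∀ j ∈ harmonics 3, (q.frame d n).UB S' 3 ((q.frame d n).E 0) fun i => H.V i j)
    {j : ℤ} (hj : j ∈ harmonics 3) :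
    (q.frame d n).UB S' 2 ((q.frame d n).E 4) fun i t => H.V i j t - H.U i j t :=
  (q.UB_sub_low (hV j hj)).congr_on fun i t h0 h1 => by
    rw [H.U_eq hS hj (q.mem_horizon_of_le hS' h0 h1)]

/-- On the time interval the defect is the commutator of truncation and nonlinearity, low(N(V)) -
N(low V) with N(V) the sum of triads. Both N(V) - N(low V) and the high frequencies of N(V) are
`O(ε⁴)` once one derivative is given up. -/
lemma bound_defect (hS : 0 < S) (hS' : S' ≤ S)
    (hV : ∀ j ∈ harmonics 3, (q.frame d n).UB S' 3 ((q.frame d n).E 0) fun i => H.V i j)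
    (j : ℤ) :
    (q.frame d n).UB S' 2 ((q.frame d n).E 4) fun i => H.defect i j := by
  have hT : (q.frame d n).TriBdd p.nl := q.triBdd_tri (d := d) p.tT
  have h1 := UB.envSum_sub hT (m := 4) (fun l hl => (hV l hl).mono_s (s' := 2) (by omega))
    (fun l hl => (H.bound_U hS hS' hV hl).mono_s (by omega))
    (fun l hl => H.bound_V_sub_U hS hS' hV hl) j
  refine (h1.sub (q.UB_sub_low (UB.envSum hT hV j))).congr_on fun i t h0 h1 => ?_
  rw [defect, H.forcing_eq (q.mem_horizon_of_le hS' h0 h1)]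
  have e : (q.ε i)⁻¹ • low (q.R i) (q.ε i • envSum p.nl j fun l => H.V i l t)
      = low (q.R i) (envSum p.nl j fun l => H.V i l t) := by
    have := ((low (q.R i)).restrictScalars ℝ).map_smul (q.ε i) (envSum p.nl j fun l => H.V i l t)
    change _ • ((low (q.R i)).restrictScalars ℝ) _ = ((low (q.R i)).restrictScalars ℝ) _
    rw [this, smul_smul, inv_mul_cancel₀ (q.pos i).ne', one_smul]
  rw [e]
  abel

/-- The truncated initial data are polarized up to `O(ε)`. -/
lemma bound_init_polarization : ∃ C, 0 ≤ C ∧ ∀ i, (q.frame d n).N i 2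
    (H.U i 1 0 - (p.system q).P i (H.U i 1 0)) ≤ C * q.ε i := by
  obtain ⟨C₀, hC₀, h₀⟩ := H.bound_init
  obtain ⟨C₁, hC₁, h₁⟩ := H.bound₁
  obtain ⟨cK, hcK, hK⟩ := (p.system q).bdd_K
  obtain ⟨cA, hcA, hA⟩ := (p.system q).loses_A
  obtain ⟨cL, hcL, hL⟩ := q.bdd_mulOp (m := fun _ _ => p.L 1) (fun _ => isMultiplier_const (d := d) _)
    (norm_nonneg (p.L 1)) fun _ _ => le_rfl
  refine ⟨cK * (cL * C₁ + cA * C₀), by positivity, fun i => ?_⟩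
  have hU : H.U i 1 0 = low (q.R i) (H.init i 1) := by
    rw [U, if_pos one_pos, ext, (p.isGroup q _ i).duhamel_zero]
  rw [hU]
  set v := low (q.R i) (H.init i 1) with hv
  have hcomm : ∀ w : FL d n, cst (p.L 1) (low (q.R i) w) = low (q.R i) (cst (p.L 1) w) := by
    intro w
    have := mulOp_comm (d := d) (isMultiplier_const (p.L 1)) (isMultiplier_lowSym (q.R i))
      fun k => (Commute.one_right _).smul_right _
    exact congrArg (fun B : FL d n →L[ℂ] FL d n => B w) this
  have hLv : (q.ε i)⁻¹ • cst (p.L 1) v = low (q.R i) (cst (p.L 1) H.v₁) := by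
    rw [hv, hcomm, init, if_pos rfl, map_add, H.pol, zero_add, map_smul]
    have := ((low (q.R i)).restrictScalars ℝ).map_smul (q.ε i) (cst (p.L 1) H.v₁)
    change _ • ((low (q.R i)).restrictScalars ℝ) _ = ((low (q.R i)).restrictScalars ℝ) _
    rw [this, smul_smul, inv_mul_cancel₀ (q.pos i).ne', one_smul]
  have hker := p.kSym_gen (q.pos i) (q.R_pos i).le v
  -- The unpolarized part is εK applied to the generator. The generator applied to the data is
  -- bounded, since ε⁻¹ 𝓛(ω,κ) annihilates `v₀` and meets `v₁` with a factor ε.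
  have e : v - (p.system q).P i v = q.ε i • (p.system q).K i
      ((q.ε i)⁻¹ • cst (p.L 1) v + (p.system q).A i v) := by
    have h2 : (p.system q).K i ((q.ε i)⁻¹ • cst (p.L 1) v + (p.system q).A i v)
      = (q.ε i)⁻¹ • (v - (p.system q).P i v) := hker
    rw [h2, smul_smul, mul_inv_cancel₀ (q.pos i).ne', one_smul]
  rw [e, (q.frame d n).N_smul, abs_of_pos (q.pos i), mul_comm]
  refine mul_le_mul_of_nonneg_right ((hK i 2 _).trans (mul_le_mul_of_nonneg_left ?_ hcK))
    (q.pos i).le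
  refine ((q.frame d n).N_add_le i 2 _ _).trans (add_le_add ?_ ((hA i 2 v).trans
    (mul_le_mul_of_nonneg_left ?_ hcA)))
  · rw [hLv, q.frame_N]
    refine (wnorm_low_le (q.R_pos i).le _ 2 _).trans ?_
    rw [← q.frame_N]
    refine (hL i 2 _).trans (mul_le_mul_of_nonneg_left ?_ hcL)
    refine ((q.frame d n).N_succ_le i 2 _).trans ?_
    rw [q.frame_N]
    exact h₁ _ (q.R_pos i).le
  · rw [q.frame_N]
    refine (wnorm_low_le (q.R_pos i).le _ 3 _).trans ?_
    rw [← q.frame_N]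
    exact h₀ i 1

/-- The truncated harmonics, as approximate solutions of the abstract envelope equations. -/
def sol (hS : 0 < S) (hS' : S' ≤ S)
    (hV : ∀ j ∈ harmonics 3, (q.frame d n).UB S' 3 ((q.frame d n).E 0) fun i => H.V i j) :
    (p.system q).Sol S' where
  U := H.U
  e := H.defect
  deriv₁ i t := by
    have h := H.hasDerivAt_U hS i (j := 1) one_pos t
    rw [Int.cast_one] at h
    exact h
  deriv₃ i t := by
    have h := H.hasDerivAt_U hS i (j := 3) (by norm_num) t
    rw [Int.cast_ofNat] at h
    exact h
  conj₁ i t := rfl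
  conj₃ i t := rfl
  bound₁ := H.bound_U hS hS' hV (by decide)
  bound₃ := H.bound_U hS hS' hV (by decide)
  defect₁ := H.bound_defect hS hS' hV 1
  defect₃ := H.bound_defect hS hS' hV 3
  init₁ := H.bound_init_polarization
  init₃ i := by
    rw [U, if_pos (by norm_num), ext, (p.isGroup q _ i).duhamel_zero, init, if_neg (by norm_num),
      map_zero]

end Bounds

end Envelopes

end Problem

/-! ### Carrier waves -/

lemma exp_smul_one (c : ℂ) : NormedSpace.exp (c • (1 : End n)) = Complex.exp c • (1 : End n) := by
  rw [← Algebra.algebraMap_eq_smul_one, ← Algebra.algebraMap_eq_smul_one, Complex.exp_eq_exp_ℂ,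
    NormedSpace.algebraMap_exp_comm]

lemma conjV_conjV (v : Vec n) : conjV (conjV v) = v := by ext i; simp [conjV]

lemma conj_carrier (κ : Sp d) (ω ε : ℝ) (j : ℤ) (t : ℝ) (x : Sp d) :
    (starRingEnd ℂ) (carrier κ ω ε j t x) = carrier κ ω ε (-j) t x := by
  rw [carrier, carrier, ← Complex.exp_conj, map_mul, Complex.conj_I, Complex.conj_ofReal]
  congr 1
  push_cast
  ring

lemma carrier_mul (κ : Sp d) (ω ε : ℝ) (j l : ℤ) (t : ℝ) (x : Sp d) :
    carrier κ ω ε j t x * carrier κ ω ε l t x = carrier κ ω ε (j + l) t x := by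
  rw [carrier, carrier, carrier, ← Complex.exp_add]
  congr 1
  push_cast
  ring

lemma conjV_add (v w : Vec n) : conjV (v + w) = conjV v + conjV w := map_add conjL v w

lemma conjV_sum {α : Type*} (s : Finset α) (f : α → Vec n) :
    conjV (∑ a ∈ s, f a) = ∑ a ∈ s, conjV (f a) := map_sum conjL f s

lemma sum_harmonics_three {M : Type*} [AddCommMonoid M] (f : ℤ → M) :
    ∑ j ∈ harmonics 3, f j = f 1 + f 3 + (f (-1) + f (-3)) := by
  have : harmonics 3 = {1, 3, -1, -3} := by decide
  rw [this, Finset.sum_insert (by decide), Finset.sum_insert (by decide),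
    Finset.sum_insert (by decide), Finset.sum_singleton, add_assoc]

lemma sum_carrier (κ : Sp d) (ω ε t : ℝ) (x : Sp d) {e : ℤ → Vec n} (h1 : e (-1) = conjV (e 1))
    (h3 : e (-3) = conjV (e 3)) : ∑ j ∈ harmonics 3, carrier κ ω ε j t x • e j =
      (carrier κ ω ε 1 t x • e 1 + carrier κ ω ε 3 t x • e 3) +
        conjV (carrier κ ω ε 1 t x • e 1 + carrier κ ω ε 3 t x • e 3) := by
  rw [sum_harmonics_three, conjV_add, conjV_smul, conjV_smul, conj_carrier, conj_carrier, h1, h3]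

lemma sum_triads_neg {M : Type*} [AddCommMonoid M] (m : ℤ) (f : ℤ × ℤ × ℤ → M) :
    ∑ J ∈ triads (-m), f J = ∑ J ∈ triads m, f (-J) := by
  have hh : ∀ j : ℤ, -j ∈ harmonics 3 ↔ j ∈ harmonics 3 := by
    intro j; rw [mem_harmonics_three, mem_harmonics_three]; omega
  refine Finset.sum_nbij' (fun J => -J) (fun J => -J) ?_ ?_ ?_ ?_ ?_
  · intro J hJ
    simp only [triads, Finset.mem_filter, Finset.mem_product, Prod.fst_neg, Prod.snd_neg, hh] at hJ ⊢
    exact ⟨hJ.1, by linarith [hJ.2]⟩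
  · intro J hJ
    simp only [triads, Finset.mem_filter, Finset.mem_product, Prod.fst_neg, Prod.snd_neg, hh] at hJ ⊢
    exact ⟨hJ.1, by linarith [hJ.2]⟩
  · intro J _; exact neg_neg J
  · intro J _; exact neg_neg J
  · intro J _; rw [neg_neg]

/-- The harmonics generated by the cubic nonlinearity. -/
def cubicHarmonics : Finset ℤ := {1, 3, 5, 7, 9}

/-- The cubic nonlinearity of a real wave train. -/
lemma cubic_wave_train {f : Vec n → Vec n → Vec n → Vec n} (hf : IsTrilinear f)
    (hc : ∀ a b c, conjV (f a b c) = f (conjV a) (conjV b) (conjV c)) (κ : Sp d) (ω ε t : ℝ)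
    (x : Sp d) {e : ℤ → Vec n} (h1 : e (-1) = conjV (e 1)) (h3 : e (-3) = conjV (e 3)) :
    f (∑ j ∈ harmonics 3, carrier κ ω ε j t x • e j) (∑ j ∈ harmonics 3, carrier κ ω ε j t x • e j)
      (∑ j ∈ harmonics 3, carrier κ ω ε j t x • e j) =
    (∑ m ∈ cubicHarmonics, carrier κ ω ε m t x • ∑ J ∈ triads m, f (e J.1) (e J.2.1) (e J.2.2)) +
      conjV (∑ m ∈ cubicHarmonics,
        carrier κ ω ε m t x • ∑ J ∈ triads m, f (e J.1) (e J.2.1) (e J.2.2)) := by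
  have hneg : ∀ j ∈ harmonics 3, conjV (e j) = e (-j) := by
    intro j hj
    rcases mem_harmonics_three.1 hj with rfl | rfl | rfl | rfl
    · rw [h1]
    · rw [h1, conjV_conjV, neg_neg]
    · rw [h3]
    · rw [h3, conjV_conjV, neg_neg]
  set Θ := mkTri f hf with hΘ
  -- Conjugation sends the harmonic m to -m and a triad J to -J, so the conjugate sum runs over the
  -- negative harmonics.
  have hconj : conjV (∑ m ∈ cubicHarmonics,
        carrier κ ω ε m t x • ∑ J ∈ triads m, f (e J.1) (e J.2.1) (e J.2.2)) =
      ∑ m ∈ cubicHarmonics.image (fun m => -m),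
        carrier κ ω ε m t x • ∑ J ∈ triads m, f (e J.1) (e J.2.1) (e J.2.2) := by
    rw [Finset.sum_image (fun a _ b _ h => neg_injective h), conjV_sum]
    refine Finset.sum_congr rfl fun m _ => ?_
    rw [conjV_smul, conj_carrier, sum_triads_neg, conjV_sum]
    congr 1
    refine Finset.sum_congr rfl fun J hJ => ?_
    obtain ⟨j1, j2, j3⟩ := mem_of_mem_triads hJ
    rw [hc, hneg _ j1, hneg _ j2, hneg _ j3]
    rfl
  rw [hconj, ← Finset.sum_union (by decide)]
  have hexp : f (∑ j ∈ harmonics 3, carrier κ ω ε j t x • e j)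
      (∑ j ∈ harmonics 3, carrier κ ω ε j t x • e j)
      (∑ j ∈ harmonics 3, carrier κ ω ε j t x • e j) =
      ∑ J ∈ harmonics 3 ×ˢ harmonics 3 ×ˢ harmonics 3,
        carrier κ ω ε (J.1 + J.2.1 + J.2.2) t x • f (e J.1) (e J.2.1) (e J.2.2) := by
    change Θ _ _ _ = _
    rw [Finset.sum_product, map_sum Θ, _root_.sum_apply, _root_.sum_apply]
    refine Finset.sum_congr rfl fun j1 _ => ?_
    rw [Finset.sum_product, map_smul, _root_.smul_apply, _root_.smul_apply,
      map_sum (Θ (e j1)), _root_.sum_apply, Finset.smul_sum]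
    refine Finset.sum_congr rfl fun j2 _ => ?_
    rw [map_smul, _root_.smul_apply, map_sum, Finset.smul_sum, Finset.smul_sum]
    refine Finset.sum_congr rfl fun j3 _ => ?_
    rw [map_smul, smul_smul, smul_smul, ← carrier_mul, ← carrier_mul, mul_assoc]
    rfl
  -- The triples are grouped by their sum; sums of three odd numbers of modulus at most 3 are odd
  -- and of modulus at most 9.
  rw [hexp, ← Finset.sum_fiberwise_of_maps_to
    (t := cubicHarmonics ∪ cubicHarmonics.image (fun m => -m)) (g := fun J => J.1 + J.2.1 + J.2.2)
    (by decide)]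
  refine Finset.sum_congr rfl fun m _ => ?_
  rw [Finset.smul_sum]
  refine Finset.sum_congr rfl fun J hJ => ?_
  rw [(Finset.mem_filter.1 hJ).2]

/-- `v + conj v`, on the Fourier side. -/
def twoRe : FL d n →L[ℝ] FL d n := ContinuousLinearMap.id ℝ (FL d n) + conjOp

lemma twoRe_apply (v : FL d n) : twoRe v = v + conjOp v := rfl

lemma ev_twoRe (x : Sp d) (v : FL d n) : ev x (twoRe v) = ev x v + conjV (ev x v) := by
  rw [twoRe_apply, map_add, ev_conjOp]

lemma norm_twoRe_le (v : FL d n) : ‖twoRe v‖ ≤ 2 * ‖v‖ := by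
  have h : ‖conjOp v‖ = ‖v‖ := by simpa [wnorm] using wnorm_conjOp (R := 0) le_rfl 0 v
  rw [twoRe_apply]
  refine (norm_add_le _ _).trans ?_
  rw [h]; linarith

/-- The condition conj M(-k) = M(k) says that the operator has real coefficients, hence so does its
group, which then commutes with conjugation. -/
lemma conjOp_sg {b : Sp d → End n} (hb : IsSkew b) {M : Sp d → Matrix (Fin n) (Fin n) ℂ}
    (hM : ∀ k, b k = cl (M k)) (hc : ∀ k, (M (-k)).map (starRingEnd ℂ) = M k) (t : ℝ)
    (v : FL d n) : sg b t (conjOp v) = conjOp (sg b t v) := by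
  refine mulOp_conjOp (hb.isMultiplier t) (hb.isMultiplier t) (fun k v => ?_) v
  have h1 : ∀ B : Matrix (Fin n) (Fin n) ℂ, B.map (starRingEnd ℂ) = B.conjTranspose.transpose :=
    fun B => by ext; simp
  have h2 : (-((t : ℂ) • M (-k))).map (starRingEnd ℂ) = -((t : ℂ) • M k) := by
    rw [← hc k]
    ext; simp
  rw [hM, hM, ← map_smul, ← map_smul, ← map_neg, ← map_neg, ← cl_exp, ← cl_exp, cl_apply, cl_apply,
    conjV_mulV, h1, ← Matrix.exp_conjTranspose, ← Matrix.exp_transpose, ← h1, h2]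

namespace Problem

variable [NeZero n] (p : Problem d n)

lemma symbolL_zero_zero : Complex.I • symbolL p.A p.E 0 0 = p.E.map Complex.ofReal := by
  have : symbolA p.A (0 : Sp d) = 0 := by simp [symbolA]
  rw [symbolL, this, Complex.ofReal_zero, zero_smul, neg_zero, zero_add, zero_sub, smul_neg, smul_smul,
    Complex.I_mul_I, neg_one_smul, neg_neg]

/-- The symbol of the original problem. -/
lemma fSym_zero (ε : ℝ) (k : Sp d) : p.fSym ε 0 k =
    cl (((ε⁻¹ : ℝ) : ℂ) • p.E.map Complex.ofReal + Complex.I • symbolA p.A k) := by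
  rw [fSym, L, zero_mul, zero_smul, ← map_smul, p.symbolL_zero_zero, clA_apply, map_add, map_smul,
    map_smul]

lemma fSym_eq_cl (ε j : ℝ) (k : Sp d) : p.fSym ε j k =
    cl ((Complex.I * ((ε⁻¹ : ℝ) : ℂ)) • symbolL p.A p.E (j * p.ω) (j • p.κ) +
      Complex.I • symbolA p.A k) := by
  rw [fSym, L, clA_apply, map_add, map_smul, map_smul, smul_smul, mul_comm]

lemma L_eq (j : ℝ) : p.L j = p.L 0 + (Complex.I • clA p.A (j • p.κ) -
    (Complex.I * ((j * p.ω : ℝ) : ℂ)) • (1 : End n)) := by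
  have h : symbolL p.A p.E (j * p.ω) (j • p.κ) = symbolL p.A p.E 0 0 + (symbolA p.A (j • p.κ)
      - ((j * p.ω : ℝ) : ℂ) • (1 : Matrix (Fin n) (Fin n) ℂ)) := by
    rw [symbolL_eq]
    nth_rewrite 1 [← zero_add (j • p.κ)]
    rw [symbolL_add]
    abel
  rw [L, L, zero_mul, zero_smul, h, map_add, map_sub, smul_add, smul_sub, map_smul, map_one,
    smul_smul, clA_apply]

/-- Modulation by the carrier shifts the frequency by jκ/ε. By linearity of A this produces the term
A(jκ) of 𝓛(jω, jκ), and the remaining -jω is a scalar. -/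
lemma fSym_shift (ε : ℝ) (j : ℝ) (k : Sp d) :
    p.fSym ε 0 (k + (j / ε) • p.κ) = p.fSym ε j k +
      (Complex.I * ((j * p.ω / ε : ℝ) : ℂ)) • (1 : End n) := by
  rw [fSym, fSym, p.L_eq j, map_add, map_smul, map_smul]
  have h1 : ∀ (c : ℝ) (B : End n), c • B = (c : ℂ) • B := fun c B => rfl
  rw [h1, h1]
  simp only [smul_add, smul_sub, smul_smul]
  have e1 : Complex.I * ((j / ε : ℝ) : ℂ) = ((ε⁻¹ : ℝ) : ℂ) * (Complex.I * (j : ℂ)) := by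
    push_cast; ring
  have e2 : Complex.I * ((j * p.ω / ε : ℝ) : ℂ)
      = ((ε⁻¹ : ℝ) : ℂ) * (Complex.I * ((j * p.ω : ℝ) : ℂ)) := by
    push_cast; ring
  rw [e1, e2]
  abel

/-- Multiplication by a carrier wave, on the Fourier side. -/
def wave (ε : ℝ) (j : ℤ) (t : ℝ) : FL d n →L[ℂ] FL d n :=
  Complex.exp (-((t : ℂ) * (Complex.I * (((j : ℝ) * p.ω / ε : ℝ) : ℂ)))) •
    shiftOp (((j : ℝ) / ε) • p.κ)

lemma ev_wave (ε : ℝ) (j : ℤ) (t : ℝ) (x : Sp d) (v : FL d n) :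
    NLDispersive.ev x (p.wave ε j t v) = carrier p.κ p.ω ε j t x • NLDispersive.ev x v := by
  rw [wave, _root_.smul_apply, map_smul, ev_shiftOp, smul_smul, ← Complex.exp_add, carrier,
    inner_smul_left]
  congr 2
  push_cast
  simp only [conj_trivial]
  push_cast
  ring

lemma norm_wave (ε : ℝ) (j : ℤ) (t : ℝ) (v : FL d n) : ‖p.wave ε j t v‖ = ‖v‖ := by
  have h : -((t : ℂ) * (Complex.I * (((j : ℝ) * p.ω / ε : ℝ) : ℂ)))
      = ((-(t * ((j : ℝ) * p.ω / ε)) : ℝ) : ℂ) * Complex.I := by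
    push_cast; ring
  rw [wave, _root_.smul_apply, norm_smul, norm_shiftOp, h, Complex.norm_exp_ofReal_mul_I, one_mul]

lemma continuous_wave_apply (ε : ℝ) (j : ℤ) {f : ℝ → FL d n} (hf : Continuous f) :
    Continuous fun t => p.wave ε j t (f t) := by
  have h : Continuous fun t : ℝ =>
      Complex.exp (-((t : ℂ) * (Complex.I * (((j : ℝ) * p.ω / ε : ℝ) : ℂ)))) := by fun_prop
  exact h.smul ((shiftOp (((j : ℝ) / ε) • p.κ)).continuous.comp hf)

/-- The scalar left over from the frequency shift is precisely the rate of the temporal phase of the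
carrier. So the original evolution of a modulated envelope is the modulation of the envelope
evolution. -/
lemma sg_wave (ε : ℝ) (j : ℤ) (t s : ℝ) (v : FL d n) :
    sg (p.fSym ε 0) t (p.wave ε j s v) = p.wave ε j (t + s) (sg (p.fSym ε j) t v) := by
  set c : ℂ := Complex.I * (((j : ℝ) * p.ω / ε : ℝ) : ℂ) with hc
  have hm := (p.isSkew_fSym ε j).isMultiplier t
  have h1 : ∀ k, NormedSpace.exp (-((t : ℂ) • p.fSym ε 0 (k + ((j : ℝ) / ε) • p.κ))) =
      Complex.exp (-((t : ℂ) * c)) • NormedSpace.exp (-((t : ℂ) • p.fSym ε j k)) := by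
    intro k
    have h2 : -((t : ℂ) • p.fSym ε 0 (k + ((j : ℝ) / ε) • p.κ)) =
        -((t : ℂ) • p.fSym ε j k) + (-((t : ℂ) * c)) • (1 : End n) := by
      rw [fSym_shift, smul_add, smul_smul, neg_add, neg_smul]
    rw [h2, expEnd_add ((Commute.one_right _).smul_right _), exp_smul_one, mul_smul_comm, mul_one]
  rw [wave, wave, _root_.smul_apply, _root_.smul_apply, map_smul, sg,
    mulOp_shiftOp ((p.isSkew_fSym ε 0).isMultiplier t) (hm.smul _) h1, mulOp_smul hm,
    _root_.smul_apply, map_smul, smul_smul, ← Complex.exp_add]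
  congr 2
  rw [hc]
  push_cast
  ring

lemma conjOp_sg_zero (ε t : ℝ) (v : FL d n) :
    sg (p.fSym ε 0) t (conjOp v) = conjOp (sg (p.fSym ε 0) t v) := by
  refine conjOp_sg (p.isSkew_fSym ε 0) (p.fSym_zero ε) (fun k => ?_) t v
  ext i l
  simp [symbolA, Matrix.sum_apply]

lemma twoRe_sg (ε t : ℝ) (v : FL d n) :
    sg (p.fSym ε 0) t (twoRe v) = twoRe (sg (p.fSym ε 0) t v) := by
  rw [twoRe_apply, twoRe_apply, map_add, p.conjOp_sg_zero]

end Problem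

/-- With at most one entry ±3 a triad has sum at most 5, so the sums 7 and 9 require two. -/
lemma triads_seven_nine {m : ℤ} (hm : m = 7 ∨ m = 9) (J : ℤ × ℤ × ℤ) (hJ : J ∈ triads m) :
    ((J.1 = 3 ∨ J.1 = -3) ∧ (J.2.1 = 3 ∨ J.2.1 = -3)) ∨
    ((J.1 = 3 ∨ J.1 = -3) ∧ (J.2.2 = 3 ∨ J.2.2 = -3)) ∨
    ((J.2.1 = 3 ∨ J.2.1 = -3) ∧ (J.2.2 = 3 ∨ J.2.2 = -3)) := by
  obtain ⟨h1, h2, h3⟩ := mem_of_mem_triads hJ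
  have hs : J.1 + J.2.1 + J.2.2 = m := (Finset.mem_filter.1 hJ).2
  rw [mem_harmonics_three] at h1 h2 h3
  omega

lemma wnorm_zero (R : ℝ) (v : FL d n) : wnorm R 0 v = ‖v‖ := by simp [wnorm]

lemma norm_trilinear_sub_le {X : Type*} [NormedAddCommGroup X] [NormedSpace ℝ X]
    (T : X →L[ℝ] X →L[ℝ] X →L[ℝ] X) {c B : ℝ} (hc : 0 ≤ c)
    (hT : ∀ x y z, ‖T x y z‖ ≤ c * ‖x‖ * ‖y‖ * ‖z‖) {a b : X} (ha : ‖a‖ ≤ B) (hb : ‖b‖ ≤ B) :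
    ‖T a a a - T b b b‖ ≤ 3 * c * B ^ 2 * ‖a - b‖ := by
  have e : T a a a - T b b b = T (a - b) a a + T b (a - b) a + T b b (a - b) := by
    simp only [map_sub, _root_.sub_apply]; abel
  have hB : 0 ≤ B := (norm_nonneg _).trans ha
  have h1 : ‖T (a - b) a a‖ ≤ c * ‖a - b‖ * B * B := (hT _ _ _).trans (by gcongr)
  have h2 : ‖T b (a - b) a‖ ≤ c * B * ‖a - b‖ * B := (hT _ _ _).trans (by gcongr)
  have h3 : ‖T b b (a - b)‖ ≤ c * B * B * ‖a - b‖ := (hT _ _ _).trans (by gcongr)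
  rw [e]
  refine (norm_add₃_le).trans ?_
  nlinarith

lemma integral_sg_add {b : Sp d → End n} (hb : IsSkew b) {f g : ℝ → FL d n} (hf : Continuous f)
    (hg : Continuous g) (t : ℝ) : ∫ s in (0 : ℝ)..t, sg b (t - s) (f s + g s) =
      (∫ s in (0 : ℝ)..t, sg b (t - s) (f s)) + ∫ s in (0 : ℝ)..t, sg b (t - s) (g s) := by
  have hi : ∀ {f : ℝ → FL d n}, Continuous f →
      IntervalIntegrable (fun s => sg b (t - s) (f s)) volume 0 t := fun hf =>
    ((continuousOn_sg_apply hb hf.continuousOn t).mono (subset_univ _)).intervalIntegrable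
  simp only [map_add]
  exact intervalIntegral.integral_add (hi hf) (hi hg)

/-! ### ### The wave train with the fifth harmonic and its residual -/

namespace Problem

variable [NeZero n] {p : Problem d n} {ι : Type*} {q : Params ι}

namespace Envelopes

open NLDispersive.Frame

variable {S : ℝ} (H : p.Envelopes q S)

/-- Fourier transforms of a family of solutions of the original problem. -/
structure Original where
  u : ι → ℝ → FL d n
  cont : ∀ i, ContinuousOn (u i) (Icc 0 (S / q.ε i))
  duhamel : ∀ i, ∀ t ∈ Icc 0 (S / q.ε i), u i t =
    sg (p.fSym (q.ε i) 0) t (twoRe (p.wave (q.ε i) 1 0 (H.init i 1))) +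
      ∫ s in (0 : ℝ)..t, sg (p.fSym (q.ε i) 0) (t - s) (q.ε i • p.nl (u i s) (u i s) (u i s))

lemma low_grp (j : ℝ) (i : ι) (t : ℝ) (v : FL d n) :
    low (q.R i) (p.grp q j i t v) = sg (p.fSym (q.ε i) j) t (low (q.R i) v) := by
  rw [sg_fSym_low]
  exact sg_low_comm (p.isSkew_bSym (q.R_pos i).le _ _) _ t v

lemma low_duhamel (j : ℝ) (i : ι) (w : FL d n) {f : ℝ → FL d n} (hf : Continuous f) (t : ℝ) :
    low (q.R i) (IsGroup.duhamel (p.grp q j i) w f t) =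
      sg (p.fSym (q.ε i) j) t (low (q.R i) w) +
        ∫ s in (0 : ℝ)..t, sg (p.fSym (q.ε i) j) (t - s) (low (q.R i) (f s)) := by
  have hc : Continuous fun s => p.grp q j i (t - s) (f s) :=
    ((p.isGroup q j i).continuous.comp (continuous_const.sub continuous_id)).clm_apply hf
  rw [(p.isGroup q j i).duhamel_eq _ hf, map_add, low_grp,
    ← ContinuousLinearMap.intervalIntegral_comp_comm _ (hc.intervalIntegrable _ _)]
  simp only [low_grp]

/-- A modulated solution of an envelope equation solves the original equation. -/
lemma wave_duhamel (j : ℤ) (i : ι) (w : FL d n) {f : ℝ → FL d n} (hf : Continuous f) (t : ℝ) :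
    p.wave (q.ε i) j t (low (q.R i) (IsGroup.duhamel (p.grp q j i) w f t)) =
      sg (p.fSym (q.ε i) 0) t (p.wave (q.ε i) j 0 (low (q.R i) w)) +
        ∫ s in (0 : ℝ)..t, sg (p.fSym (q.ε i) 0) (t - s)
          (p.wave (q.ε i) j s (low (q.R i) (f s))) := by
  have hc : Continuous fun s => low (q.R i) (f s) := (low (q.R i)).continuous.comp hf
  have hi : IntervalIntegrable (fun s => sg (p.fSym (q.ε i) j) (t - s) (low (q.R i) (f s)))
      volume 0 t := ((continuousOn_sg_apply (p.isSkew_fSym _ _) hc.continuousOn t).mono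
        (subset_univ _)).intervalIntegrable
  rw [low_duhamel j i w hf, map_add, ← ContinuousLinearMap.intervalIntegral_comp_comm _ hi, sg_wave,
    add_zero]
  simp only [sg_wave, sub_add_cancel]

/-- The nonlinearity of the `j`-th harmonic. -/
def N (i : ι) (j : ℤ) (t : ℝ) : FL d n := envSum p.nl j fun l => H.U i l t

lemma continuous_U (hS : 0 < S) (i : ι) {j : ℤ} (hj : j ∈ harmonics 3) : Continuous (H.U i j) := by
  have h : ∀ j : ℤ, 0 < j → Continuous (H.U i j) := fun j hj => continuous_iff_continuousAt.2
    fun t => (H.hasDerivAt_U hS i hj t).continuousAt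
  rcases mem_harmonics_three.1 hj with rfl | rfl | rfl | rfl
  · exact h 1 one_pos
  · exact conjOp.continuous.comp (h 1 one_pos)
  · exact h 3 (by norm_num)
  · exact conjOp.continuous.comp (h 3 (by norm_num))

lemma continuous_N (hS : 0 < S) (i : ι) (j : ℤ) : Continuous (H.N i j) := by
  rw [← continuousOn_univ]
  exact continuousOn_envSum p.nl j fun l hl => (H.continuous_U hS i hl).continuousOn

/-- The fifth harmonic. -/
def D (i : ι) : ℝ → FL d n := IsGroup.duhamel (p.grp q 5 i) 0 fun s => q.ε i • H.N i 5 s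

lemma hasDerivAt_D (hS : 0 < S) (i : ι) (t : ℝ) : HasDerivAt (H.D i)
    (-((q.ε i)⁻¹ • cst (p.L 5) (H.D i t) + (mulOp (p.aSym (q.R i))).restrictScalars ℝ (H.D i t))
      + q.ε i • H.N i 5 t) t := by
  have h := (p.isGroup q 5 i).hasDerivAt_duhamel 0 ((H.continuous_N hS i 5).const_smul (q.ε i)) t
  rw [← p.gen_apply]
  exact h

/-- The wave train of the first, third and fifth harmonics. -/
def train (i : ι) (t : ℝ) : FL d n :=
  p.wave (q.ε i) 1 t (H.U i 1 t) + p.wave (q.ε i) 3 t (H.U i 3 t) +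
    p.wave (q.ε i) 5 t (low (q.R i) (H.D i t))

/-- The forcing of the wave train. -/
def trainForcing (i : ι) (s : ℝ) : FL d n :=
  p.wave (q.ε i) 1 s (low (q.R i) (H.forcing i 1 s)) +
    p.wave (q.ε i) 3 s (low (q.R i) (H.forcing i 3 s)) +
    p.wave (q.ε i) 5 s (low (q.R i) (q.ε i • H.N i 5 s))

/-- A projection outside the Duhamel integral is equivalent to projected data and forcing. Only
after this outer projection do the truncated and full groups agree, as the passage to the original
equation requires. -/
lemma U_eq_low (hS : 0 < S) (i : ι) {j : ℤ} (hj : 0 < j) (t : ℝ) : H.U i j t =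
    low (q.R i) (IsGroup.duhamel (p.grp q j i) (H.init i j) (H.forcing i j) t) := by
  have hc : Continuous fun s => low (q.R i) (H.forcing i j s) :=
    (low (q.R i)).continuous.comp (H.continuous_forcing hS i j)
  rw [low_duhamel _ _ _ (H.continuous_forcing hS i j), U, if_pos hj, ext,
    (p.isGroup q j i).duhamel_eq _ hc, sg_fSym_low]
  simp only [sg_fSym_low]

lemma continuous_trainForcing (hS : 0 < S) (i : ι) : Continuous (H.trainForcing i) :=
  ((p.continuous_wave_apply _ 1 ((low (q.R i)).continuous.comp (H.continuous_forcing hS i 1))).add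
    (p.continuous_wave_apply _ 3 ((low (q.R i)).continuous.comp (H.continuous_forcing hS i 3)))).add
    (p.continuous_wave_apply _ 5
      ((low (q.R i)).continuous.comp ((H.continuous_N hS i 5).const_smul (q.ε i))))

set_option maxHeartbeats 1000000 in
lemma train_duhamel (hS : 0 < S) (i : ι) (t : ℝ) : H.train i t =
    sg (p.fSym (q.ε i) 0) t (p.wave (q.ε i) 1 0 (low (q.R i) (H.init i 1))) +
      ∫ s in (0 : ℝ)..t, sg (p.fSym (q.ε i) 0) (t - s) (H.trainForcing i s) := by
  have h1 := wave_duhamel (p := p) (q := q) 1 i (H.init i 1) (H.continuous_forcing hS i 1) t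
  have h3 := wave_duhamel (p := p) (q := q) 3 i (H.init i 3) (H.continuous_forcing hS i 3) t
  have h5 := wave_duhamel (p := p) (q := q) 5 i 0 (f := fun s => q.ε i • H.N i 5 s)
    ((H.continuous_N hS i 5).const_smul (q.ε i)) t
  have hi : H.init i 3 = 0 := if_neg (by norm_num)
  rw [← H.U_eq_low hS i one_pos] at h1
  rw [← H.U_eq_low hS i (by norm_num), hi, map_zero, map_zero, map_zero, zero_add] at h3
  rw [map_zero, map_zero, map_zero, zero_add, Int.cast_ofNat] at h5
  have c1 : Continuous fun s => p.wave (q.ε i) 1 s (low (q.R i) (H.forcing i 1 s)) :=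
    p.continuous_wave_apply (q.ε i) 1
      ((low (q.R i)).continuous.comp (H.continuous_forcing hS i 1))
  have c3 : Continuous fun s => p.wave (q.ε i) 3 s (low (q.R i) (H.forcing i 3 s)) :=
    p.continuous_wave_apply (q.ε i) 3
      ((low (q.R i)).continuous.comp (H.continuous_forcing hS i 3))
  have c5 : Continuous fun s => p.wave (q.ε i) 5 s (low (q.R i) (q.ε i • H.N i 5 s)) :=
    p.continuous_wave_apply (q.ε i) 5
      ((low (q.R i)).continuous.comp ((H.continuous_N hS i 5).const_smul (q.ε i)))
  have c13 : Continuous fun s => p.wave (q.ε i) 1 s (low (q.R i) (H.forcing i 1 s)) +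
      p.wave (q.ε i) 3 s (low (q.R i) (H.forcing i 3 s)) := c1.add c3
  have hb := p.isSkew_fSym (q.ε i) 0
  rw [train, D, h1, h3, h5]
  unfold trainForcing
  rw [integral_sg_add hb c13 c5, integral_sg_add hb c1 c3]
  simp only [add_assoc]

/-- The real wave train of the first and third harmonics. -/
def approx (i : ι) (t : ℝ) : FL d n :=
  twoRe (p.wave (q.ε i) 1 t (H.U i 1 t) + p.wave (q.ε i) 3 t (H.U i 3 t))

/-- The residual of the wave train. -/
def residual (i : ι) (t : ℝ) : FL d n :=
  p.wave (q.ε i) 7 t (H.N i 7 t) + p.wave (q.ε i) 9 t (H.N i 9 t) +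
    p.wave (q.ε i) 5 t (H.N i 5 t - low (q.R i) (H.N i 5 t)) -
    p.wave (q.ε i) 1 t (H.defect i 1 t) - p.wave (q.ε i) 3 t (H.defect i 3 t)

lemma ev_nl (x : Sp d) (a b c : FL d n) : NLDispersive.ev x (p.nl a b c) =
    extT p.T (NLDispersive.ev x a) (NLDispersive.ev x b) (NLDispersive.ev x c) :=
  ev_tri p.tT a b c x

lemma ev_envSum (x : Sp d) (j : ℤ) (V : ℤ → FL d n) : NLDispersive.ev x (envSum p.nl j V) =
    ∑ J ∈ triads j, extT p.T (NLDispersive.ev x (V J.1)) (NLDispersive.ev x (V J.2.1))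
      (NLDispersive.ev x (V J.2.2)) := by
  rw [envSum, map_sum]
  exact Finset.sum_congr rfl fun J _ => ev_nl x _ _ _

lemma ev_wave_train (ε t : ℝ) (x : Sp d) {V : ℤ → FL d n} (h1 : V (-1) = conjOp (V 1))
    (h3 : V (-3) = conjOp (V 3)) :
    NLDispersive.ev x (twoRe (p.wave ε 1 t (V 1) + p.wave ε 3 t (V 3))) =
      ∑ j ∈ harmonics 3, carrier p.κ p.ω ε j t x • NLDispersive.ev x (V j) := by
  rw [sum_carrier p.κ p.ω ε t x (e := fun j => NLDispersive.ev x (V j))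
    (by simp only [h1, ev_conjOp]) (by simp only [h3, ev_conjOp]), ev_twoRe, map_add, ev_wave,
    ev_wave]

lemma nl_approx (i : ι) (t : ℝ) : p.nl (H.approx i t) (H.approx i t) (H.approx i t) =
    twoRe (∑ m ∈ cubicHarmonics, p.wave (q.ε i) m t (H.N i m t)) := by
  apply ev_injective
  intro x
  have h1 : H.U i (-1) t = conjOp (H.U i 1 t) := rfl
  have h3 : H.U i (-3) t = conjOp (H.U i 3 t) := rfl
  have e : NLDispersive.ev x (H.approx i t) = _ :=
    ev_wave_train (q.ε i) t x (V := fun j => H.U i j t) h1 h3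
  rw [ev_nl, e, cubic_wave_train (isTrilinear_extT p.T) (extT_conjV p.T) p.κ p.ω (q.ε i) t x
    (by rw [h1, ev_conjOp]) (by rw [h3, ev_conjOp]), ev_twoRe, map_sum]
  simp only [ev_wave, N, ev_envSum]

-- The harmonics 1, 3 and 5 generated by the approximation are matched by the forcing of the train,
-- up to defects and high frequencies; 7 and 9 remain. The nonlinearity is evaluated without the
-- fifth harmonic, which is small enough to be treated as a perturbation later.
set_option maxHeartbeats 400000 in
lemma smul_nl_approx (i : ι) (t : ℝ) :
    q.ε i • p.nl (H.approx i t) (H.approx i t) (H.approx i t) =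
      twoRe (H.trainForcing i t) + q.ε i • twoRe (H.residual i t) := by
  have hsum : ∀ f : ℤ → FL d n, ∑ m ∈ cubicHarmonics, f m = f 1 + (f 3 + (f 5 + (f 7 + f 9))) := by
    intro f
    rw [cubicHarmonics, Finset.sum_insert (by decide), Finset.sum_insert (by decide),
      Finset.sum_insert (by decide), Finset.sum_insert (by decide), Finset.sum_singleton]
  have hs : ∀ (L : FL d n →L[ℂ] FL d n) (c : ℝ) (v : FL d n), L (c • v) = c • L v := fun L c v =>
    (L.restrictScalars ℝ).map_smul c v
  rw [nl_approx, hsum, ← map_smul, ← map_smul, ← map_add]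
  congr 1
  rw [trainForcing, residual, ← H.smul_defect, ← H.smul_defect]
  simp only [hs, map_add, map_sub, smul_add, smul_sub]
  simp only [N]
  abel

end Envelopes

end Problem

/-! ### ### The error estimate on the Fourier side -/

namespace Params

variable {ι : Type*} (q : Params ι) {S : ℝ}

lemma UB_twoRe {g : ι → ℝ → ℝ} {v : ι → ℝ → FL d n} (h : (q.frame d n).UB S 0 g v) :
    (q.frame d n).UB S 0 g fun i t => twoRe (v i t) := by
  obtain ⟨C, hC, h⟩ := h
  refine ⟨2 * C, by positivity, fun i t h0 h1 => ?_⟩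
  have h2 := h i t h0 h1
  rw [Frame.N_zero] at h2 ⊢
  linarith [norm_twoRe_le (v i t)]

lemma setOf_horizon (i : ι) : {t | 0 ≤ t ∧ t * (q.frame d n).ε i ≤ S} = Icc 0 (S / q.ε i) := by
  ext t; exact q.mem_horizon.symm

end Params

namespace Problem

lemma norm_nl_le [NeZero n] (p : Problem d n) : ∃ c, 0 ≤ c ∧
    ∀ a b e, ‖p.nl a b e‖ ≤ c * ‖a‖ * ‖b‖ * ‖e‖ := by
  obtain ⟨c, hc, h⟩ := (⟨fun _ => 1, fun _ => one_pos, fun _ => le_rfl⟩ :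
    Params Unit).triBdd_tri (d := d) p.tT
  refine ⟨c, hc, fun a b e => ?_⟩
  have := h () 0 a b e
  simp only [Frame.N_zero] at this
  exact this

variable [NeZero n] {p : Problem d n} {ι : Type*} {q : Params ι}

namespace Envelopes

open NLDispersive.Frame

variable {S S' : ℝ}

lemma UB_wave (p : Problem d n) (j : ℤ) {g : ι → ℝ → ℝ} {v : ι → ℝ → FL d n} (h : (q.frame d n).UB S 0 g v) :
    (q.frame d n).UB S 0 g fun i t => p.wave (q.ε i) j t (v i t) := by
  obtain ⟨C, hC, h⟩ := h
  refine ⟨C, hC, fun i t h0 h1 => ?_⟩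
  have h2 := h i t h0 h1
  rw [N_zero] at h2 ⊢
  exact (p.norm_wave _ _ _ _).trans_le h2

variable (H : p.Envelopes q S)

-- The harmonics 7 and 9 contain two factors `U_{±3} = O(ε²)`. The other contributions are
-- truncation errors, of order ε⁴ after giving up one derivative.
set_option maxHeartbeats 1000000 in
lemma bound_residual (hS : 0 < S) (hS' : S' ≤ S)
    (hV : ∀ j ∈ harmonics 3, (q.frame d n).UB S' 3 ((q.frame d n).E 0) fun i => H.V i j)
    (h3 : (q.frame d n).UB S' 1 ((q.frame d n).E 2) fun i => H.U i 3) :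
    (q.frame d n).UB S' 0 ((q.frame d n).E 4) H.residual := by
  have hN : ∀ m : ℤ, m = 7 ∨ m = 9 →
      (q.frame d n).UB S' 0 ((q.frame d n).E 4) fun i => H.N i m := by
    intro m hm
    have key : ∀ J ∈ triads m, (q.frame d n).UB S' 0 ((q.frame d n).E 4)
        fun i t => p.nl (H.U i J.1 t) (H.U i J.2.1 t) (H.U i J.2.2 t) := by
      intro J hJ
      obtain ⟨j1, j2, j3⟩ := mem_of_mem_triads hJ
      have h0 : (q.frame d n).UB S' 0 ((q.frame d n).E 2) fun i =>
          (H.sol hS hS' hV).U i 3 := h3.mono_s zero_le_one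
      exact (H.sol hS hS' hV).bound_tri_of_two_three (Nat.zero_le 3) h0 j1 j2 j3
        (triads_seven_nine hm J hJ)
    exact (UB.sum (triads m) (E_nonneg 4) key).congr fun i t => rfl
  have hN5 : (q.frame d n).UB S' 0 ((q.frame d n).E 4)
      fun i t => H.N i 5 t - low (q.R i) (H.N i 5 t) :=
    q.UB_sub_low (s := 0) ((UB.envSum (q.triBdd_tri (d := d) p.tT)
      (fun j hj => H.bound_U hS hS' hV hj) 5).mono_s (by omega))
  have hd : ∀ j, (q.frame d n).UB S' 0 ((q.frame d n).E 4) fun i => H.defect i j := fun j =>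
    (H.bound_defect hS hS' hV j).mono_s (by omega)
  exact ((((UB_wave p 7 (hN 7 (Or.inl rfl))).add (UB_wave p 9 (hN 9 (Or.inr rfl)))).add
    (UB_wave p 5 hN5)).sub (UB_wave p 1 (hd 1))).sub (UB_wave p 3 (hd 3))

/-- On a short time interval, the third harmonic is `O(ε²)` and the fifth one is `O(ε³)`. -/
lemma exists_bound_fast (hS : 0 < S) : ∃ S', 0 < S' ∧ S' ≤ S ∧
    (∀ j ∈ harmonics 3, (q.frame d n).UB S' 3 ((q.frame d n).E 0) fun i => H.V i j) ∧
    ((q.frame d n).UB S' 1 ((q.frame d n).E 2) fun i => H.U i 3) ∧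
    (q.frame d n).UB S' 0 ((q.frame d n).E 3) H.D := by
  obtain ⟨S₁, h1, hle1, hV⟩ := H.exists_bound hS
  obtain ⟨S₂, h2, hle2, hy, -⟩ := (H.sol hS hle1 hV).fast_order_one h1
  obtain ⟨S₃, h3, hle3, hU⟩ := ((H.sol hS hle1 hV).anti hle2).third_order_two h2 hy
  refine ⟨S₃, h3, hle3.trans (hle2.trans hle1), fun j hj => (hV j hj).anti (hle3.trans hle2), hU, ?_⟩
  exact (((H.sol hS hle1 hV).anti hle2).anti hle3).fifth_order_three h3 (hy.anti hle3) hU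
    (fun i t => H.hasDerivAt_D hS i t) fun i => (p.isGroup q 5 i).duhamel_zero _ _

lemma norm_init_le : ∃ C, 0 ≤ C ∧ ∀ i j, ‖H.init i j‖ ≤ C := by
  obtain ⟨C, hC, h⟩ := H.bound_init
  refine ⟨C, hC, fun i j => ?_⟩
  rw [← (q.frame d n).N_zero i]
  exact ((q.frame d n).N_mono i (by omega) _).trans (h i j)

lemma norm_init_sub_low_le : ∃ C, 0 ≤ C ∧ ∀ i j,
    ‖H.init i j - low (q.R i) (H.init i j)‖ ≤ C * q.ε i ^ 4 := by
  obtain ⟨C, hC, h⟩ := H.bound_init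
  refine ⟨C, hC, fun i j => ?_⟩
  have h1 := wnorm_sub_low_le (q.R_pos i) 0 (H.init i j)
  have h3 : (q.R i)⁻¹ = q.ε i ^ 4 := inv_inv _
  rw [h3, wnorm_zero, mul_comm] at h1
  refine h1.trans (mul_le_mul_of_nonneg_right ?_ (pow_nonneg (q.pos i).le 4))
  rw [← q.frame_N]
  exact ((q.frame d n).N_mono i (by omega) _).trans (h i j)

namespace Original

variable {H} (O : H.Original)

lemma continuousOn_nl {i : ι} :
    ContinuousOn (fun s => q.ε i • p.nl (O.u i s) (O.u i s) (O.u i s)) (Icc 0 (S / q.ε i)) :=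
  (((p.nl.continuous.comp_continuousOn (O.cont i)).clm_apply (O.cont i)).clm_apply
    (O.cont i)).const_smul (q.ε i)

lemma exists_bound (hS : 0 < S) : ∃ S', 0 < S' ∧ S' ≤ S ∧
    (q.frame d n).UB S' 0 ((q.frame d n).E 0) O.u := by
  obtain ⟨C, hC, hinit⟩ := H.norm_init_le
  obtain ⟨c, hc, hT⟩ := p.norm_nl_le
  obtain ⟨S', hS', hle, C', hC', hb⟩ := (q.frame d n).bootstrap hS (φ := fun i t => ‖O.u i t‖)
    (fun i => by rw [q.setOf_horizon]; exact (O.cont i).norm) (fun i t => norm_nonneg _)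
    ⟨2 * C + c, by positivity, fun i t h0 h1 M hM hr => by
      have ht : t ∈ Icc 0 (S / q.ε i) := q.mem_horizon.2 ⟨h0, h1⟩
      have hε := q.pos i
      have h := sg_integral_bound (p.isSkew_fSym (q.ε i) 0) (q.R_pos i).le 0 h0
        (O.continuousOn_nl.mono (Icc_subset_Icc le_rfl ht.2)) (m := q.ε i * (c * M ^ 3))
        (fun r hrt => by
          rw [wnorm_zero, norm_smul, Real.norm_of_nonneg hε.le]
          refine mul_le_mul_of_nonneg_left ((hT _ _ _).trans ?_) hε.le
          have := hr r hrt
          calc c * ‖O.u i r‖ * ‖O.u i r‖ * ‖O.u i r‖ ≤ c * M * M * M := by gcongr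
            _ = c * M ^ 3 := by ring)
        (twoRe (p.wave (q.ε i) 1 0 (H.init i 1)))
      rw [← O.duhamel i t ht, wnorm_zero, wnorm_zero] at h
      have h2 := norm_twoRe_le (p.wave (q.ε i) 1 0 (H.init i 1))
      rw [norm_wave] at h2
      have h3 := hinit i 1
      have h4 : 0 ≤ t * q.ε i * M ^ 3 := by positivity
      change ‖O.u i t‖ ≤ _ + _ * (t * q.ε i) * M ^ 3
      nlinarith⟩
  refine ⟨S', hS', hle, C', hC', fun i t h0 h1 => ?_⟩
  simp only [Frame.E, pow_zero, mul_one, N_zero]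
  exact hb i t h0 h1

set_option maxHeartbeats 1000000 in
/-- The equation for the error of the wave train. -/
lemma sub_train_duhamel (hS : 0 < S) (i : ι) {t : ℝ} (ht : t ∈ Icc 0 (S / q.ε i)) :
    O.u i t - twoRe (H.train i t) = sg (p.fSym (q.ε i) 0) t
      (twoRe (p.wave (q.ε i) 1 0 (H.init i 1 - low (q.R i) (H.init i 1)))) +
      ∫ s in (0 : ℝ)..t, sg (p.fSym (q.ε i) 0) (t - s)
        (q.ε i • p.nl (O.u i s) (O.u i s) (O.u i s) - twoRe (H.trainForcing i s)) := by
  have hb := p.isSkew_fSym (q.ε i) 0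
  have hsub : Icc 0 t ⊆ Icc 0 (S / q.ε i) := Icc_subset_Icc le_rfl ht.2
  have hi : ∀ {f : ℝ → FL d n}, ContinuousOn f (Icc 0 t) →
      IntervalIntegrable (fun s => sg (p.fSym (q.ε i) 0) (t - s) (f s)) volume 0 t := fun hf =>
    ((continuousOn_sg_apply hb hf t).mono (by rw [uIcc_of_le ht.1])).intervalIntegrable
  have hc := H.continuous_trainForcing hS i
  have hc2 : Continuous fun s => twoRe (H.trainForcing i s) := twoRe.continuous.comp hc
  have h2 : twoRe (H.train i t) = sg (p.fSym (q.ε i) 0) t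
      (twoRe (p.wave (q.ε i) 1 0 (low (q.R i) (H.init i 1)))) +
      ∫ s in (0 : ℝ)..t, sg (p.fSym (q.ε i) 0) (t - s) (twoRe (H.trainForcing i s)) := by
    rw [H.train_duhamel hS, map_add, ← p.twoRe_sg,
      ← ContinuousLinearMap.intervalIntegral_comp_comm _ (hi hc.continuousOn)]
    simp only [p.twoRe_sg]
  rw [O.duhamel i t ht, h2]
  simp only [map_sub]
  rw [intervalIntegral.integral_sub (hi (O.continuousOn_nl.mono hsub)) (hi hc2.continuousOn)]
  abel

lemma bound_fifth (hD : (q.frame d n).UB S' 0 ((q.frame d n).E 3) H.D) :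
    (q.frame d n).UB S' 0 ((q.frame d n).E 3)
      fun i t => twoRe (p.wave (q.ε i) 5 t (low (q.R i) (H.D i t))) :=
  q.UB_twoRe (UB_wave p 5 (q.UB_low hD))

lemma twoRe_train (i : ι) (t : ℝ) : twoRe (H.train i t) =
    H.approx i t + twoRe (p.wave (q.ε i) 5 t (low (q.R i) (H.D i t))) := by
  rw [train, map_add, approx]

-- The difference of u and the train is driven by ε times a Lipschitz term in u - `approx` and by ε
-- times the residual. Over times of order 1/ε this yields `O(ε³)` plus a multiple of the running
-- maximum with factor tε, which is absorbed on a shorter interval.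
set_option maxHeartbeats 2000000 in
lemma exists_bound_sub_train (hS : 0 < S) : ∃ S', 0 < S' ∧ S' ≤ S ∧
    (∀ j ∈ harmonics 3, (q.frame d n).UB S' 3 ((q.frame d n).E 0) fun i => H.V i j) ∧
    ((q.frame d n).UB S' 0 ((q.frame d n).E 3) H.D) ∧
    (q.frame d n).UB S' 0 ((q.frame d n).E 3) fun i t => O.u i t - twoRe (H.train i t) := by
  obtain ⟨S₁, h1, hle1, hu⟩ := O.exists_bound hS
  obtain ⟨S₂, h2, hle2, hV, h3, hD⟩ := H.exists_bound_fast hS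
  set S₀ := min S₁ S₂ with hS₀
  have h0 : 0 < S₀ := lt_min h1 h2
  have hle0 : S₀ ≤ S := (min_le_left _ _).trans hle1
  replace hu := hu.anti (min_le_left S₁ S₂)
  replace hV := fun j hj => (hV j hj).anti (min_le_right S₁ S₂)
  replace h3 := h3.anti (min_le_right S₁ S₂)
  replace hD := hD.anti (min_le_right S₁ S₂)
  obtain ⟨Ca, hCa, ha⟩ : (q.frame d n).UB S₀ 0 ((q.frame d n).E 0) H.approx :=
    q.UB_twoRe ((UB_wave p 1 ((H.bound_U hS hle0 hV (by decide)).mono_s (by omega))).add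
      (UB_wave p 3 ((H.bound_U hS hle0 hV (by decide)).mono_s (by omega))))
  obtain ⟨Cu, hCu, hu⟩ := hu
  obtain ⟨Cr, hCr, hr⟩ := q.UB_twoRe (H.bound_residual hS hle0 hV h3)
  obtain ⟨C5, hC5, h5⟩ := bound_fifth hD
  obtain ⟨Ci, hCi, hi⟩ := H.norm_init_sub_low_le
  obtain ⟨c, hc, hT⟩ := p.norm_nl_le
  simp only [Frame.E, pow_zero, mul_one, N_zero] at hu ha hr h5
  set B := Ca + Cu with hB
  -- Local Lipschitz constant of the cubic nonlinearity on a ball containing both the solution and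
  -- the approximation.
  set K := 3 * c * B ^ 2 with hK
  have hK0 : 0 ≤ K := by positivity
  obtain ⟨S', hS', hle, C', hC', hb⟩ := (q.frame d n).absorb h0 (m := 3)
    (φ := fun i t => ‖O.u i t - twoRe (H.train i t)‖)
    (fun i => by
      rw [q.setOf_horizon]
      have hct : Continuous fun t => twoRe (H.train i t) := by
        refine twoRe.continuous.comp (((p.continuous_wave_apply _ 1 (H.continuous_U hS i
          (by decide))).add (p.continuous_wave_apply _ 3 (H.continuous_U hS i (by decide)))).add
          (p.continuous_wave_apply _ 5 ((low (q.R i)).continuous.comp ?_)))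
        exact continuous_iff_continuousAt.2 fun t => (H.hasDerivAt_D hS i t).continuousAt
      exact (((O.cont i).mono fun t ht => q.mem_horizon_of_le hle0 ht.1
        (q.mem_horizon.1 ht).2).sub hct.continuousOn).norm)
    (fun i t => norm_nonneg _)
    -- 2Ci comes from the truncation of the initial data, doubled by adding the conjugate; S₀(K C5 +
    -- Cr) from the fifth harmonic and the residual integrated over a time S₀/ε; K is the
    -- coefficient of the running maximum.
    ⟨2 * Ci + S₀ * (K * C5 + Cr) + K, by positivity, fun i t ht0 ht1 M hM hr' => by
      have ht : t ∈ Icc 0 (S / q.ε i) := q.mem_horizon_of_le hle0 ht0 ht1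
      have hε := q.pos i
      have hε1 := q.le_one i
      change t * q.ε i ≤ S₀ at ht1
      have hle : ∀ r ∈ Icc 0 t, r * q.ε i ≤ S₀ := fun r hrt =>
        (mul_le_mul_of_nonneg_right hrt.2 hε.le).trans ht1
      have h4 : q.ε i ^ 4 ≤ q.ε i ^ 3 := pow_le_pow_of_le_one hε.le hε1 (by omega)
      have h := sg_integral_bound (p.isSkew_fSym (q.ε i) 0) (q.R_pos i).le 0 ht0
        (f := fun s => q.ε i • p.nl (O.u i s) (O.u i s) (O.u i s) - twoRe (H.trainForcing i s))
        ((O.continuousOn_nl.mono (Icc_subset_Icc le_rfl ht.2)).sub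
          (twoRe.continuous.comp (H.continuous_trainForcing hS i)).continuousOn)
        (m := q.ε i * (K * (M + C5 * q.ε i ^ 3) + Cr * q.ε i ^ 3))
        (fun r hrt => by
          have e : q.ε i • p.nl (O.u i r) (O.u i r) (O.u i r) - twoRe (H.trainForcing i r) =
              q.ε i • (p.nl (O.u i r) (O.u i r) (O.u i r) -
                p.nl (H.approx i r) (H.approx i r) (H.approx i r) + twoRe (H.residual i r)) := by
            rw [smul_add, smul_sub, H.smul_nl_approx]
            abel
          rw [wnorm_zero, e, norm_smul, Real.norm_of_nonneg hε.le]
          refine mul_le_mul_of_nonneg_left ((norm_add_le _ _).trans (add_le_add ?_ ?_)) hε.le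
          · refine (norm_trilinear_sub_le p.nl hc hT (B := B) ?_ ?_).trans
              (mul_le_mul_of_nonneg_left ?_ hK0)
            · linarith [hu i r hrt.1 (hle r hrt)]
            · linarith [ha i r hrt.1 (hle r hrt)]
            -- The nonlinearity sees the distance to the train without its fifth harmonic, which
            -- adds `O(ε³)` to the error being estimated.
            · have e2 : O.u i r - H.approx i r = (O.u i r - twoRe (H.train i r)) +
                  twoRe (p.wave (q.ε i) 5 r (low (q.R i) (H.D i r))) := by
                rw [twoRe_train]; abel
              rw [e2]
              exact (norm_add_le _ _).trans (add_le_add (hr' r hrt) (h5 i r hrt.1 (hle r hrt)))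
          · exact (hr i r hrt.1 (hle r hrt)).trans (mul_le_mul_of_nonneg_left h4 hCr))
        (twoRe (p.wave (q.ε i) 1 0 (H.init i 1 - low (q.R i) (H.init i 1))))
      rw [← O.sub_train_duhamel hS i ht, wnorm_zero, wnorm_zero] at h
      have h6 := norm_twoRe_le (p.wave (q.ε i) 1 0 (H.init i 1 - low (q.R i) (H.init i 1)))
      rw [norm_wave] at h6
      have h7 := (hi i 1).trans (mul_le_mul_of_nonneg_left h4 hCi)
      have h8 : t * q.ε i * (K * C5 * q.ε i ^ 3 + Cr * q.ε i ^ 3) ≤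
          S₀ * (K * C5 * q.ε i ^ 3 + Cr * q.ε i ^ 3) :=
        mul_le_mul_of_nonneg_right ht1 (by positivity)
      have h9 : 0 ≤ K * q.ε i ^ 3 := by positivity
      have h10 : 0 ≤ (2 * Ci + S₀ * (K * C5 + Cr)) * (t * q.ε i * M) := by positivity
      change ‖O.u i t - twoRe (H.train i t)‖ ≤ _ * q.ε i ^ 3 + _ * (t * q.ε i) * M
      linear_combination h + h6 + 2 * h7 + h8 + h9 + h10⟩
  refine ⟨S', hS', hle.trans hle0, fun j hj => (hV j hj).anti hle, hD.anti hle, C', hC',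
    fun i t t0 t1 => ?_⟩
  rw [N_zero]
  exact hb i t t0 t1

/-- The wave train of the first and third harmonics approximates the solution up to `O(ε³)`. -/
theorem exists_bound_sub_approximation (hS : 0 < S) : ∃ S', 0 < S' ∧ S' ≤ S ∧
    ∃ C, 0 ≤ C ∧ ∀ i, ∀ t ∈ Icc 0 (S' / q.ε i), ‖O.u i t -
      twoRe (p.wave (q.ε i) 1 t (H.V i 1 t) + p.wave (q.ε i) 3 t (H.V i 3 t))‖ ≤
        C * q.ε i ^ 3 := by
  obtain ⟨S', hS', hle, hV, hD, hu⟩ := O.exists_bound_sub_train hS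
  have hVU : ∀ j ∈ harmonics 3, (q.frame d n).UB S' 0 ((q.frame d n).E 3)
      fun i t => H.V i j t - H.U i j t := fun j hj =>
    ((H.bound_V_sub_U hS hle hV hj).mono_s (by omega)).mono_E (by omega)
  obtain ⟨C, hC, h⟩ : (q.frame d n).UB S' 0 ((q.frame d n).E 3) fun i t => O.u i t -
      twoRe (p.wave (q.ε i) 1 t (H.V i 1 t) + p.wave (q.ε i) 3 t (H.V i 3 t)) := by
    -- The error against the actual envelopes consists of the error of the train, the fifth harmonic
    -- and the high frequencies V - U, each `O(ε³)`.
    refine ((hu.add (bound_fifth hD)).sub (q.UB_twoRe ((UB_wave p 1 (hVU 1 (by decide))).add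
      (UB_wave p 3 (hVU 3 (by decide)))))).congr fun i t => ?_
    rw [twoRe_train, approx]
    simp only [map_add, map_sub]
    abel
  refine ⟨S', hS', hle, C, hC, fun i t ht => ?_⟩
  have := h i t (q.mem_horizon.1 ht).1 (q.mem_horizon.1 ht).2
  rwa [N_zero] at this

end Original

end Envelopes

end Problem

lemma ev_real_smul (x : Sp d) (c : ℝ) (v : FL d n) : ev x (c • v) = (c : ℂ) • ev x v := by
  rw [← map_smul]
  congr 1

/-! ### ### Return to functions in the Wiener algebra -/

namespace Problem

variable [NeZero n] (p : Problem d n)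

/-- Mild solutions of the original problem and of the envelope equations, for some `ε`. -/
structure Run (p₀ p₁ : Sp d → Vec n) (S : ℝ) where
  ε : ℝ
  pos : 0 < ε
  le_one : ε ≤ 1
  u : ℝ → Sp d → Vec n
  U : ℤ → ℝ → Sp d → Vec n
  original : SolvesOriginal p.A p.E p.T p.κ ε (fun x => p₀ x + (ε : ℂ) • p₁ x) (S / ε) u
  envelope : SolvesEnvelope p.A p.E p.T 3 p.κ p.ω ε (fun x => p₀ x + (ε : ℂ) • p₁ x) (S / ε) U

namespace Run

variable {p} {p₀ p₁ : Sp d → Vec n} {S : ℝ}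

variable (p p₀ p₁ S) in
/-- The parameters of all runs. -/
def params : Params (p.Run p₀ p₁ S) := ⟨Run.ε, Run.pos, Run.le_one⟩

lemma exists_lift_envelope (r : p.Run p₀ p₁ S) : ∃ V : ℤ → ℝ → FL d n,
    (∀ j, ContinuousOn (V j) (Icc 0 (S / r.ε))) ∧
    (∀ j, 0 < j → ∀ t, V (-j) t = conjOp (V j t)) ∧
    ∀ j ∈ harmonics 3, ∀ t ∈ Icc 0 (S / r.ε), ∀ x, r.U j t x = NLDispersive.ev x (V j t) := by
  obtain ⟨V₁, h1, hc1⟩ := (r.envelope.2 1 (by decide) one_pos).1.exists_lift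
  obtain ⟨V₃, h3, hc3⟩ := (r.envelope.2 3 (by decide) (by norm_num)).1.exists_lift
  -- Only the harmonics ±1 and ±3 carry information; the value 0 elsewhere makes continuity and the
  -- conjugation rule hold for every index.
  set V : ℤ → ℝ → FL d n := fun j => if j = 1 then V₁ else if j = 3 then V₃ else fun _ => 0 with hV
  have hVc : ∀ j, ContinuousOn (V j) (Icc 0 (S / r.ε)) := by
    intro j
    simp only [hV]
    split_ifs
    · exact hc1
    · exact hc3
    · exact continuousOn_const
  refine ⟨fun j t => if 0 < j then V j t else conjOp (V (-j) t), fun j => ?_, fun j hj t => ?_,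
    fun j hj t ht x => ?_⟩
  · have hcj : ContinuousOn (fun t => conjOp (V (-j) t)) (Icc 0 (S / r.ε)) :=
      conjOp.continuous.comp_continuousOn (hVc (-j))
    by_cases hj : 0 < j
    · simpa only [if_pos hj] using hVc j
    · simpa only [if_neg hj] using hcj
  · have : ¬ 0 < -j := by omega
    simp only [if_neg this, if_pos hj, neg_neg]
  · rcases mem_harmonics_three.1 hj with rfl | rfl | rfl | rfl
    · exact h1 t ht x
    · rw [r.envelope.1 1 (by decide) t ht x, h1 t ht x, ← ev_conjOp]
      rfl
    · exact h3 t ht x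
    · rw [r.envelope.1 3 (by decide) t ht x, h3 t ht x, ← ev_conjOp]
      rfl

lemma ev_forcing (r : p.Run p₀ p₁ S) {V : ℤ → ℝ → FL d n} {t : ℝ} (x : Sp d)
    (h : ∀ j ∈ harmonics 3, r.U j t x = NLDispersive.ev x (V j t)) (j : ℤ) :
    (r.ε : ℂ) • envelopeT p.T 3 r.U j t x =
      NLDispersive.ev x (r.ε • envSum p.nl j fun l => V l t) := by
  rw [ev_real_smul, Envelopes.ev_envSum, envelopeT]
  congr 1
  refine Finset.sum_congr rfl fun J hJ => ?_
  obtain ⟨j1, j2, j3⟩ := mem_of_mem_triads hJ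
  rw [h _ j1, h _ j2, h _ j3]

/-- All runs share the lifts of `p₀` and `p₁`, and only the combination with ε varies. This makes
the bounds of the data, and with them all later constants, independent of the run. -/
lemma exists_envelopes (hp₀ : MemWs 3 p₀) (hp₁ : MemWs 3 p₁)
    (hpol : ∀ᵐ x, mulV (symbolL p.A p.E p.ω p.κ) (p₀ x) = 0) :
    ∃ H : p.Envelopes (params p p₀ p₁ S) S, (∀ x, p₀ x = NLDispersive.ev x H.v₀) ∧
      (∀ x, p₁ x = NLDispersive.ev x H.v₁) ∧
      ∀ r, ∀ j ∈ harmonics 3, ∀ t ∈ Icc 0 (S / r.ε), ∀ x,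
        r.U j t x = NLDispersive.ev x (H.V r j t) := by
  obtain ⟨v₀, h0, hb0⟩ := hp₀.exists_lift
  obtain ⟨v₁, h1, hb1⟩ := hp₁.exists_lift
  choose V hc hconj hV using fun r : p.Run p₀ p₁ S => r.exists_lift_envelope
  have hinit : ∀ (r : p.Run p₀ p₁ S) x, p₀ x + (r.ε : ℂ) • p₁ x =
      NLDispersive.ev x (v₀ + r.ε • v₁) := fun r x => by
    rw [map_add, ev_real_smul, h0, h1]
  have hcn : ∀ (r : p.Run p₀ p₁ S) j, ContinuousOn
      (fun s => r.ε • envSum p.nl j fun l => V r l s) (Icc 0 (S / r.ε)) := fun r j =>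
    (continuousOn_envSum p.nl j fun l _ => hc r l).const_smul r.ε
  refine ⟨⟨v₀, v₁, hb0, hb1, ?_, V, hc, hconj, fun r t ht => ?_, fun r t ht => ?_⟩, h0, h1, hV⟩
  · refine mulOp_const_eq_zero ?_
    filter_upwards [hpol] with x hx
    rw [← h0, p.L_one, _root_.smul_apply, cl_apply, hx, smul_zero]
  · refine (r.envelope.2 1 (by decide) one_pos).duhamel (p.isSkew_fSym _ _) (fun k => ?_)
      (fun x => ?_) (hV r 1 (by decide))
      (fun s hs x => r.ev_forcing x (fun j hj => hV r j hj s hs x) 1) (hcn r 1) ht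
    · rw [fSym_eq_cl, Int.cast_one]
      rfl
    · rw [if_pos rfl]
      exact hinit r x
  · refine (r.envelope.2 3 (by decide) (by norm_num)).duhamel (p.isSkew_fSym _ _) (fun k => ?_)
      (fun x => ?_) (hV r 3 (by decide))
      (fun s hs x => r.ev_forcing x (fun j hj => hV r j hj s hs x) 3) (hcn r 3) ht
    · rw [fSym_eq_cl, Int.cast_ofNat]
      rfl
    · rw [if_neg (by norm_num), map_zero]
      rfl

lemma exists_original (H : p.Envelopes (params p p₀ p₁ S) S)
    (h0 : ∀ x, p₀ x = NLDispersive.ev x H.v₀) (h1 : ∀ x, p₁ x = NLDispersive.ev x H.v₁) :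
    ∃ O : H.Original, ∀ r, ∀ t ∈ Icc 0 (S / r.ε), ∀ x, r.u t x = NLDispersive.ev x (O.u r t) := by
  choose v hv hc using fun r : p.Run p₀ p₁ S => r.original.1.exists_lift
  refine ⟨⟨v, hc, fun r t ht => ?_⟩, hv⟩
  refine r.original.duhamel (p.isSkew_fSym _ _) (p.fSym_zero _) (fun x => ?_) (hv r)
    (fun s hs x => ?_) ?_ ht
  · have hcar : carrier p.κ 0 r.ε 1 0 x = carrier p.κ p.ω r.ε 1 0 x := by simp [carrier]
    have hi : NLDispersive.ev x (H.init r 1) = p₀ x + (r.ε : ℂ) • p₁ x := by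
      rw [Envelopes.init, if_pos rfl, map_add, ev_real_smul, ← h0, ← h1]
      rfl
    rw [ev_twoRe, ev_wave, hi, hcar]
    rfl
  · change _ = NLDispersive.ev x (r.ε • p.nl (v r s) (v r s) (v r s))
    rw [ev_real_smul, Envelopes.ev_nl, hv r s hs x]
  · exact (((p.nl.continuous.comp_continuousOn (hc r)).clm_apply (hc r)).clm_apply
      (hc r)).const_smul r.ε

end Run

/-- The error bound for the approximation by the first and third harmonics. -/
theorem error_bound {p₀ p₁ : Sp d → Vec n} (hp₀ : MemWs 3 p₀) (hp₁ : MemWs 3 p₁)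
    (hpol : ∀ᵐ x, mulV (symbolL p.A p.E p.ω p.κ) (p₀ x) = 0) {S : ℝ} (hS : 0 < S) :
    ∃ S', 0 < S' ∧ S' ≤ S ∧ ∃ C, 0 ≤ C ∧ ∀ r : p.Run p₀ p₁ S, ∀ t ∈ Icc 0 (S' / r.ε),
      ∃ v : FL d n, ‖v‖ ≤ C * r.ε ^ 3 ∧
        ∀ x, r.u t x - approximation 3 p.κ p.ω r.ε r.U t x = NLDispersive.ev x v := by
  obtain ⟨H, h0, h1, hV⟩ := Run.exists_envelopes (S := S) hp₀ hp₁ hpol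
  obtain ⟨O, hO⟩ := Run.exists_original H h0 h1
  obtain ⟨S', hS', hle, C, hC, h⟩ := O.exists_bound_sub_approximation hS
  refine ⟨S', hS', hle, C, hC, fun r t ht => ⟨_, h r t ht, fun x => ?_⟩⟩
  have ht' : t ∈ Icc 0 (S / r.ε) :=
    ⟨ht.1, ht.2.trans (div_le_div_of_nonneg_right hle r.pos.le)⟩
  have e := Envelopes.ev_wave_train (p := p) r.ε t x (V := fun j => H.V r j t)
    (H.conj r 1 one_pos t) (H.conj r 3 (by norm_num) t)
  rw [map_sub, hO r t ht' x]
  congr 1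
  refine Eq.trans ?_ e.symm
  exact Finset.sum_congr rfl fun j hj => by rw [hV r j hj t ht' x]

end Problem

/-- The supremum of an inverse Fourier transform is bounded by the `L¹` norm, so the second estimate
of the theorem follows from the first. -/
lemma eLpNorm_ev_le (v : FL d n) :
    eLpNorm (fun x => ev x v) ⊤ volume ≤ ENNReal.ofReal (fourierConst d * ‖v‖) := by
  rw [eLpNorm_exponent_top]
  refine eLpNormEssSup_le_of_ae_bound (ae_of_all _ fun x => norm_ev_le x v)

end NLDispersive

end

/-! ### ### The theorem -/

theorem theorem5p5 {d n : ℕ} [NeZero n]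
    (A : Fin d → Matrix (Fin n) (Fin n) ℝ) (hA : ∀ l, (A l).IsSymm)
    (E : Matrix (Fin n) (Fin n) ℝ) (hE : E.transpose = -E)
    (T : NLDispersive.Trilin n)
    (κ : NLDispersive.Sp d) (hκ : κ ≠ 0) (ω : ℝ)
    -- the kernel of `𝓛(ω, κ)` is one-dimensional (in particular `ω` is an eigenvalue)
    (hker : Module.finrank ℂ
      (LinearMap.ker (Matrix.toLin' (NLDispersive.symbolL A E ω κ))) = 1)
    -- initial data `p = p₀ + ε p₁` with `p₀, p₁ ∈ W³` and polarized `p₀`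
    (p₀ p₁ : NLDispersive.Sp d → NLDispersive.Vec n)
    (hp₀ : NLDispersive.MemWs 3 p₀) (hp₁ : NLDispersive.MemWs 3 p₁)
    (hpol : ∀ᵐ x, NLDispersive.mulV (NLDispersive.symbolL A E ω κ) (p₀ x) = 0)
    -- eigendecomposition of `𝓛(0, β)`
    (w : Fin n → NLDispersive.Sp d → ℝ)
    (ψ : Fin n → NLDispersive.Sp d → NLDispersive.Vec n)
    (heig : NLDispersive.IsSmoothEigendecomposition A E κ ω w ψ)
    -- non-resonance conditions
    (hres3 : NLDispersive.NonResonant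
      (NLDispersive.symbolL A E (3 * ω) ((3 : ℝ) • κ)) (NLDispersive.symbolL A E ω κ))
    (hres5 : NLDispersive.NonResonant
      (NLDispersive.symbolL A E (5 * ω) ((5 : ℝ) • κ))
      (NLDispersive.symbolL A E (3 * ω) ((3 : ℝ) • κ)))
    (tend : ℝ) (htend : 0 < tend) :
    ∃ tstar : ℝ, 0 < tstar ∧ tstar ≤ tend ∧ ∃ C : ℝ, 0 < C ∧
      ∀ ε : ℝ, 0 < ε → ε ≤ 1 →
      ∀ (u : ℝ → NLDispersive.Sp d → NLDispersive.Vec n)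
        (U : ℤ → ℝ → NLDispersive.Sp d → NLDispersive.Vec n),
        NLDispersive.SolvesOriginal A E T κ ε (fun x => p₀ x + (ε : ℂ) • p₁ x) (tend / ε) u →
        NLDispersive.SolvesEnvelope A E T 3 κ ω ε (fun x => p₀ x + (ε : ℂ) • p₁ x)
          (tend / ε) U →
        ∀ t ∈ Set.Icc 0 (tstar / ε),
          NLDispersive.normW
              (fun x => u t x - NLDispersive.approximation 3 κ ω ε U t x)
            ≤ ENNReal.ofReal (C * ε ^ 3) ∧
          MeasureTheory.eLpNorm
              (fun x => u t x - NLDispersive.approximation 3 κ ω ε U t x) ⊤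
              MeasureTheory.volume
            ≤ ENNReal.ofReal (C * ε ^ 3) := by
  let p : NLDispersive.Problem d n := ⟨A, hA, E, hE, T, κ, ω, w, ψ, heig, hres3, hres5⟩
  obtain ⟨S, hS, hle, C, hC, h⟩ := p.error_bound hp₀ hp₁ hpol htend
  have hF := NLDispersive.fourierConst_pos (d := d)
  -- One constant serves both norms: C for the Wiener norm, C times the Fourier normalization for
  -- the supremum norm, and 1 to make it positive.
  refine ⟨S, hS, hle, C + NLDispersive.fourierConst d * C + 1, by positivity,
    fun ε hε hε1 u U hu hU t ht => ?_⟩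
  obtain ⟨v, hv, he⟩ := h ⟨ε, hε, hε1, u, U, hu, hU⟩ t ht
  change ‖v‖ ≤ C * ε ^ 3 at hv
  have he' : (fun x => u t x - NLDispersive.approximation 3 κ ω ε U t x) =
      fun x => NLDispersive.ev x v := funext he
  have h3 : 0 ≤ ε ^ 3 := by positivity
  have hFC : 0 ≤ NLDispersive.fourierConst d * C := by positivity
  rw [he']
  constructor
  · rw [NLDispersive.normW_ev]
    refine ENNReal.ofReal_le_ofReal (hv.trans ?_)
    nlinarith
  · refine (NLDispersive.eLpNorm_ev_le v).trans (ENNReal.ofReal_le_ofReal ?_)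
    have := mul_le_mul_of_nonneg_left hv hF.le
    have := mul_nonneg hC h3
    nlinarith
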